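/- **Setting.** Let $U\subset\mathbb R^3$ be a bounded domain with $C^3$ boundary and outward unit normal $n$. Let $a,b,c\in\mathbb R$ satisfy $a>0$, $c>0$ and $ac\ge \tfrac{9}{16}b^2$. Greek indices run over $1,2,3$, repeated Greek indices are summed, and $|A|=(A_{\alpha\beta}A_{\alpha\beta})^{1/2}$ is the Frobenius norm. Consider $u:[0,\infty)\times U\to\mathbb R^3$, $\pi:[0,\infty)\times U\to\mathbb R$, and $Q$ on $[0,\infty)\times U$ with values in the symmetric traceless real $3\times3$ matrices, and the system $$ \begin{cases} (\partial_t+u_\gamma\partial_\gamma)Q_{\alpha\beta}=H_{\alpha\beta},\qquad H=-aQ+b\big[Q^2-\tfrac13\operatorname{tr}(Q^2)I\big]-cQ\operatorname{tr}(Q^2)+\Delta Q,\\ (\partial_t+u_\beta\partial_\beta)u_\alpha=\Delta u_\alpha+\partial_\alpha \pi-\partial_\beta(\partial_\alpha Q_{\zeta\delta}\,\partial_\beta Q_{\zeta\delta})+\partial_\beta(Q_{\alpha\gamma}\Delta Q_{\gamma\beta}-\Delta Q_{\alpha\gamma}Q_{\gamma\beta}),\\ \partial_\gamma u_\gamma=0,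 \end{cases} $$ with $(u,Q)|_{t=0}=(u_0,Q_0)$ and $(u,\partial_nQ)|_{\partial U}=(0,0)$. Let $1<m<\infty$, $2\le q<\infty$, $3\le r<\infty$. A *global strong solution* is a triple $(u,Q,\pi)$ such that, for all $T>0$, $$u\in C([0,T];L^q(U))\cap L^m(0,T;W^{2,q}(U)\cap W^{1,q}_0(U)),\quad \partial_tu\in L^m(0,T;L^q(U)),$$ $$Q\in C([0,T];L^r(U))\cap L^m(0,T;W^{3,r}(U)),\quad \partial_tQ\in L^m(0,T;W^{1,r}(U)),\qquad \pi\in L^m(0,T;W^{1,q}(U)),$$ which satisfies the three equations almost everywhere on $U\times(0,\infty)$, the initial conditions almost everywhere on $U$, and the condition $\partial_nQ=0$ on $\partial U$ in the sense of traces for almost every $t>0$. **Proposition.** Let $a,b,c$ be as above and let $2\le p<\infty$. There is a constant $C=C(a,b,c,p)>0$, independent of $U$, of the exponents $m,q,r$, of the data and of the solution, such that every global strong solution $(u,Q,\pi)$ with $Q_0\in L^p(U)$ satisfies $$\|Q(t,\cdot)\|_{L^p(U)}\le e^{-Ct}\,\|Q_0\|_{L^p(U)}\qquad\text{for all } t\ge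 0 .$$ -/

import Mathlib

open MeasureTheory Filter Topology Set
open scoped ENNReal ContDiff

namespace BerisEdwards

noncomputable section

/-- Physical space `ℝ³`. -/
abbrev E3 : Type := EuclideanSpace ℝ (Fin 3)

/-- Real `3 × 3` matrices. -/
abbrev Mat3 : Type := Matrix (Fin 3) (Fin 3) ℝ

/-- Frobenius norm `|A| = (A_{αβ} A_{αβ})^{1/2}`, equal to `(tr A²)^{1/2}` for symmetric `A`. -/
def frob (A : Mat3) : ℝ := Real.sqrt (∑ α, ∑ β, A α β ^ 2)

/-! ### Domains with boundary of class `C³` -/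

/-- `ρ` is a `C³` defining function of `U`: `U = {ρ < 0}` and `∇ρ ≠ 0` on `{ρ = 0}`.
Then `{ρ = 0}` is the boundary of `U`, and the outward unit normal there is `n = ∇ρ / |∇ρ|`. -/
structure IsDefiningFunction (U : Set E3) (ρ : E3 → ℝ) : Prop where
  contDiff : ContDiff ℝ 3 ρ
  eq_sublevel : U = {x | ρ x < 0}
  fderiv_ne_zero : ∀ x, ρ x = 0 → fderiv ℝ ρ x ≠ 0

/-- Bounded domain (open connected set) of `ℝ³` with boundary of class `C³`. -/
structure IsC3Domain (U : Set E3) : Prop where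
  isOpen : IsOpen U
  isConnected : IsConnected U
  isBounded : Bornology.IsBounded U
  exists_definingFunction : ∃ ρ, IsDefiningFunction U ρ

/-! ### Weak derivatives -/

/-- The classical partial derivative `∂ᵢ φ`. -/
def partialD (i : Fin 3) (φ : E3 → ℝ) (x : E3) : ℝ :=
  fderiv ℝ φ x (EuclideanSpace.single i 1)

/-- `φ ∈ C_c^∞(V)`. -/
def IsTestFunction {E : Type*} [NormedAddCommGroup E] [NormedSpace ℝ E]
    (V : Set E) (φ : E → ℝ) : Prop :=
  ContDiff ℝ ∞ φ ∧ HasCompactSupport φ ∧ tsupport φ ⊆ V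

/-- `g` is the weak partial derivative `∂ᵢ f` on `U`. -/
def IsWeakPartial (U : Set E3) (i : Fin 3) (f g : E3 → ℝ) : Prop :=
  LocallyIntegrableOn f U ∧ LocallyIntegrableOn g U ∧
    ∀ φ : E3 → ℝ, IsTestFunction U φ →
      ∫ x in U, f x * partialD i φ x = - ∫ x in U, g x * φ x

open Classical in
/-- The weak partial derivative `∂ᵢ f` on `U` (unique up to null sets when it exists; the value
is `0` when it does not exist). -/
def wD (U : Set E3) (i : Fin 3) (f : E3 → ℝ) : E3 → ℝ :=
  if h : ∃ g, IsWeakPartial U i f g then h.choose else 0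

/-- The weak Laplacian `Δ f = ∂_γ ∂_γ f` on `U`. -/
def wLap (U : Set E3) (f : E3 → ℝ) (x : E3) : ℝ := ∑ γ, wD U γ (wD U γ f) x

/-- `g` is the weak time derivative `∂ₜ f` on `(0,∞) × U`, tested against
`C_c^∞((0,∞) × U)`. -/
def IsWeakTimeDeriv (U : Set E3) (f g : ℝ → E3 → ℝ) : Prop :=
  LocallyIntegrableOn (Function.uncurry f) (Ioi (0 : ℝ) ×ˢ U) ∧
  LocallyIntegrableOn (Function.uncurry g) (Ioi (0 : ℝ) ×ˢ U) ∧
    ∀ φ : ℝ × E3 → ℝ, IsTestFunction (Ioi (0 : ℝ) ×ˢ U) φ →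
      ∫ z in Ioi (0 : ℝ) ×ˢ U, f z.1 z.2 * fderiv ℝ φ z (1, 0) =
        - ∫ z in Ioi (0 : ℝ) ×ˢ U, g z.1 z.2 * φ z

open Classical in
/-- The weak time derivative `∂ₜ f` on `(0,∞) × U` (`0` when it does not exist). -/
def wDt (U : Set E3) (f : ℝ → E3 → ℝ) : ℝ → E3 → ℝ :=
  if h : ∃ g, IsWeakTimeDeriv U f g then h.choose else 0

/-! ### Function spaces -/

/-- `f ∈ L^m(0,T; L^q(U))`. -/
def MemLL (m q : ℝ) (U : Set E3) (T : ℝ) (f : ℝ → E3 → ℝ) : Prop :=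
  AEStronglyMeasurable (Function.uncurry f)
      ((volume.restrict (Ioo 0 T)).prod (volume.restrict U)) ∧
    ∫⁻ t in Ioo 0 T, (eLpNorm (f t) (ENNReal.ofReal q) (volume.restrict U)) ^ m < ⊤

/-- `f ∈ L^m(0,T; W^{k,q}(U))`. -/
def MemLW (m q : ℝ) (U : Set E3) (T : ℝ) : ℕ → (ℝ → E3 → ℝ) → Prop
  | 0, f => MemLL m q U T f
  | k + 1, f => MemLL m q U T f ∧ ∀ i : Fin 3, ∃ g : ℝ → E3 → ℝ,
      (∀ᵐ t ∂(volume.restrict (Ioo 0 T)), IsWeakPartial U i (f t) (g t)) ∧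
        MemLW m q U T k g

/-- `f ∈ C([0,∞); L^q(U))`. -/
def ContinuousInLp (q : ℝ) (U : Set E3) (f : ℝ → E3 → ℝ) : Prop :=
  ∀ t, 0 ≤ t → MemLp (f t) (ENNReal.ofReal q) (volume.restrict U) ∧
    Tendsto (fun s => eLpNorm (f s - f t) (ENNReal.ofReal q) (volume.restrict U))
      (𝓝[Ici 0] t) (𝓝 0)

/-- `f ∈ W₀^{1,q}(U)`, the closure of `C_c^∞(U)` in `W^{1,q}(U)` (functions with zero trace). The
functions `G i` are the weak derivatives of `f`. -/
def MemW0 (q : ℝ) (U : Set E3) (f : E3 → ℝ) : Prop :=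
  MemLp f (ENNReal.ofReal q) (volume.restrict U) ∧
  ∃ G : Fin 3 → E3 → ℝ, (∀ i, MemLp (G i) (ENNReal.ofReal q) (volume.restrict U)) ∧
    (∀ i, IsWeakPartial U i f (G i)) ∧
    ∀ ε : ℝ≥0∞, 0 < ε → ∃ φ : E3 → ℝ, IsTestFunction U φ ∧
      eLpNorm (f - φ) (ENNReal.ofReal q) (volume.restrict U) ≤ ε ∧
      ∀ i, eLpNorm (G i - partialD i φ) (ENNReal.ofReal q) (volume.restrict U) ≤ ε

/-- `∂ₙ f = 0` on `∂U` in the sense of traces: for a defining function `ρ` of `U`, the function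
`∇ρ · ∇f`, which on `∂U` is `|∇ρ| ∂ₙ f`, has zero trace. The condition does not depend on the choice
of `ρ`, because the gradients of two defining functions are positive multiples of one another along
`∂U`. -/
def HasZeroNormalDeriv (r : ℝ) (U : Set E3) (f : E3 → ℝ) : Prop :=
  ∃ ρ, IsDefiningFunction U ρ ∧
    MemW0 r U (fun x => ∑ i, partialD i ρ x * wD U i f x)

/-! ### The system -/

/-- The molecular field
`H = -a Q + b (Q² - tr(Q²) I / 3) - c Q tr(Q²) + Δ Q` at the point `x`. -/
def molecularField (a b c : ℝ) (U : Set E3) (Q : E3 → Mat3) (x : E3) : Mat3 :=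
  -(a • Q x) + b • (Q x * Q x - ((Q x * Q x).trace / 3) • (1 : Mat3))
    - (c * (Q x * Q x).trace) • Q x + Matrix.of fun α β => wLap U (fun y => Q y α β) x

/-- The Ericksen stress `∂_α Q_{ζδ} ∂_β Q_{ζδ}`. -/
def ericksen (U : Set E3) (Q : E3 → Mat3) (α β : Fin 3) (x : E3) : ℝ :=
  ∑ ζ, ∑ δ, wD U α (fun y => Q y ζ δ) x * wD U β (fun y => Q y ζ δ) x

/-- The antisymmetric stress `Q_{αγ} ΔQ_{γβ} - ΔQ_{αγ} Q_{γβ}`. -/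
def antisymStress (U : Set E3) (Q : E3 → Mat3) (α β : Fin 3) (x : E3) : ℝ :=
  ∑ γ, (Q x α γ * wLap U (fun y => Q y γ β) x - wLap U (fun y => Q y α γ) x * Q x γ β)

/-- `(u, Q, π)` is a global strong solution, with exponents `(m, q, r)`, of the system
`(∂ₜ + u_γ ∂_γ) Q_{αβ} = H_{αβ}`,
`(∂ₜ + u_β ∂_β) u_α = Δ u_α + ∂_α π - ∂_β (∂_α Q_{ζδ} ∂_β Q_{ζδ})
  + ∂_β (Q_{αγ} ΔQ_{γβ} - ΔQ_{αγ} Q_{γβ})`,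
`∂_γ u_γ = 0`
on `U × (0,∞)`, with initial data `(u₀, Q₀)` and boundary conditions `u = 0`, `∂ₙ Q = 0` on `∂U`;
`Q` takes values in the symmetric traceless matrices. -/
structure IsStrongSolution (a b c m q r : ℝ) (U : Set E3)
    (u₀ : E3 → Fin 3 → ℝ) (Q₀ : E3 → Mat3)
    (u : ℝ → E3 → Fin 3 → ℝ) (Q : ℝ → E3 → Mat3) (π : ℝ → E3 → ℝ) : Prop where
  -- regularity of the velocity
  u_cont : ∀ α, ContinuousInLp q U (fun t x => u t x α)
  u_space : ∀ T, 0 < T → ∀ α, MemLW m q U T 2 (fun t x => u t x α)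
  u_time : ∀ α, ∃ g, IsWeakTimeDeriv U (fun t x => u t x α) g ∧
    ∀ T, 0 < T → MemLW m q U T 0 g
  -- regularity of the order parameter
  Q_cont : ∀ α β, ContinuousInLp r U (fun t x => Q t x α β)
  Q_space : ∀ T, 0 < T → ∀ α β, MemLW m r U T 3 (fun t x => Q t x α β)
  Q_time : ∀ α β, ∃ g, IsWeakTimeDeriv U (fun t x => Q t x α β) g ∧
    ∀ T, 0 < T → MemLW m r U T 1 g
  -- regularity of the pressure
  π_space : ∀ T, 0 < T → MemLW m q U T 1 π
  -- algebraic constraint on the order parameter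
  Q_symm_traceless : ∀ t, 0 ≤ t → ∀ᵐ x ∂(volume.restrict U),
    (Q t x).transpose = Q t x ∧ (Q t x).trace = 0
  -- initial conditions
  u_init : ∀ᵐ x ∂(volume.restrict U), u 0 x = u₀ x
  Q_init : ∀ᵐ x ∂(volume.restrict U), Q 0 x = Q₀ x
  -- boundary conditions
  u_boundary : ∀ᵐ t ∂(volume.restrict (Ioi (0 : ℝ))), ∀ α, MemW0 q U (fun x => u t x α)
  Q_boundary : ∀ᵐ t ∂(volume.restrict (Ioi (0 : ℝ))), ∀ α β,
    HasZeroNormalDeriv r U (fun x => Q t x α β)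
  -- the equations, almost everywhere
  Q_eq : ∀ᵐ t ∂(volume.restrict (Ioi (0 : ℝ))), ∀ᵐ x ∂(volume.restrict U), ∀ α β,
    wDt U (fun s y => Q s y α β) t x + ∑ γ, u t x γ * wD U γ (fun y => Q t y α β) x
      = molecularField a b c U (Q t) x α β
  u_eq : ∀ᵐ t ∂(volume.restrict (Ioi (0 : ℝ))), ∀ᵐ x ∂(volume.restrict U), ∀ α,
    wDt U (fun s y => u s y α) t x + ∑ β, u t x β * wD U β (fun y => u t y α) x
      = wLap U (fun y => u t y α) x + wD U α (π t) x
        - ∑ β, wD U β (ericksen U (Q t) α β) x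
        + ∑ β, wD U β (antisymStress U (Q t) α β) x
  div_free : ∀ᵐ t ∂(volume.restrict (Ioi (0 : ℝ))), ∀ᵐ x ∂(volume.restrict U),
    ∑ γ, wD U γ (fun y => u t y γ) x = 0

end

end BerisEdwards

namespace BerisEdwards

/-! Formally one contracts the equation for Q with |Q|^(p-2) Q. Transport contributes nothing
because u is solenoidal with zero trace. The Laplacian contributes a nonpositive term by convexity
and the Neumann condition. The bulk part is coercive: |tr Q³| ≤ |Q|³ and b² ≤ (16/9) ac give bQ:Q² ≤
(4/9) a|Q|² + c|Q|⁴, so Q contracted with the bulk field is at most -(5/9) a|Q|²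
(`inner_bulkField_le`).

For large p the powers of Q in this computation need not be integrable a priori. The contraction is
therefore made with the gradient k(Q) Q of a convex radial function Φ whose gradient has norm at
most 1 (`IsRadialEntropy`), so that every pairing with an integrable function is integrable.
Convexity gives Φ(X) - Φ(0) ≤ k(X)|X|², hence y(t) = ∫ (Φ(Q) - Φ(0)) decays like exp(-(5/9) a t),
with the same rate for all Φ (`IsStrongSolution.integral_entropy_le`). Smooth approximations of (|X|
- l)₊ are such functions, so every truncated L¹ norm decays at this rate. Since X^p is the integral
of p(p-1) l^(p-2) (X - l)₊ over l > 0, the p-th moment does too, and a p-th root gives C = 5a/(9p).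

The rest makes the formal computation rigorous for weak derivatives. Spatial chain rules come from
mollification; only monotonicity of ∇Φ is used, never its Hessian
(`IsRadialEntropy.setIntegral_mul_second_le`). The Neumann condition enters through averages of
∇ρ·∇Q over boundary layers of width ε, which tend to 0 (`tendsto_average_layer`). For the time
derivative, almost every x is given an absolutely continuous path in t, along which the chain rule
is classical (`IsRadialEntropy.integral_sub_eq`). -/

/-! ### Algebra of the bulk term -/

/-- A matrix regarded as a vector of the Euclidean space `ℝ⁹`. -/
noncomputable def vec (A : Mat3) : EuclideanSpace ℝ (Fin 3 × Fin 3) :=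
  WithLp.toLp 2 fun i => A i.1 i.2

@[simp] lemma vec_apply (A : Mat3) (i : Fin 3 × Fin 3) : vec A i = A i.1 i.2 := rfl

lemma norm_vec (A : Mat3) : ‖vec A‖ = frob A := by
  simp [EuclideanSpace.norm_eq, frob, Fintype.sum_prod_type]

lemma norm_vec_sq (A : Mat3) : ‖vec A‖ ^ 2 = ∑ α, ∑ β, A α β ^ 2 := by
  rw [norm_vec, frob, Real.sq_sqrt (by positivity)]

lemma sum_sq_mul_le (A : Mat3) :
    ∑ α, ∑ β, (A * A) α β ^ 2 ≤ (∑ α, ∑ β, A α β ^ 2) ^ 2 := by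
  have h : ∀ α β, (A * A) α β ^ 2 ≤ (∑ γ, A α γ ^ 2) * ∑ γ, A γ β ^ 2 := fun α β => by
    rw [Matrix.mul_apply]
    exact Finset.sum_mul_sq_le_sq_mul_sq _ _ _
  calc ∑ α, ∑ β, (A * A) α β ^ 2
      ≤ ∑ α, ∑ β, (∑ γ, A α γ ^ 2) * ∑ γ, A γ β ^ 2 :=
        Finset.sum_le_sum fun α _ => Finset.sum_le_sum fun β _ => h α β
    _ = (∑ α, ∑ β, A α β ^ 2) ^ 2 := by
        simp_rw [← Finset.mul_sum, ← Finset.sum_mul]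
        rw [Finset.sum_comm (f := fun i j => A j i ^ 2), sq]

lemma sq_sum_mul_sq_le (A : Mat3) :
    (∑ α, ∑ β, A α β * (A * A) α β) ^ 2 ≤ (∑ α, ∑ β, A α β ^ 2) ^ 3 := by
  have h1 := Finset.sum_mul_sq_le_sq_mul_sq (Finset.univ : Finset (Fin 3 × Fin 3))
    (fun i => A i.1 i.2) (fun i => (A * A) i.1 i.2)
  simp only [Fintype.sum_prod_type] at h1
  have h2 := mul_le_mul_of_nonneg_left (sum_sq_mul_le A)
    (show 0 ≤ ∑ α, ∑ β, A α β ^ 2 by positivity)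
  calc _ ≤ _ := h1
    _ ≤ _ := h2
    _ = _ := by ring

/-- The part of the molecular field without the Laplacian. -/
noncomputable def bulkField (a b c : ℝ) (A : Mat3) : Mat3 :=
  -(a • A) + b • (A * A - ((A * A).trace / 3) • (1 : Mat3)) - (c * (A * A).trace) • A

/-- With S = |A|² and T = tr A³ the contraction equals -aS + bT - cS². The cubic term is absorbed by
the whole quartic term and the fraction 4/9 of the quadratic one; the fraction 5/9 is left and fixes
the decay rate. -/
lemma inner_bulkField_le {a b c : ℝ} (ha : 0 < a) (hc : 0 < c)
    (hac : 9 / 16 * b ^ 2 ≤ a * c) (A : Mat3) (hs : A.transpose = A) (ht : A.trace = 0) :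
    ∑ α, ∑ β, A α β * bulkField a b c A α β ≤ -(5 / 9 * a) * ‖vec A‖ ^ 2 := by
  rw [norm_vec_sq]
  set S := ∑ α, ∑ β, A α β ^ 2 with hS
  set T := ∑ α, ∑ β, A α β * (A * A) α β with hT
  have hS0 : 0 ≤ S := by positivity
  have htr : (A * A).trace = S := by
    rw [hS, Matrix.trace]
    refine Finset.sum_congr rfl fun α _ => ?_
    rw [Matrix.diag_apply, Matrix.mul_apply]
    refine Finset.sum_congr rfl fun β _ => ?_
    rw [sq, ← Matrix.transpose_apply A α β, hs]
  have hone : ∑ α, ∑ β, A α β * (1 : Mat3) α β = 0 := by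
    rw [← ht, Matrix.trace]
    refine Finset.sum_congr rfl fun α _ => ?_
    simp [Matrix.one_apply]
  have hmain : ∑ α, ∑ β, A α β * bulkField a b c A α β = -(a * S) + b * T - c * S * S := by
    have : ∀ α β, A α β * bulkField a b c A α β = -a * A α β ^ 2 + b * (A α β * (A * A) α β)
        - b * S / 3 * (A α β * (1 : Mat3) α β) - c * S * A α β ^ 2 := fun α β => by
      simp only [bulkField, htr, Matrix.sub_apply, Matrix.add_apply, Matrix.neg_apply,
        Matrix.smul_apply, smul_eq_mul]
      ring
    simp_rw [this, Finset.sum_sub_distrib, Finset.sum_add_distrib, ← Finset.mul_sum]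
    rw [hone, ← hS, ← hT]
    ring
  rw [hmain]
  have hTS : T ^ 2 ≤ S ^ 3 := sq_sum_mul_sq_le A
  -- By the inequality of the means, (4/9 aS + cS²)² ≥ 4 · (4/9) ac S³ = (16/9) ac S³ ≥ b² S³; the
  -- fraction 4/9 is the one that meets the hypothesis on ac exactly.
  have key : b * T ≤ 4 / 9 * a * S + c * S ^ 2 := by
    apply abs_le_of_sq_le_sq' _ (by positivity) |>.2
    calc (b * T) ^ 2 = b ^ 2 * T ^ 2 := by ring
      _ ≤ (16 / 9 * (a * c)) * S ^ 3 := by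
          apply mul_le_mul _ hTS (by positivity) (by positivity)
          linarith
      _ ≤ (4 / 9 * a * S + c * S ^ 2) ^ 2 := by
          nlinarith [sq_nonneg (4 / 9 * a * S - c * S ^ 2)]
  nlinarith

/-! ### Convex radial entropies -/

section Entropy

variable {V : Type*} [NormedAddCommGroup V] [InnerProductSpace ℝ V]

/-- `Φ` is a convex radial function with gradient `k X • X`, of norm at most `1`. -/
structure IsRadialEntropy (Φ k : V → ℝ) : Prop where
  hasFDerivAt : ∀ X, HasFDerivAt Φ (k X • innerSL ℝ X) X
  contDiff : ContDiff ℝ 1 k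
  nonneg : ∀ X, 0 ≤ k X
  mul_norm_le_one : ∀ X, k X * ‖X‖ ≤ 1
  monotone : ∀ X Y, 0 ≤ inner ℝ (k X • X - k Y • Y) (X - Y)

namespace IsRadialEntropy

variable {Φ k : V → ℝ} (h : IsRadialEntropy Φ k)
include h

lemma norm_smul_le (X : V) : ‖k X • X‖ ≤ 1 := by
  rw [norm_smul, Real.norm_of_nonneg (h.nonneg X)]
  exact h.mul_norm_le_one X

lemma lipschitz : LipschitzWith 1 Φ := by
  refine lipschitzWith_of_nnnorm_fderiv_le (𝕜 := ℝ) (fun X => (h.hasFDerivAt X).differentiableAt)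
    fun X => ?_
  rw [(h.hasFDerivAt X).fderiv]
  rw [← NNReal.coe_le_coe, coe_nnnorm, norm_smul, innerSL_apply_norm,
    Real.norm_of_nonneg (h.nonneg X)]
  exact h.mul_norm_le_one X

lemma continuous : Continuous Φ := h.lipschitz.continuous

lemma exists_mean_value (X : V) :
    ∃ s ∈ Ioo (0 : ℝ) 1, Φ X - Φ 0 = s * k (s • X) * ‖X‖ ^ 2 := by
  have hd : ∀ s : ℝ, HasDerivAt (fun s : ℝ => Φ (s • X)) (s * k (s • X) * ‖X‖ ^ 2) s := fun s => by
    have h1 : HasDerivAt (fun s : ℝ => s • X) X s := by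
      simpa using (hasDerivAt_id s).smul_const X
    have := (h.hasFDerivAt (s • X)).comp_hasDerivAt s h1
    refine this.congr_deriv ?_
    simp
    ring
  obtain ⟨s, hs, he⟩ := exists_hasDerivAt_eq_slope (fun s : ℝ => Φ (s • X)) _ zero_lt_one
    (fun s _ => (hd s).continuousAt.continuousWithinAt) (fun s _ => hd s)
  exact ⟨s, hs, by simpa using he.symm⟩

lemma map_zero_le (X : V) : Φ 0 ≤ Φ X := by
  obtain ⟨s, hs, he⟩ := h.exists_mean_value X
  have : 0 ≤ s * k (s • X) * ‖X‖ ^ 2 :=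
    mul_nonneg (mul_nonneg hs.1.le (h.nonneg _)) (sq_nonneg _)
  linarith

/-- This is convexity along the ray through X: the mean value point s • X has a smaller radial slope
than X, by monotonicity of the gradient. It converts the coercivity of the bulk term into decay of Φ
itself. -/
lemma sub_map_zero_le (X : V) : Φ X - Φ 0 ≤ k X * ‖X‖ ^ 2 := by
  obtain ⟨s, hs, he⟩ := h.exists_mean_value X
  rw [he]
  have := h.monotone X (s • X)
  have e : inner ℝ (k X • X - k (s • X) • s • X) (X - s • X)
      = (1 - s) * (k X * ‖X‖ ^ 2 - s * k (s • X) * ‖X‖ ^ 2) := by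
    simp only [inner_sub_left, inner_sub_right, inner_smul_left, inner_smul_right,
      real_inner_self_eq_norm_sq, RCLike.conj_to_real]
    ring
  rw [e] at this
  have := nonneg_of_mul_nonneg_right this (sub_pos.2 hs.2)
  linarith

lemma sub_map_zero_le_norm (X : V) : Φ X - Φ 0 ≤ ‖X‖ := by
  refine (h.sub_map_zero_le X).trans ?_
  nlinarith [h.mul_norm_le_one X, norm_nonneg X]

end IsRadialEntropy

/-! ### Smooth truncated norms as radial entropies. -/

/-- The smooth approximation `√(w² + δ²)` of `|w|`. -/
noncomputable def smoothAbs (δ w : ℝ) : ℝ := √(w ^ 2 + δ ^ 2)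

section smoothAbs

variable {δ : ℝ}

lemma smoothAbs_pos (hδ : 0 < δ) (w : ℝ) : 0 < smoothAbs δ w :=
  Real.sqrt_pos.2 (by positivity)

lemma smoothAbs_sq (δ w : ℝ) : smoothAbs δ w ^ 2 = w ^ 2 + δ ^ 2 := Real.sq_sqrt (by positivity)

lemma abs_le_smoothAbs (δ w : ℝ) : |w| ≤ smoothAbs δ w := by
  rw [smoothAbs, ← Real.sqrt_sq_eq_abs]
  exact Real.sqrt_le_sqrt (by linarith [sq_nonneg δ])

lemma smoothAbs_le (hδ : 0 < δ) (w : ℝ) : smoothAbs δ w ≤ |w| + δ := by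
  refine (abs_le_of_sq_le_sq' ?_ (by positivity)).2
  rw [smoothAbs_sq, ← sq_abs w]
  nlinarith [abs_nonneg w]

lemma contDiff_smoothAbs (hδ : 0 < δ) : ContDiff ℝ ∞ (smoothAbs δ) :=
  (by fun_prop : ContDiff ℝ ∞ fun w : ℝ => w ^ 2 + δ ^ 2).sqrt fun w => by positivity

lemma hasDerivAt_smoothAbs (hδ : 0 < δ) (w : ℝ) :
    HasDerivAt (smoothAbs δ) (w / smoothAbs δ w) w := by
  have h1 : HasDerivAt (fun w : ℝ => w ^ 2 + δ ^ 2) (2 * w) w := by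
    simpa using (hasDerivAt_pow 2 w).add_const (δ ^ 2)
  refine (h1.sqrt (by positivity)).congr_deriv ?_
  simp only [smoothAbs]
  ring

lemma monotone_div_smoothAbs (hδ : 0 < δ) : Monotone fun w => w / smoothAbs δ w := by
  refine monotone_of_hasDerivAt_nonneg
    (fun w => (hasDerivAt_id w).div (hasDerivAt_smoothAbs hδ w) (smoothAbs_pos hδ w).ne')
    fun w => ?_
  have := smoothAbs_pos hδ w
  have h2 := smoothAbs_sq δ w
  simp only [id, Pi.zero_apply]
  apply div_nonneg _ (by positivity)
  rw [one_mul, sub_nonneg, mul_div_assoc', div_le_iff₀ this]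
  nlinarith [sq_nonneg δ]

lemma abs_div_smoothAbs_le (hδ : 0 < δ) (w : ℝ) : |w / smoothAbs δ w| ≤ 1 := by
  rw [abs_div, abs_of_pos (smoothAbs_pos hδ w)]
  exact (div_le_one (smoothAbs_pos hδ w)).2 (abs_le_smoothAbs δ w)

end smoothAbs

/-- A smooth convex approximation of `max (‖X‖ - l) 0`. -/
noncomputable def truncNorm {V : Type*} [NormedAddCommGroup V] (δ l : ℝ) (X : V) : ℝ :=
  ((smoothAbs δ ‖X‖ - l) + smoothAbs δ (smoothAbs δ ‖X‖ - l)) / 2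

/-- The radial factor of the gradient of `truncNorm`. -/
noncomputable def truncNormFactor {V : Type*} [NormedAddCommGroup V] (δ l : ℝ) (X : V) : ℝ :=
  (1 + (smoothAbs δ ‖X‖ - l) / smoothAbs δ (smoothAbs δ ‖X‖ - l)) / 2 / smoothAbs δ ‖X‖

lemma hasFDerivAt_smoothAbs_norm {δ : ℝ} (hδ : 0 < δ) (X : V) :
    HasFDerivAt (fun X : V => smoothAbs δ ‖X‖) ((smoothAbs δ ‖X‖)⁻¹ • innerSL ℝ X) X := by
  have h1 := ((hasStrictFDerivAt_norm_sq X).hasFDerivAt.add_const (δ ^ 2)).sqrt (by positivity)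
  refine h1.congr_fderiv ?_
  ext Y
  simp [smoothAbs]
  ring

lemma contDiff_smoothAbs_norm {δ : ℝ} (hδ : 0 < δ) :
    ContDiff ℝ ∞ (fun X : V => smoothAbs δ ‖X‖) :=
  ((contDiff_norm_sq ℝ).add contDiff_const).sqrt fun X => by positivity

/-- The function is the nondecreasing convex map w ↦ (w + `smoothAbs δ w`)/2 composed with
`smoothAbs δ ‖X‖ - l`. Its radial slope is a product of two nonnegative factors, each nondecreasing
in ‖X‖ and at most 1. -/
lemma isRadialEntropy_truncNorm {δ : ℝ} (hδ : 0 < δ) (l : ℝ) :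
    IsRadialEntropy (truncNorm (V := V) δ l) (truncNormFactor δ l) := by
  have hR := fun X : V => smoothAbs_pos hδ ‖X‖
  have hk : ∀ X : V, 0 ≤ truncNormFactor δ l X := fun X => by
    have := (abs_le.1 (abs_div_smoothAbs_le hδ (smoothAbs δ ‖X‖ - l))).1
    exact div_nonneg (by linarith) (hR X).le
  refine ⟨fun X => ?_, ?_, hk, fun X => ?_, fun X Y => ?_⟩
  · have h1 := (hasFDerivAt_smoothAbs_norm hδ X).sub_const l
    have h2 := (hasDerivAt_smoothAbs hδ (smoothAbs δ ‖X‖ - l)).comp_hasFDerivAt X h1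
    have h3 := (h1.add h2).const_mul (1 / 2)
    refine (h3.congr_fderiv ?_).congr_of_eventuallyEq (.of_forall fun Y => ?_)
    · ext Y
      simp [truncNormFactor]
      ring
    · simp [truncNorm]
      ring
  · have h1 : ContDiff ℝ ∞ (fun X : V => smoothAbs δ ‖X‖ - l) :=
      (contDiff_smoothAbs_norm hδ).sub contDiff_const
    have h2 := (contDiff_smoothAbs hδ).comp h1
    have h3 : ContDiff ℝ ∞ (truncNormFactor (V := V) δ l) :=
      ((contDiff_const.add (h1.div h2 fun X => (smoothAbs_pos hδ _).ne')).div_const 2).div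
        (contDiff_smoothAbs_norm hδ) fun X => (hR X).ne'
    exact h3.of_le (by exact_mod_cast le_top)
  · have h1 := (abs_le.1 (abs_div_smoothAbs_le hδ (smoothAbs δ ‖X‖ - l))).2
    have h2 := abs_le_smoothAbs δ ‖X‖
    rw [abs_norm] at h2
    rw [truncNormFactor, div_mul_eq_mul_div, div_le_one (hR X)]
    nlinarith [norm_nonneg X]
  -- Cauchy–Schwarz bounds the inner product below by (kX‖X‖ - kY‖Y‖)(‖X‖ - ‖Y‖), so monotonicity of
  -- the gradient reduces to that of the scalar radial slope.
  · have hcs := real_inner_le_norm X Y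
    have hmono : 0 ≤ (truncNormFactor δ l X * ‖X‖ - truncNormFactor δ l Y * ‖Y‖)
        * (‖X‖ - ‖Y‖) := by
      have hm : ∀ X Y : V, ‖X‖ ≤ ‖Y‖ →
          truncNormFactor δ l X * ‖X‖ ≤ truncNormFactor δ l Y * ‖Y‖ := fun X Y hXY => by
        have h1 := monotone_div_smoothAbs hδ hXY
        have hS : smoothAbs δ ‖X‖ ≤ smoothAbs δ ‖Y‖ :=
          Real.sqrt_le_sqrt (by gcongr)
        have h2 := monotone_div_smoothAbs hδ (sub_le_sub_right hS l)
        have h3 := (abs_le.1 (abs_div_smoothAbs_le hδ (smoothAbs δ ‖Y‖ - l))).1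
        have e : ∀ Z : V, truncNormFactor δ l Z * ‖Z‖ =
            (1 + (smoothAbs δ ‖Z‖ - l) / smoothAbs δ (smoothAbs δ ‖Z‖ - l)) / 2
              * (‖Z‖ / smoothAbs δ ‖Z‖) := fun Z => by
          rw [truncNormFactor]
          ring
        rw [e, e]
        simp only at h1 h2
        refine mul_le_mul (by linarith) h1 (div_nonneg (norm_nonneg _) (hR X).le) (by linarith)
      rcases le_total ‖X‖ ‖Y‖ with hXY | hXY
      · exact mul_nonneg_of_nonpos_of_nonpos (by linarith [hm X Y hXY]) (by linarith)
      · exact mul_nonneg (by linarith [hm Y X hXY]) (by linarith)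
    have e : inner ℝ (truncNormFactor δ l X • X - truncNormFactor δ l Y • Y) (X - Y)
        = truncNormFactor δ l X * ‖X‖ ^ 2 + truncNormFactor δ l Y * ‖Y‖ ^ 2
          - (truncNormFactor δ l X + truncNormFactor δ l Y) * inner ℝ X Y := by
      simp only [inner_sub_left, inner_sub_right, inner_smul_left,
        real_inner_self_eq_norm_sq, RCLike.conj_to_real, real_inner_comm X Y]
      ring
    rw [e]
    nlinarith [hk X, hk Y]

lemma max_le_truncNorm {V : Type*} [NormedAddCommGroup V] (δ l : ℝ) (X : V) :
    max (‖X‖ - l) 0 ≤ truncNorm δ l X := by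
  have h1 := abs_le_smoothAbs δ ‖X‖
  rw [abs_norm] at h1
  have h2 := abs_le.1 (abs_le_smoothAbs δ (smoothAbs δ ‖X‖ - l))
  rw [truncNorm]
  exact max_le (by linarith) (by linarith)

/-- The error is uniform in X, so on a domain of finite measure it costs a multiple of δ after
integration and disappears as δ → 0. -/
lemma truncNorm_le {V : Type*} [NormedAddCommGroup V] {δ : ℝ} (hδ : 0 < δ) (l : ℝ) (X : V) :
    truncNorm δ l X ≤ max (‖X‖ - l) 0 + 2 * δ := by
  have h1 := smoothAbs_le hδ ‖X‖
  rw [abs_norm] at h1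
  have h2 := smoothAbs_le hδ (smoothAbs δ ‖X‖ - l)
  have h3 := le_max_left (‖X‖ - l) 0
  have h4 := le_max_right (‖X‖ - l) 0
  rw [truncNorm]
  rcases abs_cases (smoothAbs δ ‖X‖ - l) with h | h <;> rw [h.1] at h2 <;> linarith

end Entropy

/-! ### Mollification -/

section Mollify

open scoped Convolution

/-- Scheffé's lemma: |F - f| = F + f - 2 min(F, f), and the minimum is dominated by f, so equal
masses and convergence almost everywhere force convergence in L¹. -/
lemma tendsto_integral_abs_sub_zero_of_nonneg {X : Type*} [MeasurableSpace X] {μ : Measure X}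
    {F : ℕ → X → ℝ} {f : X → ℝ} (hF : ∀ n, Integrable (F n) μ) (hf : Integrable f μ)
    (hF0 : ∀ n, ∀ᵐ x ∂μ, 0 ≤ F n x) (hf0 : ∀ᵐ x ∂μ, 0 ≤ f x)
    (hint : ∀ n, ∫ x, F n x ∂μ = ∫ x, f x ∂μ)
    (hlim : ∀ᵐ x ∂μ, Tendsto (fun n => F n x) atTop (𝓝 (f x))) :
    Tendsto (fun n => ∫ x, |F n x - f x| ∂μ) atTop (𝓝 0) := by
  have hmin : Tendsto (fun n => ∫ x, min (F n x) (f x) ∂μ) atTop (𝓝 (∫ x, f x ∂μ)) := by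
    refine tendsto_integral_of_dominated_convergence f
      (fun n => ((hF n).inf hf).aestronglyMeasurable) hf (fun n => ?_) ?_
    · filter_upwards [hF0 n, hf0] with x h1 h2
      rw [Real.norm_of_nonneg (le_min h1 h2)]
      exact min_le_right _ _
    · filter_upwards [hlim] with x hx
      simpa using hx.min (tendsto_const_nhds (x := f x))
  have heq : ∀ n, ∫ x, |F n x - f x| ∂μ = 2 * ((∫ x, f x ∂μ) - ∫ x, min (F n x) (f x) ∂μ) :=
    fun n => by
    have hm : Integrable (fun x => min (F n x) (f x)) μ := (hF n).inf hf
    have : ∀ x, |F n x - f x| = F n x + f x - 2 * min (F n x) (f x) := fun x => by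
      rcases le_total (F n x) (f x) with h | h
      · rw [min_eq_left h, abs_of_nonpos (by linarith)]
        ring
      · rw [min_eq_right h, abs_of_nonneg (by linarith)]
        ring
    simp_rw [this]
    rw [integral_sub (f := fun x => F n x + f x) ((hF n).add hf) (hm.const_mul 2),
      integral_add (hF n) hf,
      integral_const_mul, hint n]
    ring
  simp_rw [heq]
  simpa using ((tendsto_const_nhds (x := ∫ x, f x ∂μ)).sub hmin).const_mul 2

/-- A sequence of bump functions whose supports shrink to the origin. -/
noncomputable def bump (n : ℕ) : ContDiffBump (0 : E3) where
  rIn := 1 / ((n : ℝ) + 1) / 2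
  rOut := 1 / ((n : ℝ) + 1)
  rIn_pos := by positivity
  rIn_lt_rOut := half_lt_self (by positivity)

/-- The mollification at scale `1 / (n + 1)` of the extension of `f` from `U` by zero. -/
noncomputable def mollify (U : Set E3) (n : ℕ) (f : E3 → ℝ) (x : E3) : ℝ :=
  ∫ y in U, f y * (bump n).normed volume (x - y)

variable {U : Set E3} {f g : E3 → ℝ}

lemma mollify_eq_convolution (hU : MeasurableSet U) (n : ℕ) (f : E3 → ℝ) :
    mollify U n f = U.indicator f ⋆[ContinuousLinearMap.mul ℝ ℝ] (bump n).normed volume := by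
  ext x
  rw [convolution_def, mollify, ← integral_indicator hU]
  congr 1
  ext y
  by_cases hy : y ∈ U <;> simp [hy]

lemma mollify_eq_convolution_swap (hU : MeasurableSet U) (n : ℕ) (f : E3 → ℝ) :
    mollify U n f = (bump n).normed volume ⋆[ContinuousLinearMap.lsmul ℝ ℝ] U.indicator f := by
  rw [mollify_eq_convolution hU]
  ext x
  rw [convolution_eq_swap, convolution_def]
  simp [mul_comm]

lemma integrable_mollify (hU : MeasurableSet U) (hf : IntegrableOn f U) (n : ℕ) :
    Integrable (mollify U n f) := by
  rw [mollify_eq_convolution hU]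
  exact (hf.integrable_indicator hU).integrable_convolution _ (bump n).integrable_normed

lemma contDiff_mollify (hU : MeasurableSet U) (hf : IntegrableOn f U) (n : ℕ) :
    ContDiff ℝ ∞ (mollify U n f) := by
  rw [mollify_eq_convolution hU]
  exact (bump n).hasCompactSupport_normed.contDiff_convolution_right _
    (hf.integrable_indicator hU).locallyIntegrable (bump n).contDiff_normed

lemma tendsto_bump_rOut : Tendsto (fun n => (bump n).rOut) atTop (𝓝 0) :=
  tendsto_one_div_add_atTop_nhds_zero_nat

lemma ae_tendsto_mollify (hU : MeasurableSet U) (hf : IntegrableOn f U) :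
    ∀ᵐ x, Tendsto (fun n => mollify U n f x) atTop (𝓝 (U.indicator f x)) := by
  simp_rw [mollify_eq_convolution_swap hU]
  -- The outer radius of each bump is twice the inner one, which keeps the kernels comparable to
  -- averages over balls.
  refine ContDiffBump.ae_convolution_tendsto_right_of_locallyIntegrable (K := 2)
    tendsto_bump_rOut (.of_forall fun n => ?_) (hf.integrable_indicator hU).locallyIntegrable
  simp only [bump]
  linarith

lemma integral_mollify (hU : MeasurableSet U) (hf : IntegrableOn f U) (n : ℕ) :
    ∫ x, mollify U n f x = ∫ x, U.indicator f x := by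
  rw [mollify_eq_convolution hU, integral_convolution _ (hf.integrable_indicator hU)
    (bump n).integrable_normed, ContDiffBump.integral_normed]
  simp

lemma mollify_nonneg (hf : ∀ x, 0 ≤ f x) (n : ℕ) (x : E3) :
    0 ≤ mollify U n f x :=
  integral_nonneg fun y => mul_nonneg (hf y) ((bump n).nonneg_normed _)

lemma mollify_sub (hf : IntegrableOn f U) (hg : IntegrableOn g U) (n : ℕ) (x : E3) :
    mollify U n (fun y => f y - g y) x = mollify U n f x - mollify U n g x := by
  have hb : ∀ {f}, IntegrableOn f U →
      IntegrableOn (fun y => f y * (bump n).normed volume (x - y)) U := fun {f} hf => by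
    obtain ⟨C, hC⟩ := ((bump n).hasCompactSupport_normed
      (μ := volume)).exists_bound_of_continuous (bump n).continuous_normed
    exact hf.mul_bdd (c := C) ((bump n).continuous_normed.comp
      (continuous_const.sub continuous_id)).aestronglyMeasurable (.of_forall fun y => hC _)
  simp only [mollify, sub_mul]
  exact integral_sub (hb hf) (hb hg)

/-- Mollification preserves sign and mass, so Scheffé's lemma applies to the positive and the
negative part of f separately. -/
lemma tendsto_integral_abs_mollify_sub (hU : MeasurableSet U) (hf : IntegrableOn f U) :
    Tendsto (fun n => ∫ x in U, |mollify U n f x - f x|) atTop (𝓝 0) := by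
  have key : ∀ h : E3 → ℝ, IntegrableOn h U → (∀ x, 0 ≤ h x) →
      Tendsto (fun n => ∫ x, |mollify U n h x - U.indicator h x|) atTop (𝓝 0) :=
    fun h hh h0 => tendsto_integral_abs_sub_zero_of_nonneg (fun n => integrable_mollify hU hh n)
      (hh.integrable_indicator hU) (fun n => .of_forall fun x => mollify_nonneg h0 n x)
      (.of_forall fun x => indicator_nonneg (fun x _ => h0 x) x)
      (fun n => integral_mollify hU hh n) (ae_tendsto_mollify hU hh)
  have hp : IntegrableOn (fun x => max (f x) 0) U := hf.pos_part
  have hm : IntegrableOn (fun x => max (-f x) 0) U := hf.neg_part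
  have hlim := (key _ hp fun x => le_max_right _ _).add (key _ hm fun x => le_max_right _ _)
  rw [add_zero] at hlim
  have hi : ∀ {h : E3 → ℝ}, IntegrableOn h U → ∀ n,
      Integrable (fun x => |mollify U n h x - U.indicator h x|) := fun hh n =>
    ((integrable_mollify hU hh n).sub (hh.integrable_indicator hU)).abs
  refine squeeze_zero (fun n => integral_nonneg fun x => abs_nonneg _) (fun n => ?_) hlim
  rw [← integral_add (hi hp n) (hi hm n)]
  refine (setIntegral_mono_on ((integrable_mollify hU hf n).integrableOn.sub hf).abs
    ((hi hp n).add (hi hm n)).integrableOn hU fun x hx => ?_).trans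
    (setIntegral_le_integral ((hi hp n).add (hi hm n))
      (.of_forall fun x => add_nonneg (abs_nonneg _) (abs_nonneg _)))
  have hfx : ∀ y, f y = max (f y) 0 - max (-f y) 0 := fun y => by
    rcases le_total (f y) 0 with h | h
    · rw [max_eq_right h, max_eq_left (by linarith)]
      ring
    · rw [max_eq_left h, max_eq_right (by linarith)]
      ring
  have e : mollify U n f x
      = mollify U n (fun y => max (f y) 0) x - mollify U n (fun y => max (-f y) 0) x := by
    rw [← mollify_sub hp hm]
    simp only [← hfx]
  change |mollify U n f x - f x|
    ≤ |mollify U n (fun y => max (f y) 0) x - U.indicator (fun y => max (f y) 0) x|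
      + |mollify U n (fun y => max (-f y) 0) x - U.indicator (fun y => max (-f y) 0) x|
  rw [indicator_of_mem hx, indicator_of_mem hx, e]
  calc _ = |(mollify U n (fun y => max (f y) 0) x - max (f x) 0)
        - (mollify U n (fun y => max (-f y) 0) x - max (-f x) 0)| := by
        congr 1
        linarith [hfx x]
    _ ≤ _ := abs_sub _ _

/-- The derivative falls on the kernel, and y ↦ kernel (x - y) is an admissible test function as
long as the ball around x stays inside U. The sign from differentiating x - y cancels the sign in
the definition of the weak derivative. -/
lemma partialD_mollify (hU : MeasurableSet U) (hf : IntegrableOn f U) {i : Fin 3}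
    (h : IsWeakPartial U i f g) {n : ℕ} {x : E3}
    (hx : Metric.closedBall x (1 / ((n : ℝ) + 1)) ⊆ U) :
    partialD i (mollify U n f) x = mollify U n g x := by
  set φ := (bump n).normed (volume : Measure E3) with hφ
  have hφc : ContDiff ℝ ∞ φ := (bump n).contDiff_normed
  have h1 : ContDiff ℝ 1 φ := hφc.of_le (by exact_mod_cast le_top)
  have hL := (hf.integrable_indicator hU).locallyIntegrable
  have hd := (bump n).hasCompactSupport_normed.hasFDerivAt_convolution_right
    (ContinuousLinearMap.mul ℝ ℝ) hL h1 x
  rw [partialD, mollify_eq_convolution hU, hd.fderiv, convolution_precompR_apply _ hL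
    ((bump n).hasCompactSupport_normed.fderiv ℝ) (h1.continuous_fderiv one_ne_zero),
    convolution_def]
  set ψ : E3 → ℝ := fun y => φ (x - y) with hψ
  have hsub : ContDiff ℝ ∞ fun y : E3 => x - y := contDiff_const.sub contDiff_id
  have hsupp : tsupport ψ ⊆ Metric.closedBall x (1 / ((n : ℝ) + 1)) := by
    refine closure_minimal (fun y hy => ?_) Metric.isClosed_closedBall
    have h3 : x - y ∈ Function.support φ := hy
    rw [hφ, (bump n).support_normed_eq, mem_ball_zero_iff] at h3
    rw [Metric.mem_closedBall, dist_comm, dist_eq_norm]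
    exact h3.le
  have ht : IsTestFunction U ψ := ⟨hφc.comp hsub,
    HasCompactSupport.of_support_subset_isCompact (isCompact_closedBall x _)
      ((subset_tsupport ψ).trans hsupp), hsupp.trans hx⟩
  have hder : ∀ y, partialD i ψ y = -(fderiv ℝ φ (x - y) (EuclideanSpace.single i 1)) := fun y => by
    have h2 : HasFDerivAt (fun y : E3 => x - y) (-ContinuousLinearMap.id ℝ E3) y :=
      (hasFDerivAt_id y).const_sub x
    have h3 := ((h1.differentiable one_ne_zero) (x - y)).hasFDerivAt.comp y h2
    rw [partialD, hψ]
    have h4 : fderiv ℝ (fun y => φ (x - y)) y = _ := h3.fderiv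
    rw [h4]
    simp
  have hw := h.2.2 ψ ht
  rw [mollify, ← neg_eq_iff_eq_neg.2 hw, ← integral_neg, ← integral_indicator hU]
  congr 1
  ext y
  by_cases hy : y ∈ U <;> simp [hy, hder, hφ]

end Mollify

/-! ### Chain rules for weak derivatives -/

/-- Write w h = w h₀ + w (h - h₀) along the sequence: dominated convergence handles the first term,
the uniform bound on w and L¹ convergence the second. Every passage to the limit in the chain rules
has this form. -/
lemma tendsto_integral_mul_of_tendsto_integral_abs_sub {X : Type*} [MeasurableSpace X]
    {μ : Measure X} {w : ℕ → X → ℝ} {w₀ : X → ℝ} {h : ℕ → X → ℝ} {h₀ : X → ℝ} {C : ℝ}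
    (hw : ∀ n, AEStronglyMeasurable (w n) μ) (hb : ∀ n, ∀ᵐ x ∂μ, |w n x| ≤ C)
    (hlim : ∀ᵐ x ∂μ, Tendsto (fun n => w n x) atTop (𝓝 (w₀ x)))
    (hh : ∀ n, Integrable (h n) μ) (hh₀ : Integrable h₀ μ)
    (hL : Tendsto (fun n => ∫ x, |h n x - h₀ x| ∂μ) atTop (𝓝 0)) :
    Tendsto (fun n => ∫ x, w n x * h n x ∂μ) atTop (𝓝 (∫ x, w₀ x * h₀ x ∂μ)) := by
  have hint : ∀ {u : X → ℝ} n, Integrable u μ → Integrable (fun x => w n x * u x) μ :=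
    fun n hu => hu.bdd_mul (hw n) (hb n)
  have h1 : Tendsto (fun n => ∫ x, w n x * h₀ x ∂μ) atTop (𝓝 (∫ x, w₀ x * h₀ x ∂μ)) := by
    refine tendsto_integral_of_dominated_convergence (fun x => C * |h₀ x|)
      (fun n => (hint n hh₀).aestronglyMeasurable) (hh₀.abs.const_mul C) (fun n => ?_) ?_
    · filter_upwards [hb n] with x hx
      rw [norm_mul]
      exact mul_le_mul_of_nonneg_right hx (abs_nonneg _)
    · filter_upwards [hlim] with x hx
      exact hx.mul_const _
  have h2 : Tendsto (fun n => ∫ x, w n x * (h n x - h₀ x) ∂μ) atTop (𝓝 0) := by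
    have h3 := hL.const_mul C
    rw [mul_zero] at h3
    refine squeeze_zero_norm (fun n => ?_) h3
    rw [← integral_const_mul]
    refine norm_integral_le_of_norm_le (((hh n).sub hh₀).abs.const_mul C) ?_
    filter_upwards [hb n] with x hx
    rw [norm_mul]
    exact mul_le_mul_of_nonneg_right hx (abs_nonneg _)
  have h3 := h1.add h2
  rw [add_zero] at h3
  refine h3.congr fun n => ?_
  rw [← integral_add (hint n hh₀) (hint (u := fun x => h n x - h₀ x) n ((hh n).sub hh₀))]
  congr 1
  ext x
  ring

/-! ### Vector fields and chain rules of first and second order. -/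

section Fields

variable {κ : Type*} [Fintype κ]

/-- The vector field with the components `F j`. -/
noncomputable def field {κ : Type*} (F : κ → E3 → ℝ) (x : E3) : EuclideanSpace ℝ κ :=
  WithLp.toLp 2 fun j => F j x

@[simp] lemma field_apply {κ : Type*} (F : κ → E3 → ℝ) (x : E3) (j : κ) : field F x j = F j x := rfl

lemma norm_le_sum_abs (X : EuclideanSpace ℝ κ) : ‖X‖ ≤ ∑ j, |X j| := by
  rw [EuclideanSpace.norm_eq]
  refine Real.sqrt_le_iff.2 ⟨by positivity, ?_⟩
  simp only [Real.norm_eq_abs]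
  exact Finset.sum_sq_le_sq_sum_of_nonneg fun j _ => abs_nonneg _

lemma aestronglyMeasurable_field {F : κ → E3 → ℝ} {μ : Measure E3}
    (h : ∀ j, AEStronglyMeasurable (F j) μ) : AEStronglyMeasurable (field F) μ :=
  (PiLp.continuous_toLp 2 _).comp_aestronglyMeasurable
    (aemeasurable_pi_lambda _ fun j => (h j).aemeasurable).aestronglyMeasurable

lemma contDiff_field {F : κ → E3 → ℝ} {n : WithTop ℕ∞} (h : ∀ j, ContDiff ℝ n (F j)) :
    ContDiff ℝ n (field F) :=
  contDiff_euclidean.2 h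

lemma fderiv_field_apply {F : κ → E3 → ℝ} {x : E3} (h : ∀ j, DifferentiableAt ℝ (F j) x)
    (i : Fin 3) (j : κ) :
    fderiv ℝ (field F) x (EuclideanSpace.single i 1) j = partialD i (F j) x := by
  have hd : DifferentiableAt ℝ (field F) x := differentiableAt_euclidean.2 h
  have h1 := (EuclideanSpace.proj (𝕜 := ℝ) j).hasFDerivAt.comp x hd.hasFDerivAt
  have h2 : fderiv ℝ (F j) x = _ := h1.fderiv
  rw [partialD, h2]
  rfl

lemma inner_eq_sum (X Y : EuclideanSpace ℝ κ) : inner ℝ X Y = ∑ j, X j * Y j := by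
  simp [PiLp.inner_apply, mul_comm]

/-- The inner product of the two difference quotients is t⁻² times a monotonicity expression, hence
nonnegative before the limit. This replaces positivity of the Hessian of Φ. -/
lemma inner_fderiv_comp_nonneg {V : Type*} [NormedAddCommGroup V] [InnerProductSpace ℝ V]
    {K : V → V} (hmono : ∀ X Y, 0 ≤ inner ℝ (K X - K Y) (X - Y)) {f : E3 → V} {x : E3}
    (hf : DifferentiableAt ℝ f x) (hK : DifferentiableAt ℝ (fun y => K (f y)) x) (v : E3) :
    0 ≤ inner ℝ (fderiv ℝ (fun y => K (f y)) x v) (fderiv ℝ f x v) := by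
  have h1 := (hf.hasFDerivAt.hasLineDerivAt v).tendsto_slope_zero
  have h2 := (hK.hasFDerivAt.hasLineDerivAt v).tendsto_slope_zero
  refine ge_of_tendsto' (h2.inner h1) fun t => ?_
  rw [inner_smul_left, inner_smul_right, ← mul_assoc]
  exact mul_nonneg (by simpa using mul_self_nonneg t⁻¹) (by simpa using hmono _ _)

lemma partialD_eq_zero_of_notMem {η : E3 → ℝ} {x : E3} (hx : x ∉ tsupport η) (i : Fin 3) :
    partialD i η x = 0 := by
  rw [partialD, fderiv_of_notMem_tsupport (𝕜 := ℝ) hx]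
  rfl

lemma continuous_partialD {η : E3 → ℝ} (hη : ContDiff ℝ 1 η) (i : Fin 3) :
    Continuous (partialD i η) :=
  (hη.continuous_fderiv one_ne_zero).clm_apply continuous_const

lemma hasCompactSupport_partialD {η : E3 → ℝ} (hη : HasCompactSupport η) (i : Fin 3) :
    HasCompactSupport (partialD i η) :=
  hη.fderiv_apply (𝕜 := ℝ) _

lemma integral_mul_partialD {P η : E3 → ℝ} (hP : ContDiff ℝ 1 P) (hη : ContDiff ℝ 1 η)
    (hc : HasCompactSupport η) (i : Fin 3) :
    ∫ x, P x * partialD i η x = -∫ x, partialD i P x * η x := by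
  refine integral_mul_fderiv_eq_neg_fderiv_mul_of_integrable ?_ ?_ ?_ (fun x _ =>
    hP.differentiable one_ne_zero x) (fun x _ => hη.differentiable one_ne_zero x)
  · exact ((continuous_partialD hP i).mul hη.continuous).integrable_of_hasCompactSupport
      hc.mul_left
  · exact (hP.continuous.mul (continuous_partialD hη i)).integrable_of_hasCompactSupport
      (hasCompactSupport_partialD hc i).mul_left
  · exact (hP.continuous.mul hη.continuous).integrable_of_hasCompactSupport hc.mul_left

lemma setIntegral_mul_partialD {U : Set E3} {P η : E3 → ℝ} (hP : ContDiff ℝ 1 P)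
    (hη : ContDiff ℝ 1 η) (hc : HasCompactSupport η) (hs : tsupport η ⊆ U) (i : Fin 3) :
    ∫ x in U, P x * partialD i η x = -∫ x in U, partialD i P x * η x := by
  have hout : ∀ x, x ∉ U → x ∉ tsupport η := fun x hx h => hx (hs h)
  rw [setIntegral_eq_integral_of_forall_compl_eq_zero, integral_mul_partialD hP hη hc,
    setIntegral_eq_integral_of_forall_compl_eq_zero]
  · intro x hx
    rw [image_eq_zero_of_notMem_tsupport (hout x hx), mul_zero]
  · intro x hx
    rw [partialD_eq_zero_of_notMem (hout x hx), mul_zero]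

variable {U : Set E3}

lemma eventually_closedBall_subset (hU : IsOpen U) {K : Set E3} (hK : IsCompact K) (hKU : K ⊆ U) :
    ∀ᶠ n : ℕ in atTop, ∀ x ∈ K, Metric.closedBall x (1 / ((n : ℝ) + 1)) ⊆ U := by
  obtain ⟨δ, hδ, h⟩ := hK.exists_cthickening_subset_open hU hKU
  filter_upwards [tendsto_one_div_add_atTop_nhds_zero_nat.eventually_lt_const hδ] with n hn x hx
  exact (Metric.closedBall_subset_closedBall hn.le).trans
    ((Metric.closedBall_subset_cthickening hx δ).trans h)

lemma ae_tendsto_field_mollify (hU : MeasurableSet U) {F : κ → E3 → ℝ}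
    (hF : ∀ j, IntegrableOn (F j) U) :
    ∀ᵐ x ∂(volume.restrict U),
      Tendsto (fun n => field (fun j => mollify U n (F j)) x) atTop (𝓝 (field F x)) := by
  have h := ae_all_iff.2 fun j => ae_restrict_of_ae (s := U) (ae_tendsto_mollify hU (hF j))
  filter_upwards [h, ae_restrict_mem hU] with x hx hxU
  have h1 : Tendsto (fun n => fun j => mollify U n (F j) x) atTop (𝓝 fun j => F j x) :=
    tendsto_pi_nhds.2 fun j => by simpa [hxU] using hx j
  exact ((PiLp.continuous_toLp 2 _).tendsto _).comp h1

variable {Φ k : EuclideanSpace ℝ κ → ℝ}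

lemma IsRadialEntropy.abs_mul_apply_le (h : IsRadialEntropy Φ k) (X : EuclideanSpace ℝ κ) (j : κ) :
    |k X * X j| ≤ 1 := by
  have := (PiLp.norm_apply_le (k X • X) j).trans (h.norm_smul_le X)
  simpa using this

lemma IsRadialEntropy.contDiff_map (h : IsRadialEntropy Φ k) : ContDiff ℝ 1 Φ := by
  rw [contDiff_one_iff_fderiv]
  refine ⟨fun X => (h.hasFDerivAt X).differentiableAt, ?_⟩
  have : fderiv ℝ Φ = fun X => k X • innerSL ℝ X := by
    ext1 X
    exact (h.hasFDerivAt X).fderiv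
  rw [this]
  exact h.contDiff.continuous.smul (innerSL ℝ).continuous

lemma IsRadialEntropy.partialD_comp (h : IsRadialEntropy Φ k) {F : κ → E3 → ℝ} {x : E3}
    (hF : ∀ j, DifferentiableAt ℝ (F j) x) (i : Fin 3) :
    partialD i (fun y => Φ (field F y)) x
      = ∑ j, k (field F x) * F j x * partialD i (F j) x := by
  have hd : DifferentiableAt ℝ (field F) x := differentiableAt_euclidean.2 hF
  have h1 := (h.hasFDerivAt (field F x)).comp x hd.hasFDerivAt
  have h2 : fderiv ℝ (fun y => Φ (field F y)) x = _ := h1.fderiv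
  rw [partialD, h2]
  simp only [ContinuousLinearMap.comp_apply, smul_apply, innerSL_apply_apply,
    inner_eq_sum, fderiv_field_apply hF, field_apply, smul_eq_mul, Finset.mul_sum, mul_assoc]

lemma IsRadialEntropy.tendsto_integral_mul (h : IsRadialEntropy Φ k) (hU : MeasurableSet U)
    {F : κ → E3 → ℝ} (hF : ∀ j, IntegrableOn (F j) U) {G : E3 → ℝ} (hG : IntegrableOn G U)
    {ζ : E3 → ℝ} (hζ : Continuous ζ) (hc : HasCompactSupport ζ) (j : κ) :
    Tendsto (fun n => ∫ x in U, (k (field (fun j => mollify U n (F j)) x) * mollify U n (F j) x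
      * ζ x) * mollify U n G x) atTop
      (𝓝 (∫ x in U, (k (field F x) * F j x * ζ x) * G x)) := by
  obtain ⟨C, hC⟩ := hc.exists_bound_of_continuous hζ
  have hfc : ∀ n, Continuous (field fun j => mollify U n (F j)) := fun n =>
    (contDiff_field fun j => contDiff_mollify hU (hF j) n).continuous
  have hK : Continuous fun X : EuclideanSpace ℝ κ => k X * X j := by
    have := h.contDiff.continuous
    fun_prop
  refine tendsto_integral_mul_of_tendsto_integral_abs_sub (C := C)
    (fun n => ?_) (fun n => .of_forall fun x => ?_) ?_
    (fun n => (integrable_mollify hU hG n).integrableOn) hG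
    (tendsto_integral_abs_mollify_sub hU hG)
  · exact ((hK.comp (hfc n)).mul hζ).aestronglyMeasurable
  · have h1 := h.abs_mul_apply_le (field (fun j => mollify U n (F j)) x) j
    have h2 := hC x
    rw [abs_mul]
    exact (mul_le_of_le_one_left (abs_nonneg _) h1).trans h2
  · filter_upwards [ae_tendsto_field_mollify hU hF] with x hx
    exact ((hK.tendsto _).comp hx).mul_const _

lemma integrable_mul_mul_mul (h : IsRadialEntropy Φ k)
    {F : κ → E3 → ℝ} (hF : ∀ j, IntegrableOn (F j) U) {G : E3 → ℝ} (hG : IntegrableOn G U)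
    {ζ : E3 → ℝ} (hζ : Continuous ζ) {C : ℝ} (hC : ∀ x, |ζ x| ≤ C) (j : κ) :
    IntegrableOn (fun x => (k (field F x) * F j x * ζ x) * G x) U := by
  have hm : AEStronglyMeasurable (field F) (volume.restrict U) :=
    aestronglyMeasurable_field fun j => (hF j).aestronglyMeasurable
  refine Integrable.bdd_mul (c := C) hG ?_ (.of_forall fun x => ?_)
  · exact ((h.contDiff.continuous.comp_aestronglyMeasurable hm).mul
      (hF j).aestronglyMeasurable).mul hζ.aestronglyMeasurable
  · have h1 := h.abs_mul_apply_le (field F x) j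
    rw [Real.norm_eq_abs, abs_mul]
    exact (mul_le_of_le_one_left (abs_nonneg _) h1).trans (hC x)

/-- The weak form of ∂ᵢΦ(F) = Σ k(F) Fⱼ ∂ᵢFⱼ. It is classical for mollified fields, whose
derivatives are the mollified weak derivatives near the support of η once n is large. The left side
converges since Φ is 1-Lipschitz, the right side since k(F) Fⱼ is bounded. Subtracting Φ(0) makes
the entropy integrable without a bound on the measure of U. -/
lemma IsRadialEntropy.setIntegral_mul_partialD (h : IsRadialEntropy Φ k) (hU : IsOpen U)
    {F G : κ → E3 → ℝ} (hF : ∀ j, IntegrableOn (F j) U) (hG : ∀ j, IntegrableOn (G j) U)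
    {i : Fin 3} (hFG : ∀ j, IsWeakPartial U i (F j) (G j))
    {η : E3 → ℝ} (hη : ContDiff ℝ 1 η) (hc : HasCompactSupport η) (hs : tsupport η ⊆ U) :
    ∫ x in U, (Φ (field F x) - Φ 0) * partialD i η x
      = -∫ x in U, ∑ j, (k (field F x) * F j x * η x) * G j x := by
  have hUm := hU.measurableSet
  obtain ⟨C, hC⟩ := hc.exists_bound_of_continuous hη.continuous
  have hsm : ∀ n j, ContDiff ℝ ∞ (mollify U n (F j)) := fun n j => contDiff_mollify hUm (hF j) n
  have hfs : ∀ n, ContDiff ℝ 1 (field fun j => mollify U n (F j)) := fun n =>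
    (contDiff_field (hsm n)).of_le (by exact_mod_cast le_top)
  have hfm : AEStronglyMeasurable (field F) (volume.restrict U) :=
    aestronglyMeasurable_field fun j => (hF j).aestronglyMeasurable
  have hint : ∀ {f : κ → E3 → ℝ}, AEStronglyMeasurable (field f) (volume.restrict U) →
      (∀ j, IntegrableOn (f j) U) → IntegrableOn (fun x => Φ (field f x) - Φ 0) U := fun hm hf => by
    refine Integrable.mono' (integrable_finsetSum Finset.univ fun j _ => (hf j).abs)
      ((h.continuous.comp_aestronglyMeasurable hm).sub aestronglyMeasurable_const)
      (.of_forall fun x => ?_)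
    rw [Real.norm_of_nonneg (sub_nonneg.2 (h.map_zero_le _))]
    exact (h.sub_map_zero_le_norm _).trans (norm_le_sum_abs _)
  have hleft : Tendsto (fun n => ∫ x in U, partialD i η x *
      (Φ (field (fun j => mollify U n (F j)) x) - Φ 0)) atTop
      (𝓝 (∫ x in U, partialD i η x * (Φ (field F x) - Φ 0))) := by
    obtain ⟨C', hC'⟩ := (hasCompactSupport_partialD hc i).exists_bound_of_continuous
      (continuous_partialD hη i)
    have hin : ∀ n, IntegrableOn (fun x => Φ (field (fun j => mollify U n (F j)) x) - Φ 0) U :=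
      fun n => hint (hfs n).continuous.aestronglyMeasurable
        fun j => (integrable_mollify hUm (hF j) n).integrableOn
    refine tendsto_integral_mul_of_tendsto_integral_abs_sub (C := C')
      (fun n => (continuous_partialD hη i).aestronglyMeasurable)
      (fun n => .of_forall fun x => hC' x)
      (.of_forall fun x => tendsto_const_nhds) hin (hint hfm hF) ?_
    have hsum := tendsto_finsetSum Finset.univ fun j _ =>
      tendsto_integral_abs_mollify_sub hUm (hF j)
    rw [Finset.sum_const_zero] at hsum
    refine squeeze_zero (fun n => integral_nonneg fun x => abs_nonneg _) (fun n => ?_) hsum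
    have hdi : ∀ j, IntegrableOn (fun x => |mollify U n (F j) x - F j x|) U := fun j =>
      ((integrable_mollify hUm (hF j) n).integrableOn.sub (hF j)).abs
    rw [← integral_finsetSum _ fun j _ => hdi j]
    refine integral_mono ((hin n).sub (hint hfm hF)).abs
      (integrable_finsetSum _ fun j _ => hdi j) fun x => ?_
    have h1 := h.lipschitz.dist_le_mul (field (fun j => mollify U n (F j)) x) (field F x)
    rw [NNReal.coe_one, one_mul, Real.dist_eq, dist_eq_norm] at h1
    simpa using h1.trans (norm_le_sum_abs _)
  have hright : Tendsto (fun n => -∑ j, ∫ x in U, (k (field (fun j => mollify U n (F j)) x)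
      * mollify U n (F j) x * η x) * mollify U n (G j) x) atTop
      (𝓝 (-∑ j, ∫ x in U, (k (field F x) * F j x * η x) * G j x)) :=
    (tendsto_finsetSum _ fun j _ => h.tendsto_integral_mul hUm hF (hG j) hη.continuous hc j).neg
  simp_rw [mul_comm _ (partialD i η _)]
  rw [integral_finsetSum _ fun j _ => integrable_mul_mul_mul h hF (hG j) hη.continuous hC j]
  refine tendsto_nhds_unique hleft (hright.congr' ?_)
  filter_upwards [eventually_closedBall_subset hU hc hs] with n hn
  have hP : ContDiff ℝ 1 fun x => Φ (field (fun j => mollify U n (F j)) x) - Φ 0 :=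
    (h.contDiff_map.comp (hfs n)).sub contDiff_const
  simp_rw [mul_comm (partialD i η _)]
  rw [BerisEdwards.setIntegral_mul_partialD hP hη hc hs, ← integral_finsetSum]
  · congr 2
    ext x
    by_cases hx : x ∈ tsupport η
    · have h1 := h.partialD_comp (x := x)
        (fun j => (hsm n j).differentiable (by simp) x) i
      have h2 : partialD i (fun x => Φ (field (fun j => mollify U n (F j)) x) - Φ 0) x
          = partialD i (fun x => Φ (field (fun j => mollify U n (F j)) x)) x := by
        rw [partialD, fderiv_sub_const, partialD]
      rw [h2, h1, Finset.sum_mul]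
      refine Finset.sum_congr rfl fun j _ => ?_
      rw [partialD_mollify hUm (hF j) (hFG j) (hn x hx)]
      ring
    · simp [image_eq_zero_of_notMem_tsupport hx]
  · exact fun j _ => integrable_mul_mul_mul h
      (fun j => (integrable_mollify hUm (hF j) n).integrableOn)
      (integrable_mollify hUm (hG j) n).integrableOn hη.continuous hC j

/-- Integrating by parts gives the right side minus ∫ η ∂ᵢ(k(F) F)·∂ᵢF, and the last integrand is
nonnegative by monotonicity. The term is dropped while the fields are still mollified, so its limit
never has to exist. -/
lemma IsRadialEntropy.setIntegral_mul_second_le (h : IsRadialEntropy Φ k) (hU : IsOpen U)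
    {F G L : κ → E3 → ℝ} (hF : ∀ j, IntegrableOn (F j) U) (hG : ∀ j, IntegrableOn (G j) U)
    (hL : ∀ j, IntegrableOn (L j) U)
    {i : Fin 3} (hFG : ∀ j, IsWeakPartial U i (F j) (G j))
    (hGL : ∀ j, IsWeakPartial U i (G j) (L j))
    {η : E3 → ℝ} (hη : ContDiff ℝ 1 η) (hc : HasCompactSupport η) (hs : tsupport η ⊆ U)
    (hη0 : ∀ x, 0 ≤ η x) :
    ∑ j, ∫ x in U, (k (field F x) * F j x * η x) * L j x
      ≤ -∑ j, ∫ x in U, (k (field F x) * F j x * partialD i η x) * G j x := by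
  have hUm := hU.measurableSet
  obtain ⟨C, hC⟩ := hc.exists_bound_of_continuous hη.continuous
  have hci := hasCompactSupport_partialD hc i
  have hηi := continuous_partialD hη i
  obtain ⟨C', hC'⟩ := hci.exists_bound_of_continuous hηi
  refine le_of_tendsto_of_tendsto
    (tendsto_finsetSum _ fun j _ => h.tendsto_integral_mul hUm hF (hL j) hη.continuous hc j)
    (tendsto_finsetSum _ fun j _ => h.tendsto_integral_mul hUm hF (hG j) hηi hci j).neg ?_
  filter_upwards [eventually_closedBall_subset hU hc hs] with n hn
  set f := field fun j => mollify U n (F j) with hf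
  set g := field fun j => mollify U n (G j) with hg
  have hfj : ∀ j, ContDiff ℝ 1 (mollify U n (F j)) := fun j =>
    (contDiff_mollify hUm (hF j) n).of_le (by exact_mod_cast le_top)
  have hgj : ∀ j, ContDiff ℝ 1 (mollify U n (G j)) := fun j =>
    (contDiff_mollify hUm (hG j) n).of_le (by exact_mod_cast le_top)
  have hfs : ContDiff ℝ 1 f := contDiff_field hfj
  have hgs : ContDiff ℝ 1 g := contDiff_field hgj
  have hKs : ContDiff ℝ 1 fun x => k (f x) • f x := (h.contDiff.comp hfs).smul hfs
  have hP : ContDiff ℝ 1 fun x => inner ℝ (k (f x) • f x) (g x) := hKs.inner ℝ hgs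
  have hmi : ∀ {F : E3 → ℝ}, IntegrableOn F U → IntegrableOn (mollify U n F) U := fun hF =>
    (integrable_mollify hUm hF n).integrableOn
  have hiL := fun j => integrable_mul_mul_mul h (fun j => hmi (hF j)) (hmi (hL j))
    hη.continuous hC j
  have hiG := fun j => integrable_mul_mul_mul h (fun j => hmi (hF j)) (hmi (hG j)) hηi hC' j
  rw [← integral_finsetSum _ fun j _ => hiL j, ← integral_finsetSum _ fun j _ => hiG j]
  have e : ∀ x, ∑ j, k (f x) * mollify U n (F j) x * partialD i η x * mollify U n (G j) x
      = inner ℝ (k (f x) • f x) (g x) * partialD i η x := fun x => by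
    rw [inner_eq_sum, Finset.sum_mul]
    refine Finset.sum_congr rfl fun j _ => ?_
    simp only [PiLp.smul_apply, smul_eq_mul, hf, hg, field_apply]
    ring
  refine le_of_le_of_eq ?_ (congrArg Neg.neg (integral_congr_ae (.of_forall fun x => (e x).symm)))
  rw [BerisEdwards.setIntegral_mul_partialD hP hη hc hs, neg_neg]
  refine setIntegral_mono_on (integrable_finsetSum _ fun j _ => hiL j)
    (((continuous_partialD hP i).mul hη.continuous).integrable_of_hasCompactSupport
      hc.mul_left).integrableOn hUm fun x _ => ?_
  by_cases hx : x ∈ tsupport η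
  · have hfd : DifferentiableAt ℝ f x := hfs.differentiable one_ne_zero x
    have hgd : DifferentiableAt ℝ g x := hgs.differentiable one_ne_zero x
    have hKd : DifferentiableAt ℝ (fun x => k (f x) • f x) x := hKs.differentiable one_ne_zero x
    have h1 : fderiv ℝ f x (EuclideanSpace.single i 1) = g x := by
      ext j
      rw [hf, fderiv_field_apply fun j => (hfj j).differentiable one_ne_zero x,
        partialD_mollify hUm (hF j) (hFG j) (hn x hx)]
      rfl
    have h2 := inner_fderiv_comp_nonneg h.monotone hfd hKd (EuclideanSpace.single i 1)
    rw [h1] at h2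
    -- The product rule for ⟨k(f) f, g⟩ yields the wanted term plus ⟨∂ᵢ(k(f) f), ∂ᵢf⟩, which `h2`
    -- shows to be nonnegative.
    rw [partialD, fderiv_inner_apply ℝ hKd hgd, ← Finset.sum_congr rfl (fun j _ =>
      show (k (f x) * mollify U n (F j) x * mollify U n (L j) x) * η x = _ by ring),
      ← Finset.sum_mul]
    refine mul_le_mul_of_nonneg_right ?_ (hη0 x)
    have h3 : ∑ j, k (f x) * mollify U n (F j) x * mollify U n (L j) x
        = inner ℝ (k (f x) • f x) (fderiv ℝ g x (EuclideanSpace.single i 1)) := by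
      rw [inner_eq_sum]
      refine Finset.sum_congr rfl fun j _ => ?_
      rw [hg, fderiv_field_apply fun j => (hgj j).differentiable one_ne_zero x,
        partialD_mollify hUm (hG j) (hGL j) (hn x hx)]
      simp [hf]
    linarith
  · simp [image_eq_zero_of_notMem_tsupport hx]

end Fields

/-! ### The boundary layer -/

/-- The points of the sublevel set `{ρ < 0}` at which `-ε < ρ`. -/
def layer (ρ : E3 → ℝ) (ε : ℝ) : Set E3 := {x | -ε < ρ x ∧ ρ x < 0}

lemma measurableSet_layer {ρ : E3 → ℝ} (hρ : Continuous ρ) (ε : ℝ) :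
    MeasurableSet (layer ρ ε) :=
  ((isOpen_lt continuous_const hρ).inter (isOpen_lt hρ continuous_const)).measurableSet

lemma fderiv_apply_eq_sum (φ : E3 → ℝ) (x e : E3) :
    fderiv ℝ φ x e = ∑ i, e i * partialD i φ x := by
  conv_lhs => rw [← (EuclideanSpace.basisFun (Fin 3) ℝ).sum_repr e, map_sum]
  simp [partialD]

lemma lintegral_enorm_fderiv_le {φ : E3 → ℝ} (hφ : ContDiff ℝ 1 φ) (s : Set E3) (e : E3) :
    ∫⁻ x in s, ‖fderiv ℝ φ x e‖ₑ ≤ ‖e‖ₑ * ∑ i, ∫⁻ x in s, ‖partialD i φ x‖ₑ := by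
  rw [← lintegral_finsetSum _ fun i _ => (continuous_partialD hφ i).enorm.measurable,
    ← lintegral_const_mul' _ _ enorm_ne_top]
  refine lintegral_mono fun x => ?_
  simp only
  rw [fderiv_apply_eq_sum, Finset.mul_sum]
  refine (enorm_sum_le _ _).trans (Finset.sum_le_sum fun i _ => ?_)
  rw [enorm_mul]
  gcongr
  rw [enorm_le_iff_norm_le]
  exact PiLp.norm_apply_le e i

/-- A one-dimensional Poincaré estimate in the direction `e`, for a function which vanishes after
a translation by `T • e`. -/
lemma lintegral_enorm_le_of_translate {φ : E3 → ℝ} (hφ : ContDiff ℝ 1 φ) {s t : Set E3}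
    (hs : MeasurableSet s) {e : E3} {T : ℝ} (hT : 0 ≤ T)
    (hzero : ∀ x ∈ s, φ (x + T • e) = 0)
    (hmaps : ∀ x ∈ s, ∀ τ ∈ Ioc 0 T, x + τ • e ∈ t ∨ fderiv ℝ φ (x + τ • e) = 0)
    (ht : MeasurableSet t) :
    ∫⁻ x in s, ‖φ x‖ₑ ≤ ENNReal.ofReal T * ∫⁻ x in t, ‖fderiv ℝ φ x e‖ₑ := by
  have hcont : Continuous fun p : E3 × ℝ => fderiv ℝ φ (p.1 + p.2 • e) e :=
    ((hφ.continuous_fderiv one_ne_zero).comp (by fun_prop)).clm_apply continuous_const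
  have hpt : ∀ x ∈ s, ‖φ x‖ₑ ≤ ∫⁻ τ in Ioc 0 T, ‖fderiv ℝ φ (x + τ • e) e‖ₑ := fun x hx => by
    have hd : ∀ τ ∈ uIcc 0 T, HasDerivAt (fun τ : ℝ => φ (x + τ • e))
        (fderiv ℝ φ (x + τ • e) e) τ :=
      fun τ _ => by
      have h1 : HasDerivAt (fun τ : ℝ => x + τ • e) e τ := by
        simpa using ((hasDerivAt_id τ).smul_const e).const_add x
      exact ((hφ.differentiable one_ne_zero _).hasFDerivAt).comp_hasDerivAt τ h1
    have hc : Continuous fun τ : ℝ => fderiv ℝ φ (x + τ • e) e :=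
      hcont.comp (by fun_prop : Continuous fun τ : ℝ => (x, τ))
    have h2 := intervalIntegral.integral_eq_sub_of_hasDerivAt hd (hc.intervalIntegrable 0 T)
    rw [hzero x hx, zero_smul, add_zero, zero_sub, intervalIntegral.integral_of_le hT] at h2
    rw [← enorm_neg, ← h2]
    exact enorm_integral_le_lintegral_enorm _
  calc ∫⁻ x in s, ‖φ x‖ₑ
      ≤ ∫⁻ x in s, ∫⁻ τ in Ioc 0 T, ‖fderiv ℝ φ (x + τ • e) e‖ₑ := setLIntegral_mono' hs hpt
    _ = ∫⁻ τ in Ioc 0 T, ∫⁻ x in s, ‖fderiv ℝ φ (x + τ • e) e‖ₑ :=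
        lintegral_lintegral_swap hcont.enorm.measurable.aemeasurable
    _ ≤ ∫⁻ τ in Ioc 0 T, ∫⁻ x in t, ‖fderiv ℝ φ x e‖ₑ := by
        refine setLIntegral_mono' measurableSet_Ioc fun τ hτ => ?_
        rw [← lintegral_indicator hs, ← lintegral_indicator ht,
          ← lintegral_add_right_eq_self (t.indicator fun x => ‖fderiv ℝ φ x e‖ₑ) (τ • e)]
        refine lintegral_mono fun x => ?_
        by_cases hx : x ∈ s
        · rw [indicator_of_mem hx]
          rcases hmaps x hx τ hτ with h | h
          · rw [indicator_of_mem h]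
          · simp [h]
        · rw [indicator_of_notMem hx]
          exact zero_le
    _ = ENNReal.ofReal T * ∫⁻ x in t, ‖fderiv ℝ φ x e‖ₑ := by
        rw [setLIntegral_const, Real.volume_Ioc, sub_zero, mul_comm]

variable {U : Set E3} {ρ : E3 → ℝ}

/-- With e normalised by dρ(x₀)e = 1, the derivative of ρ along e exceeds 1/2 near x₀. Translation
along this fixed direction replaces a flattening of the boundary. -/
lemma IsDefiningFunction.exists_increasing_direction (hρ : IsDefiningFunction U ρ) {x₀ : E3}
    (hx₀ : ρ x₀ = 0) :
    ∃ e : E3, ∃ R > 0, ∀ x ∈ Metric.ball x₀ R, ∀ τ, 0 < τ → τ * ‖e‖ < R →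
      ρ x + τ / 2 ≤ ρ (x + τ • e) := by
  have hρ1 : ContDiff ℝ 1 ρ := hρ.contDiff.of_le (by norm_num)
  obtain ⟨v, hv⟩ : ∃ v, fderiv ℝ ρ x₀ v ≠ 0 := by
    by_contra! h
    exact hρ.fderiv_ne_zero x₀ hx₀ (ContinuousLinearMap.ext h)
  set e : E3 := (fderiv ℝ ρ x₀ v)⁻¹ • v with he
  have he1 : fderiv ℝ ρ x₀ e = 1 := by simp [he, hv]
  have hcont : Continuous fun x => fderiv ℝ ρ x e :=
    (hρ1.continuous_fderiv one_ne_zero).clm_apply continuous_const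
  have hev : ∀ᶠ x in 𝓝 x₀, 1 / 2 < fderiv ℝ ρ x e :=
    hcont.continuousAt.eventually_const_lt (by simp only [he1]; norm_num)
  obtain ⟨R, hR, hball⟩ := Metric.eventually_nhds_iff_ball.1 hev
  refine ⟨e, R / 2, by positivity, fun x hx τ hτ hτe => ?_⟩
  have hd : ∀ σ : ℝ, HasDerivAt (fun σ : ℝ => ρ (x + σ • e)) (fderiv ℝ ρ (x + σ • e) e) σ :=
    fun σ => by
    have h1 : HasDerivAt (fun σ : ℝ => x + σ • e) e σ := by
      simpa using ((hasDerivAt_id σ).smul_const e).const_add x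
    exact ((hρ1.differentiable one_ne_zero _).hasFDerivAt).comp_hasDerivAt σ h1
  obtain ⟨σ, hσ, hs⟩ := exists_hasDerivAt_eq_slope (fun σ : ℝ => ρ (x + σ • e)) _ hτ
    (fun σ _ => (hd σ).continuousAt.continuousWithinAt) (fun σ _ => hd σ)
  have hmem : x + σ • e ∈ Metric.ball x₀ R := by
    rw [Metric.mem_ball, dist_eq_norm] at hx ⊢
    have h1 : ‖σ • e‖ ≤ τ * ‖e‖ := by
      rw [norm_smul, Real.norm_of_nonneg hσ.1.le]
      exact mul_le_mul_of_nonneg_right hσ.2.le (norm_nonneg e)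
    calc ‖x + σ • e - x₀‖ = ‖(x - x₀) + σ • e‖ := by congr 1; abel
      _ ≤ ‖x - x₀‖ + ‖σ • e‖ := norm_add_le _ _
      _ < R := by linarith
  have h2 := hball _ hmem
  simp only [hs, zero_smul, add_zero, sub_zero] at h2
  rw [lt_div_iff₀ hτ] at h2
  linarith

/-- A shift by 2ε along e raises ρ by at least ε and thus carries the layer out of U, where φ
vanishes. On the way each point stays in the layer or has left the support of φ, so the
one-dimensional Poincaré estimate gains a factor ε and only sees the gradient inside the layer. -/
lemma exists_ball_layer_estimate (hρ : IsDefiningFunction U ρ) {x₀ : E3} (hx₀ : ρ x₀ = 0) :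
    ∃ r > 0, ∃ M : ENNReal, M ≠ ⊤ ∧ ∃ ε₀ > 0, ∀ ε, 0 < ε → ε < ε₀ → ∀ φ, IsTestFunction U φ →
      ∫⁻ x in Metric.ball x₀ r ∩ layer ρ ε, ‖φ x‖ₑ
        ≤ M * ENNReal.ofReal ε * ∑ i, ∫⁻ x in layer ρ ε, ‖partialD i φ x‖ₑ := by
  have hρ1 : ContDiff ℝ 1 ρ := hρ.contDiff.of_le (by norm_num)
  obtain ⟨e, R, hR, hstep⟩ := hρ.exists_increasing_direction hx₀
  refine ⟨R, hR, 2 * ‖e‖ₑ, by finiteness, R / (2 * (‖e‖ + 1)), by positivity,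
    fun ε hε hεε φ hφ => ?_⟩
  have hφ1 : ContDiff ℝ 1 φ := hφ.1.of_le (by exact_mod_cast le_top)
  have hsmall : 2 * ε * ‖e‖ < R := by
    rw [lt_div_iff₀ (by positivity)] at hεε
    nlinarith [norm_nonneg e]
  have hUeq : ∀ x, x ∈ U ↔ ρ x < 0 := fun x => by rw [hρ.eq_sublevel]; rfl
  refine (lintegral_enorm_le_of_translate hφ1 (t := layer ρ ε) (T := 2 * ε) (e := e)
    (Metric.isOpen_ball.measurableSet.inter (measurableSet_layer hρ1.continuous ε))
    (by positivity) (fun x hx => ?_) (fun x hx τ hτ => ?_)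
    (measurableSet_layer hρ1.continuous ε)).trans ?_
  · have h1 := hstep x hx.1 (2 * ε) (by positivity) hsmall
    have h2 := hx.2.1
    refine image_eq_zero_of_notMem_tsupport fun h => ?_
    have h3 := (hUeq _).1 (hφ.2.2 h)
    linarith
  · have h1 := hstep x hx.1 τ hτ.1 (lt_of_le_of_lt
      (mul_le_mul_of_nonneg_right hτ.2 (norm_nonneg e)) hsmall)
    have h2 := hx.2.1
    have h3 := hτ.1
    by_cases h : x + τ • e ∈ tsupport φ
    · exact Or.inl ⟨by linarith, (hUeq _).1 (hφ.2.2 h)⟩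
    · exact Or.inr (fderiv_of_notMem_tsupport (𝕜 := ℝ) h)
  · calc _ ≤ ENNReal.ofReal (2 * ε) * (‖e‖ₑ * ∑ i, ∫⁻ x in layer ρ ε, ‖partialD i φ x‖ₑ) := by
          gcongr
          exact lintegral_enorm_fderiv_le hφ1 _ _
      _ = _ := by
          rw [ENNReal.ofReal_mul (by norm_num), ENNReal.ofReal_ofNat]
          ring

/-- Compactness of the closure of U patches the local estimates; an interior point has a
neighbourhood that thin layers do not meet. -/
lemma exists_layer_estimate (hb : Bornology.IsBounded U) (hρ : IsDefiningFunction U ρ) :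
    ∃ M : ENNReal, M ≠ ⊤ ∧ ∃ ε₀ > 0, ∀ ε, 0 < ε → ε < ε₀ → ∀ φ, IsTestFunction U φ →
      ∫⁻ x in layer ρ ε, ‖φ x‖ₑ
        ≤ M * ENNReal.ofReal ε * ∑ i, ∫⁻ x in layer ρ ε, ‖partialD i φ x‖ₑ := by
  have hρc : Continuous ρ := hρ.contDiff.continuous
  have hK : IsCompact (closure U) := hb.isCompact_closure
  have hind := hK.induction_on (p := fun s => ∃ M : ENNReal, M ≠ ⊤ ∧ ∃ ε₀ > 0, ∀ ε, 0 < ε →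
    ε < ε₀ → ∀ φ, IsTestFunction U φ → ∫⁻ x in s ∩ layer ρ ε, ‖φ x‖ₑ
        ≤ M * ENNReal.ofReal ε * ∑ i, ∫⁻ x in layer ρ ε, ‖partialD i φ x‖ₑ)
    ⟨0, by simp, 1, one_pos, fun ε _ _ φ _ => by simp⟩ ?_ ?_ ?_
  · obtain ⟨M, hM, ε₀, hε₀, h⟩ := hind
    refine ⟨M, hM, ε₀, hε₀, fun ε hε hεε φ hφ => ?_⟩
    have hsub : layer ρ ε ⊆ closure U := fun x hx =>
      subset_closure (by rw [hρ.eq_sublevel]; exact hx.2)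
    have := h ε hε hεε φ hφ
    rwa [inter_eq_self_of_subset_right hsub] at this
  · rintro s t hst ⟨M, hM, ε₀, hε₀, h⟩
    exact ⟨M, hM, ε₀, hε₀, fun ε hε hεε φ hφ =>
      (lintegral_mono_set (inter_subset_inter_left _ hst)).trans (h ε hε hεε φ hφ)⟩
  · rintro s t ⟨M, hM, ε₀, hε₀, h⟩ ⟨M', hM', ε₀', hε₀', h'⟩
    refine ⟨M + M', by finiteness, min ε₀ ε₀', lt_min hε₀ hε₀', fun ε hε hεε φ hφ => ?_⟩
    rw [union_inter_distrib_right, add_mul, add_mul]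
    exact (lintegral_union_le _ _ _).trans (add_le_add
      (h ε hε (hεε.trans_le (min_le_left _ _)) φ hφ)
      (h' ε hε (hεε.trans_le (min_le_right _ _)) φ hφ))
  · intro x₀ hx₀
    have hle : ρ x₀ ≤ 0 := by
      have : closure U ⊆ {x | ρ x ≤ 0} := closure_minimal
        (fun x hx => by
          rw [hρ.eq_sublevel] at hx
          exact le_of_lt (show ρ x < 0 from hx))
        (isClosed_le hρc continuous_const)
      exact this hx₀
    rcases hle.lt_or_eq with hlt | heq
    · refine ⟨{x | ρ x < ρ x₀ / 2}, mem_nhdsWithin_of_mem_nhds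
        ((isOpen_lt hρc continuous_const).mem_nhds (by simp only [mem_ofPred_eq]; linarith)),
        0, by simp, -(ρ x₀ / 2), by linarith, fun ε hε hεε φ hφ => ?_⟩
      have : {x | ρ x < ρ x₀ / 2} ∩ layer ρ ε = ∅ := by
        ext x
        simp only [layer, mem_inter_iff, mem_ofPred_eq, mem_empty_iff_false, iff_false]
        rintro ⟨h1, h2, -⟩
        linarith
      simp [this]
    · obtain ⟨r, hr, M, hM, ε₀, hε₀, h⟩ := exists_ball_layer_estimate hρ heq
      exact ⟨Metric.ball x₀ r, mem_nhdsWithin_of_mem_nhds (Metric.ball_mem_nhds x₀ hr),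
        M, hM, ε₀, hε₀, h⟩

/-- The functions `G i` are integrable, and `g` is the limit in `L¹(U)` of test functions whose
partial derivatives converge to `G i`. -/
structure IsTestLimit (U : Set E3) (g : E3 → ℝ) (G : Fin 3 → E3 → ℝ) : Prop where
  integrable : IntegrableOn g U
  integrable_partial : ∀ i, IntegrableOn (G i) U
  approx : ∀ ε : ℝ≥0∞, 0 < ε → ∃ φ, IsTestFunction U φ ∧ ∫⁻ x in U, ‖g x - φ x‖ₑ ≤ ε ∧
    ∀ i, ∫⁻ x in U, ‖G i x - partialD i φ x‖ₑ ≤ ε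

/-- The constants do not depend on the test function, so the estimate survives L¹ limits. It is the
quantitative form of zero trace: as the gradient is integrated over the layer only, the mean of g
over the layer is not merely bounded but tends to 0. -/
lemma exists_layer_estimate_of_isTestLimit (hb : Bornology.IsBounded U)
    (hρ : IsDefiningFunction U ρ) :
    ∃ M : ENNReal, M ≠ ⊤ ∧ ∃ ε₀ > 0, ∀ ε, 0 < ε → ε < ε₀ → ∀ g G, IsTestLimit U g G →
      ∫⁻ x in layer ρ ε, ‖g x‖ₑ
        ≤ M * ENNReal.ofReal ε * ∑ i, ∫⁻ x in layer ρ ε, ‖G i x‖ₑ := by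
  obtain ⟨M, hM, ε₀, hε₀, h⟩ := exists_layer_estimate hb hρ
  refine ⟨M, hM, ε₀, hε₀, fun ε hε hεε g G hg => ?_⟩
  have hsub : layer ρ ε ⊆ U := fun x hx => by rw [hρ.eq_sublevel]; exact hx.2
  have key : ∀ δ : ℝ≥0∞, 0 < δ → ∫⁻ x in layer ρ ε, ‖g x‖ₑ ≤ δ + M * ENNReal.ofReal ε *
      ∑ i, ((∫⁻ x in layer ρ ε, ‖G i x‖ₑ) + δ) := fun δ hδ => by
    obtain ⟨φ, hφ, h1, h2⟩ := hg.approx δ hδ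
    have hφ1 : ContDiff ℝ 1 φ := hφ.1.of_le (by exact_mod_cast le_top)
    calc ∫⁻ x in layer ρ ε, ‖g x‖ₑ
        ≤ ∫⁻ x in layer ρ ε, ‖g x - φ x‖ₑ + ‖φ x‖ₑ :=
          lintegral_mono fun x => by simpa using enorm_add_le (g x - φ x) (φ x)
      _ = (∫⁻ x in layer ρ ε, ‖g x - φ x‖ₑ) + ∫⁻ x in layer ρ ε, ‖φ x‖ₑ :=
          lintegral_add_right _ hφ1.continuous.enorm.measurable
      _ ≤ δ + M * ENNReal.ofReal ε * ∑ i, ∫⁻ x in layer ρ ε, ‖partialD i φ x‖ₑ :=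
          add_le_add ((lintegral_mono_set hsub).trans h1) (h ε hε hεε φ hφ)
      _ ≤ _ := by
          gcongr with i _
          calc ∫⁻ x in layer ρ ε, ‖partialD i φ x‖ₑ
              ≤ ∫⁻ x in layer ρ ε, ‖G i x‖ₑ + ‖G i x - partialD i φ x‖ₑ :=
                lintegral_mono fun x => by
                  simpa using enorm_sub_le (a := G i x) (b := G i x - partialD i φ x)
            _ = (∫⁻ x in layer ρ ε, ‖G i x‖ₑ) + ∫⁻ x in layer ρ ε, ‖G i x - partialD i φ x‖ₑ :=
                lintegral_add_left' ((hg.integrable_partial i).aestronglyMeasurable.mono_measure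
                  (Measure.restrict_mono hsub le_rfl)).enorm _
            _ ≤ _ := by
                gcongr
                exact (lintegral_mono_set hsub).trans (h2 i)
  have hlim : Tendsto (fun δ : ℝ≥0∞ => δ + M * ENNReal.ofReal ε *
      ∑ i, ((∫⁻ x in layer ρ ε, ‖G i x‖ₑ) + δ)) (𝓝[>] 0)
      (𝓝 (0 + M * ENNReal.ofReal ε * ∑ i, ((∫⁻ x in layer ρ ε, ‖G i x‖ₑ) + 0))) := by
    have h0 : Tendsto (fun δ : ℝ≥0∞ => δ) (𝓝[>] 0) (𝓝 0) := nhdsWithin_le_nhds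
    exact h0.add (ENNReal.Tendsto.const_mul (tendsto_finsetSum _ fun i _ =>
      tendsto_const_nhds.add h0) (Or.inr (by finiteness)))
  simp only [zero_add, add_zero] at hlim
  exact ge_of_tendsto hlim (eventually_nhdsWithin_of_forall fun δ hδ => key δ hδ)

lemma tendsto_lintegral_layer (hρ : Continuous ρ) {G : E3 → ℝ}
    (hG : IntegrableOn G {x | ρ x < 0}) {ε : ℕ → ℝ} (hε : Tendsto ε atTop (𝓝 0)) :
    Tendsto (fun n => ∫⁻ x in layer ρ (ε n), ‖G x‖ₑ) atTop (𝓝 0) := by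
  have hlim : Tendsto (fun n => ∫⁻ x in {x | ρ x < 0},
      (layer ρ (ε n)).indicator (fun x => ‖G x‖ₑ) x) atTop
      (𝓝 (∫⁻ x in {x | ρ x < 0}, 0)) := by
    refine tendsto_lintegral_of_dominated_convergence' (fun x => ‖G x‖ₑ)
      (fun n => hG.aestronglyMeasurable.enorm.indicator (measurableSet_layer hρ _))
      (fun n => .of_forall fun x => indicator_le_self _ _ _) hG.2.ne ?_
    filter_upwards [ae_restrict_mem (isOpen_lt hρ continuous_const).measurableSet] with x hx
    have hx' : 0 < -ρ x := neg_pos.2 hx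
    refine tendsto_const_nhds.congr' ?_
    filter_upwards [hε.eventually_lt_const hx'] with n hn
    rw [indicator_of_notMem]
    intro h
    linarith [h.1]
  rw [lintegral_zero] at hlim
  refine hlim.congr fun n => ?_
  rw [lintegral_indicator (measurableSet_layer hρ _),
    Measure.restrict_restrict (measurableSet_layer hρ _), inter_eq_self_of_subset_left]
  exact fun x hx => hx.2

/-! ### Comparison of two defining functions -/

section Comparison

variable {U : Set E3} {ρ σ : E3 → ℝ}

lemma IsDefiningFunction.contDiff_one (hρ : IsDefiningFunction U ρ) : ContDiff ℝ 1 ρ :=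
  hρ.contDiff.of_le (by norm_num)

lemma IsDefiningFunction.mem_iff (hρ : IsDefiningFunction U ρ) {x : E3} : x ∈ U ↔ ρ x < 0 := by
  rw [hρ.eq_sublevel]
  rfl

lemma IsDefiningFunction.eventually_mem (hρ : IsDefiningFunction U ρ) {y w : E3} (hy : ρ y = 0)
    (hw : fderiv ℝ ρ y w < 0) : ∀ᶠ s : ℝ in 𝓝[>] 0, y + s • w ∈ U := by
  have h1 := (((hρ.contDiff_one.differentiable one_ne_zero y).hasFDerivAt).hasLineDerivAt w)
  have h2 := (h1.tendsto_slope_zero).mono_left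
    (nhdsWithin_mono 0 fun s (hs : 0 < s) => (hs.ne' : s ≠ 0))
  filter_upwards [h2.eventually_lt_const hw, self_mem_nhdsWithin] with s hs hs0
  rw [hρ.mem_iff]
  rw [hy, sub_zero, smul_eq_mul] at hs
  by_contra! h
  exact absurd hs (not_lt.2 (mul_nonneg (inv_nonneg.2 (le_of_lt hs0)) h))

lemma IsDefiningFunction.exists_fderiv_eq_one (hρ : IsDefiningFunction U ρ) {y : E3}
    (hy : ρ y = 0) : ∃ w, fderiv ℝ ρ y w = 1 := by
  obtain ⟨v, hv⟩ : ∃ v, fderiv ℝ ρ y v ≠ 0 := by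
    by_contra! h
    exact hρ.fderiv_ne_zero y hy (ContinuousLinearMap.ext h)
  exact ⟨(fderiv ℝ ρ y v)⁻¹ • v, by simp [hv]⟩

/-- Moving from y in a direction that decreases ρ enters U, so σ(y) ≤ 0 by continuity; y itself lies
outside U, so σ(y) ≥ 0. -/
lemma IsDefiningFunction.eq_zero_of_eq_zero (hρ : IsDefiningFunction U ρ)
    (hσ : IsDefiningFunction U σ) {y : E3} (hy : ρ y = 0) : σ y = 0 := by
  obtain ⟨w, hw⟩ := hρ.exists_fderiv_eq_one hy
  have h1 := hρ.eventually_mem hy (w := -w) (by simp [hw])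
  have hc : Tendsto (fun s : ℝ => σ (y + s • -w)) (𝓝[>] 0) (𝓝 (σ y)) := by
    have : Continuous fun s : ℝ => σ (y + s • -w) :=
      hσ.contDiff.continuous.comp (by fun_prop)
    simpa using (this.tendsto 0).mono_left nhdsWithin_le_nhds
  refine le_antisymm (le_of_tendsto hc ?_) ?_
  · filter_upwards [h1] with s hs
    exact (hσ.mem_iff.1 hs).le
  · rw [← not_lt, ← hσ.mem_iff, hρ.mem_iff, hy]
    simp

/-- Directions that decrease σ enter U and so cannot increase ρ to first order. A direction tangent
for σ is a limit of decreasing ones, and so is its opposite. -/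
lemma IsDefiningFunction.fderiv_eq_zero_of_fderiv_eq_zero (hρ : IsDefiningFunction U ρ)
    (hσ : IsDefiningFunction U σ) {y : E3} (hy : ρ y = 0) {v : E3} (hv : fderiv ℝ σ y v = 0) :
    fderiv ℝ ρ y v = 0 := by
  have hy' := hρ.eq_zero_of_eq_zero hσ hy
  have key : ∀ w, fderiv ℝ σ y w < 0 → fderiv ℝ ρ y w ≤ 0 := fun w hw => by
    by_contra! h
    have h1 := hσ.eventually_mem hy' hw
    have h2 := (((hρ.contDiff_one.differentiable one_ne_zero y).hasFDerivAt).hasLineDerivAt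
      w).tendsto_slope_zero.mono_left
      (nhdsWithin_mono 0 fun s (hs : 0 < s) => (hs.ne' : s ≠ 0))
    obtain ⟨s, hs1, hs2, hs3⟩ := (h1.and ((h2.eventually_const_lt h).and
      self_mem_nhdsWithin)).exists
    rw [hy, sub_zero, smul_eq_mul] at hs2
    exact absurd hs2 (not_lt.2 (mul_nonpos_of_nonneg_of_nonpos (inv_nonneg.2 (le_of_lt hs3))
      (hρ.mem_iff.1 hs1).le))
  obtain ⟨w, hw⟩ := hσ.exists_fderiv_eq_one hy'
  have hle : ∀ v, fderiv ℝ σ y v = 0 → fderiv ℝ ρ y v ≤ 0 := fun v hv => by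
    have h1 : ∀ δ : ℝ, 0 < δ → fderiv ℝ ρ y v - δ * fderiv ℝ ρ y w ≤ 0 := fun δ hδ => by
      have := key (v - δ • w) (by simp [hv, hw, hδ])
      simpa using this
    have h2 : Tendsto (fun δ : ℝ => fderiv ℝ ρ y v - δ * fderiv ℝ ρ y w) (𝓝[>] 0)
        (𝓝 (fderiv ℝ ρ y v - 0 * fderiv ℝ ρ y w)) :=
      ((by fun_prop : Continuous fun δ : ℝ => fderiv ℝ ρ y v - δ * fderiv ℝ ρ y w).tendsto
        0).mono_left
        nhdsWithin_le_nhds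
    rw [zero_mul, sub_zero] at h2
    exact le_of_tendsto h2 (eventually_nhdsWithin_of_forall h1)
  refine le_antisymm (hle v hv) ?_
  have := hle (-v) (by simp [hv])
  simpa using this

lemma IsDefiningFunction.exists_lipschitz_fderiv (hρ : IsDefiningFunction U ρ) (x₀ : E3) :
    ∃ K : ℝ, 0 ≤ K ∧ ∀ᶠ z : E3 × E3 in 𝓝 (x₀, x₀), |ρ z.1 - ρ z.2| ≤ K * dist z.1 z.2 ∧
      ∀ v, |fderiv ℝ ρ z.1 v - fderiv ℝ ρ z.2 v| ≤ K * dist z.1 z.2 * ‖v‖ := by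
  obtain ⟨K₁, t₁, ht₁, h₁⟩ := (hρ.contDiff_one.contDiffAt (x := x₀)).exists_lipschitzOnWith
  have hD : ContDiff ℝ 1 (fderiv ℝ ρ) := hρ.contDiff.fderiv_right (by norm_num)
  obtain ⟨K₂, t₂, ht₂, h₂⟩ := (hD.contDiffAt (x := x₀)).exists_lipschitzOnWith
  refine ⟨K₁ + K₂, by positivity, ?_⟩
  filter_upwards [prod_mem_nhds (inter_mem ht₁ ht₂) (inter_mem ht₁ ht₂)] with z hz
  have e1 := h₁.dist_le_mul _ hz.1.1 _ hz.2.1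
  have e2 := h₂.dist_le_mul _ hz.1.2 _ hz.2.2
  have hd := dist_nonneg (x := z.1) (y := z.2)
  have hk1 := K₁.coe_nonneg
  have hk2 := K₂.coe_nonneg
  refine ⟨?_, fun v => ?_⟩
  · rw [← Real.dist_eq]
    nlinarith
  · rw [← sub_apply, ← Real.norm_eq_abs]
    refine (ContinuousLinearMap.le_opNorm _ v).trans (mul_le_mul_of_nonneg_right ?_ (norm_nonneg v))
    rw [← dist_eq_norm]
    nlinarith

/-- A point of the layer lies within O(ε) of a boundary point, where dρ and dσ are proportional; the
Lipschitz bounds on the differentials carry this back with an error O(ε). The comparison is needed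
because each entry of Q may come with its own defining function, whereas one cutoff must serve all
entries. -/
lemma exists_ball_comparison (hρ : IsDefiningFunction U ρ) (hσ : IsDefiningFunction U σ)
    {x₀ : E3} (hx₀ : ρ x₀ = 0) :
    ∃ r > 0, ∃ C > 0, ∃ ε₀ > 0, ∀ ε, 0 < ε → ε < ε₀ → ∀ x ∈ Metric.ball x₀ r ∩ layer ρ ε,
      x ∈ layer σ (C * ε) ∧ ∀ v, |fderiv ℝ ρ x v| ≤ C * (|fderiv ℝ σ x v| + ε * ‖v‖) := by
  obtain ⟨e, R, hR, hstep⟩ := hρ.exists_increasing_direction hx₀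
  obtain ⟨w, hw⟩ := hσ.exists_fderiv_eq_one (hρ.eq_zero_of_eq_zero hσ hx₀)
  obtain ⟨K₁, hK₁, h₁⟩ := hρ.exists_lipschitz_fderiv x₀
  obtain ⟨K₂, hK₂, h₂⟩ := hσ.exists_lipschitz_fderiv x₀
  have hcρ : Continuous fun y => |fderiv ℝ ρ y w| :=
    ((hρ.contDiff_one.continuous_fderiv one_ne_zero).clm_apply continuous_const).abs
  have hcσ : Continuous fun y => fderiv ℝ σ y w :=
    (hσ.contDiff_one.continuous_fderiv one_ne_zero).clm_apply continuous_const
  set B := |fderiv ℝ ρ x₀ w| + 1 with hB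
  have hB0 : 0 < B := by positivity
  have h₃ : ∀ᶠ y in 𝓝 x₀, |fderiv ℝ ρ y w| < B :=
    hcρ.continuousAt.eventually_lt_const (by simp [hB])
  have h₄ : ∀ᶠ y in 𝓝 x₀, 1 / 2 < fderiv ℝ σ y w :=
    hcσ.continuousAt.eventually_const_lt (by simp only [hw]; norm_num)
  obtain ⟨r, hr, hball⟩ := Metric.eventually_nhds_iff_ball.1
    ((h₁.and h₂).and ((h₃.and h₄).prod_inl_nhds x₀))
  set r' := min R (r / 2) with hr'
  have hr'0 : 0 < r' := lt_min hR (by positivity)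
  refine ⟨r', hr'0, 2 * B + (K₁ + 2 * B * K₂ + K₂) * (2 * ‖e‖) + 1, by positivity,
    r' / (2 * (‖e‖ + 1)), by positivity, fun ε hε hεε x hx => ?_⟩
  have hsmall : 2 * ε * ‖e‖ < r' := by
    rw [lt_div_iff₀ (by positivity)] at hεε
    nlinarith [norm_nonneg e]
  have hxR : x ∈ Metric.ball x₀ R := Metric.ball_subset_ball (min_le_left _ _) hx.1
  -- Along e the function ρ rises from a value in (-ε, 0) by at least ε within the time 2ε, so it
  -- crosses 0.
  obtain ⟨τ, hτ, hτ0⟩ : ∃ τ ∈ Icc 0 (2 * ε), ρ (x + τ • e) = 0 := by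
    have hcont : Continuous fun τ : ℝ => ρ (x + τ • e) :=
      hρ.contDiff.continuous.comp (by fun_prop)
    have h := intermediate_value_Icc (by positivity : (0 : ℝ) ≤ 2 * ε) hcont.continuousOn
    have h5 := hstep x hxR (2 * ε) (by positivity) (hsmall.trans_le (min_le_left _ _))
    refine h ⟨?_, ?_⟩
    · simpa using hx.2.2.le
    · linarith [hx.2.1]
  set y := x + τ • e with hy
  have hxy : dist x y ≤ 2 * ε * ‖e‖ := by
    rw [hy, dist_self_add_right, norm_smul, Real.norm_of_nonneg hτ.1]
    exact mul_le_mul_of_nonneg_right hτ.2 (norm_nonneg e)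
  have hx1 : dist x x₀ < r / 2 := lt_of_lt_of_le hx.1 (min_le_right _ _)
  have hyx : dist y x₀ < r := by
    have h5 := dist_triangle_left y x₀ x
    have h6 : r' ≤ r / 2 := min_le_right _ _
    linarith
  have hxr : dist x x₀ < r := by linarith
  have hmem : ((x, y) : E3 × E3) ∈ Metric.ball (x₀, x₀) r := by
    rw [Metric.mem_ball, Prod.dist_eq]
    exact max_lt hxr hyx
  have hmem' : ((y, y) : E3 × E3) ∈ Metric.ball (x₀, x₀) r := by
    rw [Metric.mem_ball, Prod.dist_eq]
    exact max_lt hyx hyx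
  obtain ⟨⟨⟨-, hρL⟩, hσ0, hσL⟩, -⟩ := hball _ hmem
  obtain ⟨-, hBy, hwy⟩ := hball _ hmem'
  simp only at hρL hσ0 hσL hBy hwy
  have hσy : σ y = 0 := hρ.eq_zero_of_eq_zero hσ hτ0
  have hne := norm_nonneg e
  have hd0 := dist_nonneg (x := x) (y := y)
  refine ⟨⟨?_, hσ.mem_iff.1 (hρ.mem_iff.2 hx.2.2)⟩, fun v => ?_⟩
  · rw [hσy, sub_zero] at hσ0
    have h6 := (abs_le.1 hσ0).1
    have h7 : K₂ * dist x y ≤ K₂ * (2 * ε * ‖e‖) := by gcongr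
    have h8 : 0 ≤ (K₁ + 2 * B * K₂) * (2 * ‖e‖) * ε := by positivity
    nlinarith
  -- The vector dσ(w) v - dσ(v) w is annihilated by dσ at y, hence by dρ.
  · have hpar : fderiv ℝ ρ y v * fderiv ℝ σ y w = fderiv ℝ ρ y w * fderiv ℝ σ y v := by
      have h6 := hρ.fderiv_eq_zero_of_fderiv_eq_zero hσ hτ0
        (v := fderiv ℝ σ y w • v - fderiv ℝ σ y v • w) (by simp [mul_comm])
      simp only [map_sub, map_smul, smul_eq_mul] at h6
      linarith
    have h6 : |fderiv ℝ ρ y v| ≤ 2 * B * |fderiv ℝ σ y v| := by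
      have h7 : |fderiv ℝ ρ y v| * fderiv ℝ σ y w ≤ B * |fderiv ℝ σ y v| := by
        rw [← abs_of_pos (show 0 < fderiv ℝ σ y w by linarith), ← abs_mul, hpar, abs_mul]
        gcongr
      nlinarith [abs_nonneg (fderiv ℝ ρ y v)]
    have h7 : |fderiv ℝ ρ x v| ≤ |fderiv ℝ ρ y v| + K₁ * dist x y * ‖v‖ := by
      have := hρL v
      have := abs_sub_abs_le_abs_sub (fderiv ℝ ρ x v) (fderiv ℝ ρ y v)
      linarith
    have h8 : |fderiv ℝ σ y v| ≤ |fderiv ℝ σ x v| + K₂ * dist x y * ‖v‖ := by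
      have := hσL v
      have := abs_sub_abs_le_abs_sub (fderiv ℝ σ y v) (fderiv ℝ σ x v)
      rw [abs_sub_comm (fderiv ℝ σ y v)] at this
      linarith
    set s := |fderiv ℝ σ x v|
    have hs : 0 ≤ s := abs_nonneg _
    calc |fderiv ℝ ρ x v| ≤ 2 * B * (s + K₂ * dist x y * ‖v‖) + K₁ * dist x y * ‖v‖ := by
          nlinarith
      _ = 2 * B * s + (K₁ + 2 * B * K₂) * dist x y * ‖v‖ := by ring
      _ ≤ 2 * B * s + (K₁ + 2 * B * K₂) * (2 * ε * ‖e‖) * ‖v‖ := by gcongr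
      _ ≤ _ := by
          have p1 : 0 ≤ (K₁ + 2 * B * K₂ + K₂) * (2 * ‖e‖) * s := by positivity
          have p2 : 0 ≤ 2 * B * (ε * ‖v‖) := by positivity
          have p3 : 0 ≤ K₂ * (2 * ‖e‖) * (ε * ‖v‖) := by positivity
          have p4 : 0 ≤ ε * ‖v‖ := by positivity
          nlinarith

lemma exists_layer_comparison (hb : Bornology.IsBounded U) (hρ : IsDefiningFunction U ρ)
    (hσ : IsDefiningFunction U σ) :
    ∃ C > 0, ∃ ε₀ > 0, ∀ ε, 0 < ε → ε < ε₀ → ∀ x ∈ layer ρ ε,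
      x ∈ layer σ (C * ε) ∧ ∀ v, |fderiv ℝ ρ x v| ≤ C * (|fderiv ℝ σ x v| + ε * ‖v‖) := by
  have hρc : Continuous ρ := hρ.contDiff.continuous
  have hK : IsCompact (closure U) := hb.isCompact_closure
  have hind := hK.induction_on (p := fun s => ∃ C > 0, ∃ ε₀ > 0, ∀ ε, 0 < ε → ε < ε₀ →
    ∀ x ∈ s ∩ layer ρ ε, x ∈ layer σ (C * ε) ∧
      ∀ v, |fderiv ℝ ρ x v| ≤ C * (|fderiv ℝ σ x v| + ε * ‖v‖))
    ⟨1, one_pos, 1, one_pos, fun ε _ _ x hx => absurd hx.1 (notMem_empty x)⟩ ?_ ?_ ?_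
  · obtain ⟨C, hC, ε₀, hε₀, h⟩ := hind
    exact ⟨C, hC, ε₀, hε₀, fun ε hε hεε x hx =>
      h ε hε hεε x ⟨subset_closure (hρ.mem_iff.2 hx.2), hx⟩⟩
  · rintro s t hst ⟨C, hC, ε₀, hε₀, h⟩
    exact ⟨C, hC, ε₀, hε₀, fun ε hε hεε x hx => h ε hε hεε x ⟨hst hx.1, hx.2⟩⟩
  · rintro s t ⟨C, hC, ε₀, hε₀, h⟩ ⟨C', hC', ε₀', hε₀', h'⟩
    have hmono : ∀ {D}, 0 < D → D ≤ C + C' → ∀ {ε}, 0 < ε → ∀ {x},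
        (x ∈ layer σ (D * ε) ∧ ∀ v, |fderiv ℝ ρ x v| ≤ D * (|fderiv ℝ σ x v| + ε * ‖v‖)) →
        x ∈ layer σ ((C + C') * ε) ∧
          ∀ v, |fderiv ℝ ρ x v| ≤ (C + C') * (|fderiv ℝ σ x v| + ε * ‖v‖) :=
      fun hD hDC ε hε x hx => ⟨⟨by
        have := hx.1.1
        have := mul_le_mul_of_nonneg_right hDC hε.le
        linarith, hx.1.2⟩, fun v => (hx.2 v).trans (by gcongr)⟩
    refine ⟨C + C', by positivity, min ε₀ ε₀', lt_min hε₀ hε₀', fun ε hε hεε x hx => ?_⟩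
    rcases hx with ⟨hxs | hxt, hx⟩
    · exact hmono hC (by linarith) hε (h ε hε (hεε.trans_le (min_le_left _ _)) x ⟨hxs, hx⟩)
    · exact hmono hC' (by linarith) hε (h' ε hε (hεε.trans_le (min_le_right _ _)) x ⟨hxt, hx⟩)
  · intro x₀ hx₀
    have hle : ρ x₀ ≤ 0 :=
      closure_minimal (fun x hx => (hρ.mem_iff.1 hx).le : U ⊆ {x | ρ x ≤ 0})
        (isClosed_le hρc continuous_const) hx₀
    rcases hle.lt_or_eq with hlt | heq
    · refine ⟨{x | ρ x < ρ x₀ / 2}, mem_nhdsWithin_of_mem_nhds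
        ((isOpen_lt hρc continuous_const).mem_nhds (by simp only [mem_ofPred_eq]; linarith)),
        1, one_pos, -(ρ x₀ / 2), by linarith, fun ε hε hεε x hx => ?_⟩
      have h1 : ρ x < ρ x₀ / 2 := hx.1
      exact absurd hx.2.1 (by linarith)
    · obtain ⟨r, hr, C, hC, ε₀, hε₀, h⟩ := exists_ball_comparison hρ hσ heq
      exact ⟨Metric.ball x₀ r, mem_nhdsWithin_of_mem_nhds (Metric.ball_mem_nhds x₀ hr),
        C, hC, ε₀, hε₀, h⟩

/-- If the trace of `∇σ · ∇f` vanishes, then `∇ρ · ∇f` tends to zero in mean over the boundary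
layers of the defining function `ρ`. -/
lemma tendsto_average_layer (hb : Bornology.IsBounded U) (hρ : IsDefiningFunction U ρ)
    (hσ : IsDefiningFunction U σ) {G : Fin 3 → E3 → ℝ} (hG : ∀ i, IntegrableOn (G i) U)
    {g : Fin 3 → E3 → ℝ} (hg : IsTestLimit U (fun x => ∑ i, partialD i σ x * G i x) g) :
    Tendsto (fun n : ℕ => ((n : ℝ≥0∞) + 1) *
      ∫⁻ x in layer ρ (1 / ((n : ℝ) + 1)), ‖∑ i, partialD i ρ x * G i x‖ₑ) atTop (𝓝 0) := by
  obtain ⟨C, hC, ε₀, hε₀, hcmp⟩ := exists_layer_comparison hb hρ hσ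
  obtain ⟨M, hM, ε₁, hε₁, hest⟩ := exists_layer_estimate_of_isTestLimit hb hσ
  have hsub : ∀ n : ℕ, layer ρ (1 / ((n : ℝ) + 1)) ⊆ U := fun n x hx => hρ.mem_iff.2 hx.2
  have hε0 : Tendsto (fun n : ℕ => 1 / ((n : ℝ) + 1)) atTop (𝓝 0) :=
    tendsto_one_div_add_atTop_nhds_zero_nat
  have hCε0 : Tendsto (fun n : ℕ => C * (1 / ((n : ℝ) + 1))) atTop (𝓝 0) := by
    simpa using hε0.const_mul C
  have hU : U = {x | ρ x < 0} := hρ.eq_sublevel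
  have hU' : U = {x | σ x < 0} := hσ.eq_sublevel
  -- What remains of the bound once the width is cancelled: integrals of fixed L¹ functions over
  -- shrinking layers.
  have hlim : Tendsto (fun n : ℕ => ENNReal.ofReal C * (M * ENNReal.ofReal C *
        ∑ i, ∫⁻ x in layer σ (C * (1 / ((n : ℝ) + 1))), ‖g i x‖ₑ)
      + ENNReal.ofReal C * ∑ i, ∫⁻ x in layer ρ (1 / ((n : ℝ) + 1)), ‖G i x‖ₑ) atTop (𝓝 0) := by
    have t1 := tendsto_finsetSum (Finset.univ : Finset (Fin 3)) fun i _ =>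
      tendsto_lintegral_layer hσ.contDiff.continuous (hU' ▸ hg.integrable_partial i) hCε0
    have t2 := tendsto_finsetSum (Finset.univ : Finset (Fin 3)) fun i _ =>
      tendsto_lintegral_layer hρ.contDiff.continuous (hU ▸ hG i) hε0
    have t3 := (ENNReal.Tendsto.const_mul (a := ENNReal.ofReal C)
      (ENNReal.Tendsto.const_mul (a := M * ENNReal.ofReal C) t1
      (Or.inr (by finiteness))) (Or.inr (by finiteness))).add
      (ENNReal.Tendsto.const_mul (a := ENNReal.ofReal C) t2 (Or.inr (by finiteness)))
    simpa using t3
  refine tendsto_of_tendsto_of_tendsto_of_le_of_le' tendsto_const_nhds hlim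
    (.of_forall fun n => zero_le) ?_
  filter_upwards [hε0.eventually_lt_const hε₀, hCε0.eventually_lt_const hε₁] with n hn hn'
  set ε : ℝ := 1 / ((n : ℝ) + 1) with hε
  have hεpos : 0 < ε := by positivity
  -- The averaging factor cancels exactly the power of ε gained from the layer estimate and from the
  -- comparison of differentials.
  have hinv : ((n : ℝ≥0∞) + 1) * ENNReal.ofReal ε = 1 := by
    have h1 : ((n : ℝ≥0∞) + 1) = ENNReal.ofReal ((n : ℝ) + 1) := by
      rw [ENNReal.ofReal_add (by positivity) zero_le_one]
      simp
    rw [h1, ← ENNReal.ofReal_mul (by positivity), hε, mul_one_div_cancel (by positivity),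
      ENNReal.ofReal_one]
  have hGm : ∀ i, AEMeasurable (fun x => ‖G i x‖ₑ) (volume.restrict (layer ρ ε)) := fun i =>
    ((hG i).aestronglyMeasurable.mono_measure (Measure.restrict_mono (hsub n) le_rfl)).enorm
  have hpt : ∀ x ∈ layer ρ ε, ‖∑ i, partialD i ρ x * G i x‖ₑ ≤
      ENNReal.ofReal C * (‖∑ i, partialD i σ x * G i x‖ₑ
        + ENNReal.ofReal ε * ∑ i, ‖G i x‖ₑ) := fun x hx => by
    have h1 := (hcmp ε hεpos hn x hx).2 (field G x)
    rw [fderiv_apply_eq_sum, fderiv_apply_eq_sum] at h1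
    have h2 : |∑ i, partialD i ρ x * G i x| ≤
        C * (|∑ i, partialD i σ x * G i x| + ε * ∑ i, |G i x|) := by
      have h3 := norm_le_sum_abs (field G x)
      simp only [field_apply] at h1 h3
      simp only [mul_comm (partialD _ _ _)]
      exact h1.trans (by gcongr)
    simp only [Real.enorm_eq_ofReal_abs]
    rw [← ENNReal.ofReal_sum_of_nonneg fun i _ => abs_nonneg _, ← ENNReal.ofReal_mul hεpos.le,
      ← ENNReal.ofReal_add (abs_nonneg _) (by positivity), ← ENNReal.ofReal_mul hC.le]
    exact ENNReal.ofReal_le_ofReal h2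
  have hnear := hest (C * ε) (by positivity) hn' _ _ hg
  have hsub2 : layer ρ ε ⊆ layer σ (C * ε) := fun x hx => (hcmp ε hεpos hn x hx).1
  calc ((n : ℝ≥0∞) + 1) * ∫⁻ x in layer ρ ε, ‖∑ i, partialD i ρ x * G i x‖ₑ
      ≤ ((n : ℝ≥0∞) + 1) * ∫⁻ x in layer ρ ε, ENNReal.ofReal C *
          (‖∑ i, partialD i σ x * G i x‖ₑ + ENNReal.ofReal ε * ∑ i, ‖G i x‖ₑ) := by
        exact mul_le_mul' le_rfl
          (setLIntegral_mono' (measurableSet_layer hρ.contDiff.continuous ε) hpt)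
    _ = ((n : ℝ≥0∞) + 1) * (ENNReal.ofReal C *
          ((∫⁻ x in layer ρ ε, ‖∑ i, partialD i σ x * G i x‖ₑ)
            + ENNReal.ofReal ε * ∑ i, ∫⁻ x in layer ρ ε, ‖G i x‖ₑ)) := by
        rw [lintegral_const_mul' _ _ (by finiteness), lintegral_add_right' _
          ((Finset.aemeasurable_fun_sum _ fun i _ => hGm i).const_mul _),
          lintegral_const_mul' _ _ (by finiteness), lintegral_finsetSum' _ fun i _ => hGm i]
    _ ≤ ((n : ℝ≥0∞) + 1) * (ENNReal.ofReal C *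
          (M * ENNReal.ofReal (C * ε) * (∑ i, ∫⁻ x in layer σ (C * ε), ‖g i x‖ₑ)
            + ENNReal.ofReal ε * ∑ i, ∫⁻ x in layer ρ ε, ‖G i x‖ₑ)) := by
        gcongr
        exact (lintegral_mono_set hsub2).trans hnear
    _ = (((n : ℝ≥0∞) + 1) * ENNReal.ofReal ε) * (ENNReal.ofReal C * (M * ENNReal.ofReal C *
          ∑ i, ∫⁻ x in layer σ (C * ε), ‖g i x‖ₑ)
          + ENNReal.ofReal C * ∑ i, ∫⁻ x in layer ρ ε, ‖G i x‖ₑ) := by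
        rw [ENNReal.ofReal_mul hC.le]
        ring
    _ = _ := by rw [hinv, one_mul]

end Comparison

/-! ### The dissipation and transport terms -/

section Spatial

variable {U : Set E3} {ρ : E3 → ℝ}

/-- A cutoff function, equal to `1` where `ρ ≤ -1 / (n + 1)` and to `0` where
`-1 / (2 * (n + 1)) ≤ ρ`. -/
noncomputable def cutoff (ρ : E3 → ℝ) (n : ℕ) (x : E3) : ℝ :=
  Real.smoothTransition (-(2 * ((n : ℝ) + 1)) * ρ x - 1)

lemma contDiff_cutoff (hρ : ContDiff ℝ 1 ρ) (n : ℕ) : ContDiff ℝ 1 (cutoff ρ n) :=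
  Real.smoothTransition.contDiff.comp ((contDiff_const.mul hρ).sub contDiff_const)

lemma cutoff_nonneg (ρ : E3 → ℝ) (n : ℕ) (x : E3) : 0 ≤ cutoff ρ n x :=
  Real.smoothTransition.nonneg _

lemma cutoff_le_one (ρ : E3 → ℝ) (n : ℕ) (x : E3) : cutoff ρ n x ≤ 1 :=
  Real.smoothTransition.le_one _

lemma cutoff_eq_one {n : ℕ} {x : E3} (hx : ρ x ≤ -(1 / ((n : ℝ) + 1))) : cutoff ρ n x = 1 := by
  refine Real.smoothTransition.one_of_one_le ?_
  have h := mul_le_mul_of_nonneg_left hx (show 0 ≤ 2 * ((n : ℝ) + 1) by positivity)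
  have h2 : 2 * ((n : ℝ) + 1) * -(1 / ((n : ℝ) + 1)) = -2 := by
    field_simp
  linarith

lemma tsupport_cutoff_subset (hρ : Continuous ρ) (n : ℕ) :
    tsupport (cutoff ρ n) ⊆ {x | ρ x ≤ -(1 / (2 * ((n : ℝ) + 1)))} := by
  refine closure_minimal (fun x hx => ?_) (isClosed_le hρ continuous_const)
  by_contra! h
  refine hx (Real.smoothTransition.zero_of_nonpos ?_)
  simp only [mem_ofPred_eq, not_le] at h
  have h1 := mul_lt_mul_of_pos_left h (show 0 < 2 * ((n : ℝ) + 1) by positivity)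
  have h2 : 2 * ((n : ℝ) + 1) * -(1 / (2 * ((n : ℝ) + 1))) = -1 := by
    field_simp
  linarith

lemma tsupport_cutoff_subset_of_isDefiningFunction (hρ : IsDefiningFunction U ρ) (n : ℕ) :
    tsupport (cutoff ρ n) ⊆ U := fun x hx => by
  have h1 := tsupport_cutoff_subset hρ.contDiff.continuous n hx
  have h2 : 0 < 1 / (2 * ((n : ℝ) + 1)) := by positivity
  exact hρ.mem_iff.2 (by linarith [show ρ x ≤ _ from h1])

lemma hasCompactSupport_cutoff (hb : Bornology.IsBounded U) (hρ : IsDefiningFunction U ρ) (n : ℕ) :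
    HasCompactSupport (cutoff ρ n) :=
  (hb.subset (tsupport_cutoff_subset_of_isDefiningFunction hρ
    n)).isCompact_closure.of_isClosed_subset
    (isClosed_tsupport _) subset_closure

lemma deriv_smoothTransition_eq_zero (y : ℝ) (hy : y ∉ Icc (0 : ℝ) 1) :
    deriv Real.smoothTransition y = 0 := by
  have : ∃ c : ℝ, Real.smoothTransition =ᶠ[𝓝 y] fun _ => c := by
    rcases not_and_or.1 hy with h | h
    · refine ⟨0, ?_⟩
      filter_upwards [eventually_lt_nhds (not_le.1 h)] with z hz
      exact Real.smoothTransition.zero_of_nonpos hz.le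
    · refine ⟨1, ?_⟩
      filter_upwards [eventually_gt_nhds (not_le.1 h)] with z hz
      exact Real.smoothTransition.one_of_one_le (le_of_lt hz)
  obtain ⟨c, hc⟩ := this
  rw [hc.deriv_eq, deriv_const]

/-- The gradient of the cutoff is parallel to ∇ρ, of size O(n + 1) relative to it, and on U is
confined to the layer of width 1/(n + 1). Paired with ∇F it produces a layer average of ∇ρ·∇F, the
quantity governed by the Neumann condition. -/
lemma exists_partialD_cutoff (hρ : ContDiff ℝ 1 ρ) :
    ∃ S : ℝ, ∀ (n : ℕ) x, ∃ s : ℝ, |s| ≤ S * ((n : ℝ) + 1) ∧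
      (∀ i, partialD i (cutoff ρ n) x = s * partialD i ρ x) ∧
      (ρ x ≤ -(1 / ((n : ℝ) + 1)) → s = 0) := by
  have hd : ContDiff ℝ 1 Real.smoothTransition := Real.smoothTransition.contDiff
  have hzero := deriv_smoothTransition_eq_zero
  have hcont : Continuous (deriv Real.smoothTransition) := hd.continuous_deriv le_rfl
  obtain ⟨S, hS⟩ := isCompact_Icc.exists_bound_of_continuousOn (s := Icc (0 : ℝ) 1)
    hcont.continuousOn
  have hS0 : 0 ≤ S := (norm_nonneg _).trans (hS 0 (by simp))
  have hS' : ∀ y, |deriv Real.smoothTransition y| ≤ S := fun y => by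
    by_cases hy : y ∈ Icc (0 : ℝ) 1
    · exact hS y hy
    · rw [hzero y hy, abs_zero]
      exact hS0
  refine ⟨2 * S, fun n x => ⟨deriv Real.smoothTransition (-(2 * ((n : ℝ) + 1)) * ρ x - 1)
    * -(2 * ((n : ℝ) + 1)), ?_, fun i => ?_, fun hx => ?_⟩⟩
  · rw [abs_mul, abs_neg, abs_of_pos (show 0 < 2 * ((n : ℝ) + 1) by positivity)]
    have := mul_le_mul_of_nonneg_right (hS' (-(2 * ((n : ℝ) + 1)) * ρ x - 1))
      (show 0 ≤ 2 * ((n : ℝ) + 1) by positivity)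
    linarith
  · have h1 := ((hρ.differentiable one_ne_zero x).hasFDerivAt.const_mul
      (-(2 * ((n : ℝ) + 1)))).sub_const 1
    have h2 := (hd.differentiable one_ne_zero _).hasDerivAt.comp_hasFDerivAt x h1
    have h3 : fderiv ℝ (cutoff ρ n) x = _ := h2.fderiv
    rw [partialD, h3]
    simp only [smul_apply, smul_eq_mul, partialD]
    ring
  · have h := mul_le_mul_of_nonneg_left hx (show 0 ≤ 2 * ((n : ℝ) + 1) by positivity)
    have h2 : 2 * ((n : ℝ) + 1) * -(1 / ((n : ℝ) + 1)) = -2 := by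
      field_simp
    have h3 : deriv Real.smoothTransition (-(2 * ((n : ℝ) + 1)) * ρ x - 1) = 0 := by
      rcases (show 1 ≤ -(2 * ((n : ℝ) + 1)) * ρ x - 1 by linarith).lt_or_eq with h4 | h4
      · exact hzero _ fun h5 => absurd h5.2 (not_le.2 h4)
      · rw [← h4]
        -- At the endpoint 1 the derivative vanishes by continuity from the right.
        have hmem : (1 : ℝ) ∈ closure (Ioi 1) := by simp
        exact closure_minimal (fun y (hy : 1 < y) => hzero y fun h5 => absurd h5.2 (not_le.2 hy))
          (isClosed_eq hcont continuous_const) hmem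
    rw [h3, zero_mul]

variable {κ : Type*} [Fintype κ] {Φ k : EuclideanSpace ℝ κ → ℝ}

/-- The Laplacian with homogeneous Neumann condition is dissipative for convex radial entropies. -/
lemma IsRadialEntropy.integral_laplacian_nonpos (h : IsRadialEntropy Φ k) (hU : IsOpen U)
    (hb : Bornology.IsBounded U)
    {F : κ → E3 → ℝ} {G L : κ → Fin 3 → E3 → ℝ} (hF : ∀ j, IntegrableOn (F j) U)
    (hG : ∀ j i, IntegrableOn (G j i) U) (hL : ∀ j i, IntegrableOn (L j i) U)
    (hFG : ∀ j i, IsWeakPartial U i (F j) (G j i))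
    (hGL : ∀ j i, IsWeakPartial U i (G j i) (L j i))
    {σ : κ → E3 → ℝ} (hσ : ∀ j, IsDefiningFunction U (σ j)) {g : κ → Fin 3 → E3 → ℝ}
    (hg : ∀ j, IsTestLimit U (fun x => ∑ i, partialD i (σ j) x * G j i x) (g j))
    (hρ : IsDefiningFunction U ρ) :
    ∑ i, ∑ j, ∫ x in U, (k (field F x) * F j x) * L j i x ≤ 0 := by
  have hρ1 := hρ.contDiff_one
  have hηs := fun n => contDiff_cutoff hρ1 n
  have hηc := fun n => hasCompactSupport_cutoff hb hρ n
  have hηU := fun n => tsupport_cutoff_subset_of_isDefiningFunction hρ n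
  have hle : ∀ n, ∑ i, ∑ j, ∫ x in U, (k (field F x) * F j x * cutoff ρ n x) * L j i x
      ≤ ∑ i, -∑ j, ∫ x in U, (k (field F x) * F j x * partialD i (cutoff ρ n) x) * G j i x :=
    fun n => Finset.sum_le_sum fun i _ => h.setIntegral_mul_second_le hU hF (fun j => hG j i)
      (fun j => hL j i) (fun j => hFG j i) (fun j => hGL j i) (hηs n) (hηc n) (hηU n)
      (cutoff_nonneg ρ n)
  have hleft : Tendsto (fun n => ∑ i, ∑ j,
      ∫ x in U, (k (field F x) * F j x * cutoff ρ n x) * L j i x) atTop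
      (𝓝 (∑ i, ∑ j, ∫ x in U, (k (field F x) * F j x) * L j i x)) := by
    refine tendsto_finsetSum _ fun i _ => tendsto_finsetSum _ fun j _ => ?_
    refine tendsto_integral_of_dominated_convergence (fun x => |L j i x|) (fun n => ?_)
      (hL j i).abs (fun n => .of_forall fun x => ?_) ?_
    · exact (integrable_mul_mul_mul h hF (hL j i) (hηs n).continuous (C := 1)
        (fun x => by rw [abs_of_nonneg (cutoff_nonneg ρ n x)]; exact cutoff_le_one ρ n x)
        j).aestronglyMeasurable
    · rw [Real.norm_eq_abs, abs_mul, abs_mul]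
      refine mul_le_of_le_one_left (abs_nonneg _) (mul_le_one₀ (h.abs_mul_apply_le _ j)
        (abs_nonneg _) ?_)
      rw [abs_of_nonneg (cutoff_nonneg ρ n x)]
      exact cutoff_le_one ρ n x
    · filter_upwards [ae_restrict_mem hU.measurableSet] with x hx
      have hx' : 0 < -ρ x := neg_pos.2 (hρ.mem_iff.1 hx)
      refine tendsto_const_nhds.congr' ?_
      filter_upwards [tendsto_one_div_add_atTop_nhds_zero_nat.eventually_lt_const hx'] with n hn
      rw [cutoff_eq_one (by linarith), mul_one]
  -- The boundary term: a cutoff gradient of size n + 1 acting on a layer of width 1/(n + 1). The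
  -- weight k(F) Fⱼ is bounded by 1, so `tendsto_average_layer` applies to each entry j with its own
  -- `σ j`.
  have hright : Tendsto (fun n => ∑ i, -∑ j,
      ∫ x in U, (k (field F x) * F j x * partialD i (cutoff ρ n) x) * G j i x) atTop (𝓝 0) := by
    have hint : ∀ n j i, IntegrableOn
        (fun x => (k (field F x) * F j x * partialD i (cutoff ρ n) x) * G j i x) U :=
          fun n j i => by
      obtain ⟨C, hC⟩ := (hasCompactSupport_partialD (hηc n) i).exists_bound_of_continuous
        (continuous_partialD (hηs n) i)
      exact integrable_mul_mul_mul h hF (hG j i) (continuous_partialD (hηs n) i) hC j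
    have heq : ∀ n, ∑ i, -∑ j,
        ∫ x in U, (k (field F x) * F j x * partialD i (cutoff ρ n) x) * G j i x
        = -∑ j, ∫ x in U, ∑ i, (k (field F x) * F j x * partialD i (cutoff ρ n) x) * G j i x :=
      fun n => by
      rw [Finset.sum_neg_distrib, Finset.sum_comm]
      congr 1
      refine Finset.sum_congr rfl fun j _ => ?_
      rw [integral_finsetSum _ fun i _ => hint n j i]
    simp_rw [heq]
    rw [← neg_zero, ← Finset.sum_const_zero (s := (Finset.univ : Finset κ))]
    refine (tendsto_finsetSum _ fun j _ => ?_).neg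
    obtain ⟨S, hS⟩ := exists_partialD_cutoff hρ1
    have hav := ENNReal.Tendsto.const_mul (a := ENNReal.ofReal S)
      (tendsto_average_layer hb hρ (hσ j) (hG j) (hg j)) (Or.inr (by finiteness))
    rw [mul_zero] at hav
    rw [tendsto_zero_iff_enorm_tendsto_zero]
    refine tendsto_of_tendsto_of_tendsto_of_le_of_le tendsto_const_nhds hav
      (fun n => zero_le) fun n => ?_
    have hlay := measurableSet_layer hρ1.continuous (1 / ((n : ℝ) + 1))
    have hsub : layer ρ (1 / ((n : ℝ) + 1)) ⊆ U := fun x hx => hρ.mem_iff.2 hx.2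
    have hcast : ((n : ℝ≥0∞) + 1) = ENNReal.ofReal ((n : ℝ) + 1) := by
      rw [ENNReal.ofReal_add (by positivity) zero_le_one]
      simp
    refine (enorm_integral_le_lintegral_enorm _).trans ?_
    rw [← mul_assoc, hcast, ← ENNReal.ofReal_mul' (by positivity),
      ← lintegral_const_mul' _ _ (by finiteness), ← lintegral_indicator hlay,
      ← lintegral_indicator hU.measurableSet]
    refine lintegral_mono fun x => ?_
    by_cases hxU : x ∈ U
    · rw [indicator_of_mem hxU]
      obtain ⟨s, hs1, hs2, hs3⟩ := hS n x
      have e : ∑ i, k (field F x) * F j x * partialD i (cutoff ρ n) x * G j i x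
          = (k (field F x) * F j x * s) * ∑ i, partialD i ρ x * G j i x := by
        rw [Finset.mul_sum]
        refine Finset.sum_congr rfl fun i _ => ?_
        rw [hs2]
        ring
      by_cases hx : x ∈ layer ρ (1 / ((n : ℝ) + 1))
      · rw [indicator_of_mem hx, e, enorm_mul]
        refine mul_le_mul' ?_ le_rfl
        rw [Real.enorm_eq_ofReal_abs]
        refine ENNReal.ofReal_le_ofReal ?_
        rw [abs_mul]
        exact (mul_le_of_le_one_left (abs_nonneg _) (h.abs_mul_apply_le _ j)).trans hs1
      · have : s = 0 := hs3 (not_lt.1 fun h' => hx ⟨h', hρ.mem_iff.1 hxU⟩)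
        rw [e, this]
        simp
    · rw [indicator_of_notMem hxU]
      exact zero_le
  exact le_of_tendsto_of_tendsto' hleft hright hle

lemma enorm_integral_mul_le {X : Type*} [MeasurableSpace X] {μ : Measure X} {A B : X → ℝ}
    (hA : AEStronglyMeasurable A μ) (hB : AEStronglyMeasurable B μ) :
    ‖∫ x, A x * B x ∂μ‖ₑ ≤ eLpNorm A 2 μ * eLpNorm B 2 μ := by
  refine (enorm_integral_le_lintegral_enorm _).trans ?_
  rw [← eLpNorm_one_eq_lintegral_enorm]
  have h := eLpNorm_le_eLpNorm_mul_eLpNorm'_of_norm (p := 2) (q := 2) (r := 1) hA hB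
    (fun a b => a * b) 1 (.of_forall fun x => by simp)
  simpa using h

lemma integrable_mul_of_memLp_two {X : Type*} [MeasurableSpace X] {μ : Measure X} {A B : X → ℝ}
    (hA : MemLp A 2 μ) (hB : MemLp B 2 μ) : Integrable (fun x => A x * B x) μ :=
  hA.integrable_mul hB

/-- Transport by a solenoidal field with zero trace preserves the entropy. -/
lemma IsRadialEntropy.integral_transport_eq_zero (h : IsRadialEntropy Φ k) (hU : IsOpen U)
    {F : κ → E3 → ℝ} {G : κ → Fin 3 → E3 → ℝ} (hF : ∀ j, IntegrableOn (F j) U)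
    (hF2 : ∀ j, MemLp (F j) 2 (volume.restrict U))
    (hG : ∀ j i, IntegrableOn (G j i) U) (hG2 : ∀ j i, MemLp (G j i) 2 (volume.restrict U))
    (hFG : ∀ j i, IsWeakPartial U i (F j) (G j i))
    {v D : Fin 3 → E3 → ℝ} (hv : ∀ i, MemLp (v i) 2 (volume.restrict U))
    (hD : ∀ i, MemLp (D i) 2 (volume.restrict U))
    (happ : ∀ i, ∀ ε : ℝ≥0∞, 0 < ε → ∃ φ, IsTestFunction U φ ∧
      eLpNorm (v i - φ) 2 (volume.restrict U) ≤ ε ∧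
      eLpNorm (D i - partialD i φ) 2 (volume.restrict U) ≤ ε)
    (hdiv : ∀ᵐ x ∂(volume.restrict U), ∑ i, D i x = 0) :
    ∑ i, ∫ x in U, (∑ j, (k (field F x) * F j x) * G j i x) * v i x = 0 := by
  set w : E3 → ℝ := fun x => Φ (field F x) - Φ 0 with hw
  set A : Fin 3 → E3 → ℝ := fun i x => ∑ j, (k (field F x) * F j x) * G j i x with hA
  have hfm : AEStronglyMeasurable (field F) (volume.restrict U) :=
    aestronglyMeasurable_field fun j => (hF j).aestronglyMeasurable
  have hw2 : MemLp w 2 (volume.restrict U) := by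
    have hs : MemLp (fun x => ∑ j, ‖F j x‖) 2 (volume.restrict U) :=
      memLp_finsetSum Finset.univ fun j _ => (hF2 j).norm
    refine MemLp.of_le hs
      ((h.continuous.comp_aestronglyMeasurable hfm).sub aestronglyMeasurable_const)
      (.of_forall fun x => ?_)
    rw [Real.norm_of_nonneg (sub_nonneg.2 (h.map_zero_le _))]
    refine ((h.sub_map_zero_le_norm _).trans (norm_le_sum_abs _)).trans ?_
    exact le_abs_self _
  have hA2 : ∀ i, MemLp (A i) 2 (volume.restrict U) := fun i => by
    refine memLp_finsetSum Finset.univ fun j _ => ?_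
    refine MemLp.of_le (hG2 j i) (((h.contDiff.continuous.comp_aestronglyMeasurable hfm).mul
      (hF j).aestronglyMeasurable).mul (hG j i).aestronglyMeasurable) (.of_forall fun x => ?_)
    rw [norm_mul]
    exact mul_le_of_le_one_left (norm_nonneg _) (h.abs_mul_apply_le _ j)
  -- Only an L² approximation of v and its diagonal derivatives by test functions is needed, since
  -- both the entropy w and its gradient A lie in L².
  have hbound : ∀ ε : ℝ≥0∞, 0 < ε → ε ≠ ⊤ → ‖∑ i, ∫ x in U, A i x * v i x‖ₑ ≤
      ∑ i, (eLpNorm (A i) 2 (volume.restrict U) * ε + eLpNorm w 2 (volume.restrict U) * ε) :=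
    fun ε hε hε' => by
    choose φ hφ h1 h2 using fun i => happ i ε hε
    have hφ1 : ∀ i, ContDiff ℝ 1 (φ i) := fun i => (hφ i).1.of_le (by exact_mod_cast le_top)
    have hφm : ∀ i, MemLp (φ i) 2 (volume.restrict U) := fun i =>
      ((hφ1 i).continuous.memLp_of_hasCompactSupport (hφ i).2.1).restrict U
    have hdφ : ∀ i, MemLp (partialD i (φ i)) 2 (volume.restrict U) := fun i =>
      ((continuous_partialD (hφ1 i) i).memLp_of_hasCompactSupport
        (hasCompactSupport_partialD (hφ i).2.1 i)).restrict U
    have hibp : ∀ i, ∫ x in U, w x * partialD i (φ i) x = -∫ x in U, A i x * φ i x := fun i => by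
      rw [h.setIntegral_mul_partialD hU hF (fun j => hG j i) (fun j => hFG j i) (hφ1 i)
        (hφ i).2.1 (hφ i).2.2]
      congr 2
      ext x
      rw [hA, Finset.sum_mul]
      exact Finset.sum_congr rfl fun j _ => by ring
    have hwD : ∑ i, ∫ x in U, w x * D i x = 0 := by
      rw [← integral_finsetSum _ fun i _ => integrable_mul_of_memLp_two hw2 (hD i)]
      refine integral_eq_zero_of_ae ?_
      filter_upwards [hdiv] with x hx
      rw [← Finset.mul_sum, hx, mul_zero]
      rfl
    -- Adding the vanishing integral of w div v, and using the chain rule for the test functions,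
    -- leaves only the approximation errors v - φ and D - ∂φ.
    have hsplit : ∑ i, ∫ x in U, A i x * v i x
        = ∑ i, ((∫ x in U, A i x * (v i - φ i) x) +
          ∫ x in U, w x * (D i - partialD i (φ i)) x) := by
      rw [← add_zero (∑ i, ∫ x in U, A i x * v i x), ← hwD, ← Finset.sum_add_distrib]
      refine Finset.sum_congr rfl fun i _ => ?_
      simp only [Pi.sub_apply, mul_sub]
      rw [integral_sub (integrable_mul_of_memLp_two (hA2 i) (hv i))
          (integrable_mul_of_memLp_two (hA2 i) (hφm i)),
        integral_sub (integrable_mul_of_memLp_two hw2 (hD i))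
          (integrable_mul_of_memLp_two hw2 (hdφ i)), hibp]
      ring
    rw [hsplit]
    refine (enorm_sum_le _ _).trans (Finset.sum_le_sum fun i _ => ?_)
    refine (enorm_add_le _ _).trans (add_le_add ?_ ?_)
    · exact (enorm_integral_mul_le (hA2 i).1 ((hv i).1.sub (hφm i).1)).trans
        (mul_le_mul' le_rfl (h1 i))
    · exact (enorm_integral_mul_le hw2.1 ((hD i).1.sub (hdφ i).1)).trans
        (mul_le_mul' le_rfl (h2 i))
  have hlim : Tendsto (fun ε : ℝ≥0∞ => ∑ i : Fin 3, (eLpNorm (A i) 2 (volume.restrict U) * ε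
      + eLpNorm w 2 (volume.restrict U) * ε)) (𝓝[>] 0) (𝓝 0) := by
    have h0 : Tendsto (fun δ : ℝ≥0∞ => δ) (𝓝[>] 0) (𝓝 0) := nhdsWithin_le_nhds
    have := tendsto_finsetSum (Finset.univ : Finset (Fin 3)) fun i _ =>
      (ENNReal.Tendsto.const_mul h0 (Or.inr (hA2 i).2.ne)).add
        (ENNReal.Tendsto.const_mul h0 (Or.inr hw2.2.ne))
    simpa using this
  have hev : ∀ᶠ ε : ℝ≥0∞ in 𝓝[>] 0, ε ≠ ⊤ :=
    nhdsWithin_le_nhds (isOpen_ne.mem_nhds ENNReal.zero_ne_top)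
  have := ge_of_tendsto hlim (by
    filter_upwards [self_mem_nhdsWithin, hev] with ε h1 h2 using hbound ε h1 h2)
  simpa using this

end Spatial

/-! ### The time derivative -/

section Time

lemma continuous_deriv_smoothTransition : Continuous (deriv Real.smoothTransition) :=
  (Real.smoothTransition.contDiff (n := 1)).continuous_deriv le_rfl

lemma hasCompactSupport_deriv_smoothTransition :
    HasCompactSupport (deriv Real.smoothTransition) :=
  HasCompactSupport.intro isCompact_Icc deriv_smoothTransition_eq_zero

lemma hasDerivAt_smoothTransition (x : ℝ) :
    HasDerivAt Real.smoothTransition (deriv Real.smoothTransition x) x :=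
  ((Real.smoothTransition.contDiff (n := 1)).differentiable one_ne_zero x).hasDerivAt

lemma integral_deriv_smoothTransition : ∫ x, deriv Real.smoothTransition x = 1 := by
  have h := integral_of_hasDerivAt_of_tendsto hasDerivAt_smoothTransition
    (continuous_deriv_smoothTransition.integrable_of_hasCompactSupport
      hasCompactSupport_deriv_smoothTransition) (m := 0) (n := 1) ?_ ?_
  · rw [h, sub_zero]
  · refine tendsto_const_nhds.congr' ?_
    filter_upwards [eventually_le_atBot 0] with x hx
    exact (Real.smoothTransition.zero_of_nonpos hx).symm
  · refine tendsto_const_nhds.congr' ?_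
    filter_upwards [eventually_ge_atTop 1] with x hx
    exact (Real.smoothTransition.one_of_one_le hx).symm

lemma deriv_smoothTransition_nonneg (x : ℝ) : 0 ≤ deriv Real.smoothTransition x :=
  Real.smoothTransition.monotone.deriv_nonneg

/-- The rescaled derivative of a smooth step is an approximate identity, concentrated just to the
right of s. -/
lemma tendsto_integral_deriv_step {F : ℝ → ℝ} {s : ℝ} (hF : Integrable F)
    (hc : ContinuousAt F s) :
    Tendsto (fun n : ℕ => ∫ τ, ((n : ℝ) * deriv Real.smoothTransition (n * (τ - s))) * F τ) atTop
      (𝓝 (F s)) := by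
  have h := tendsto_integral_comp_smul_smul_of_integrable (F := ℝ) (μ := volume)
    deriv_smoothTransition_nonneg integral_deriv_smoothTransition ?_
    (g := fun x => F (x + s)) (hF.comp_add_right s) ?_
  · rw [zero_add] at h
    refine (h.comp tendsto_natCast_atTop_atTop).congr fun n => ?_
    simp only [Function.comp_apply, Module.finrank_self, pow_one, smul_eq_mul]
    rw [← integral_add_right_eq_self (fun τ => ((n : ℝ) *
      deriv Real.smoothTransition (n * (τ - s))) * F τ) s]
    simp
  · refine tendsto_const_nhds.congr' ?_
    have hb : (Icc (0 : ℝ) 1)ᶜ ∈ Bornology.cobounded ℝ :=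
      Bornology.IsBounded.compl (Metric.isBounded_Icc 0 1)
    filter_upwards [hb] with x hx
    rw [deriv_smoothTransition_eq_zero x hx, mul_zero]
  · refine ContinuousAt.comp (g := F) ?_ (by fun_prop)
    simpa using hc

/-- Test with a smooth step up at s followed by a step down at t. The test functions tend to the
indicator of (s, t] and their derivatives to δ_s - δ_t; continuity of F at s and t selects the point
values. -/
lemma sub_eq_integral_of_weak_deriv {F G : ℝ → ℝ} {s t T : ℝ} (hs : 0 < s) (hst : s < t)
    (htT : t < T) (hF : IntegrableOn F (Ioo 0 T)) (hG : IntegrableOn G (Ioo 0 T))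
    (hcs : ContinuousAt F s) (hct : ContinuousAt F t)
    (hweak : ∀ θ : ℝ → ℝ, ContDiff ℝ ∞ θ → HasCompactSupport θ → tsupport θ ⊆ Ioo 0 T →
      ∫ τ in Ioo 0 T, F τ * deriv θ τ = -∫ τ in Ioo 0 T, G τ * θ τ) :
    F t - F s = ∫ τ in Ioc s t, G τ := by
  set θ : ℕ → ℝ → ℝ := fun n τ => Real.smoothTransition (n * (τ - s))
    - Real.smoothTransition (n * (τ - t)) with hθ
  have hθc : ∀ n, ContDiff ℝ ∞ (θ n) := fun n =>
    (Real.smoothTransition.contDiff.comp (by fun_prop)).sub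
      (Real.smoothTransition.contDiff.comp (by fun_prop))
  have hθd : ∀ n τ, deriv (θ n) τ = (n : ℝ) * deriv Real.smoothTransition (n * (τ - s))
      - (n : ℝ) * deriv Real.smoothTransition (n * (τ - t)) := fun n τ => by
    have h1 : ∀ c : ℝ, HasDerivAt (fun τ => Real.smoothTransition (n * (τ - c)))
        ((n : ℝ) * deriv Real.smoothTransition (n * (τ - c))) τ := fun c => by
      have h2 : HasDerivAt (fun τ : ℝ => (n : ℝ) * (τ - c)) n τ := by
        simpa using ((hasDerivAt_id τ).sub_const c).const_mul (n : ℝ)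
      have h3 := (hasDerivAt_smoothTransition (n * (τ - c))).comp τ h2
      rwa [mul_comm] at h3
    exact ((h1 s).sub (h1 t)).deriv
  -- The step down ends at t + 1/n, so half the gap between t and T suffices for large n.
  have hsupp : ∀ᶠ n : ℕ in atTop, tsupport (θ n) ⊆ Icc s (t + (T - t) / 2) := by
    have h1 : ∀ᶠ n : ℕ in atTop, 1 / ((T - t) / 2) < (n : ℝ) :=
      tendsto_natCast_atTop_atTop.eventually_gt_atTop _
    filter_upwards [h1] with n hn
    have hpos : 0 < (T - t) / 2 := by linarith
    have hn0 : (0 : ℝ) < n := (by positivity : 0 < 1 / ((T - t) / 2)).trans hn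
    rw [div_lt_iff₀ hpos] at hn
    refine closure_minimal (fun τ hτ => ?_) isClosed_Icc
    by_contra h
    refine hτ ?_
    simp only [hθ]
    rcases not_and_or.1 h with h2 | h2
    · have h3 := not_le.1 h2
      rw [Real.smoothTransition.zero_of_nonpos, Real.smoothTransition.zero_of_nonpos, sub_zero]
      · exact mul_nonpos_of_nonneg_of_nonpos hn0.le (by linarith)
      · exact mul_nonpos_of_nonneg_of_nonpos hn0.le (by linarith)
    · have h3 := not_le.1 h2
      rw [Real.smoothTransition.one_of_one_le, Real.smoothTransition.one_of_one_le, sub_self]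
      · nlinarith
      · nlinarith
  have hFi : Integrable ((Ioo 0 T).indicator F) := hF.integrable_indicator measurableSet_Ioo
  have hca : ∀ {c}, 0 < c → c < T → ContinuousAt F c → ContinuousAt ((Ioo 0 T).indicator F) c ∧
      (Ioo 0 T).indicator F c = F c := fun h0 hT hc =>
    ⟨hc.congr (by
      filter_upwards [isOpen_Ioo.mem_nhds (mem_Ioo.2 ⟨h0, hT⟩)] with τ hτ
      rw [indicator_of_mem hτ]), indicator_of_mem (mem_Ioo.2 ⟨h0, hT⟩) F⟩
  have h1 := tendsto_integral_deriv_step hFi (hca hs (hst.trans htT) hcs).1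
  have h2 := tendsto_integral_deriv_step hFi (hca (hs.trans hst) htT hct).1
  rw [(hca hs (hst.trans htT) hcs).2] at h1
  rw [(hca (hs.trans hst) htT hct).2] at h2
  have hleft : Tendsto (fun n => ∫ τ in Ioo 0 T, F τ * deriv (θ n) τ) atTop (𝓝 (F s - F t)) := by
    refine (h1.sub h2).congr fun n => ?_
    have hi : ∀ c, Integrable fun τ => ((n : ℝ) * deriv Real.smoothTransition (n * (τ - c)))
        * (Ioo 0 T).indicator F τ := fun c => by
      obtain ⟨C, hC⟩ := hasCompactSupport_deriv_smoothTransition.exists_bound_of_continuous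
        continuous_deriv_smoothTransition
      refine hFi.bdd_mul (c := n * C) ?_ (.of_forall fun τ => ?_)
      · exact (continuous_const.mul (continuous_deriv_smoothTransition.comp
          (by fun_prop))).aestronglyMeasurable
      · rw [norm_mul, Real.norm_of_nonneg (Nat.cast_nonneg n)]
        exact mul_le_mul_of_nonneg_left (hC _) (Nat.cast_nonneg n)
    rw [← integral_sub (hi s) (hi t), ← integral_indicator measurableSet_Ioo]
    congr 1
    ext τ
    by_cases hτ : τ ∈ Ioo 0 T
    · simp only [indicator_of_mem hτ, hθd]
      ring
    · simp only [indicator_of_notMem hτ]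
      ring
  have hright : Tendsto (fun n => -∫ τ in Ioo 0 T, G τ * θ n τ) atTop
      (𝓝 (-∫ τ in Ioo 0 T, (Ioc s t).indicator G τ)) := by
    refine (tendsto_integral_of_dominated_convergence (fun τ => |G τ|) (fun n => ?_) hG.abs
      (fun n => .of_forall fun τ => ?_) (.of_forall fun τ => ?_)).neg
    · exact hG.aestronglyMeasurable.mul (hθc n).continuous.aestronglyMeasurable
    · rw [norm_mul, Real.norm_eq_abs, Real.norm_eq_abs]
      refine mul_le_of_le_one_right (abs_nonneg _) (abs_le.2 ⟨?_, ?_⟩)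
      · linarith [Real.smoothTransition.nonneg (n * (τ - s)),
          Real.smoothTransition.le_one (n * (τ - t))]
      · linarith [Real.smoothTransition.le_one (n * (τ - s)),
          Real.smoothTransition.nonneg (n * (τ - t))]
    · have hstep : ∀ c, (τ ≤ c → ∀ n : ℕ, Real.smoothTransition (n * (τ - c)) = 0) ∧
          (c < τ → ∀ᶠ n : ℕ in atTop, Real.smoothTransition (n * (τ - c)) = 1) := fun c => by
        refine ⟨fun h n => Real.smoothTransition.zero_of_nonpos
          (mul_nonpos_of_nonneg_of_nonpos (Nat.cast_nonneg n) (by linarith)), fun h => ?_⟩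
        filter_upwards [(tendsto_natCast_atTop_atTop (R := ℝ)).eventually_ge_atTop (1 / (τ - c))]
          with n hn
        rw [div_le_iff₀ (by linarith)] at hn
        exact Real.smoothTransition.one_of_one_le hn
      refine tendsto_const_nhds.congr' ?_
      rcases le_or_gt τ s with h3 | h3
      · refine .of_forall fun n => ?_
        simp only [hθ]
        rw [(hstep s).1 h3, (hstep t).1 (h3.trans hst.le), indicator_of_notMem (by simp [h3])]
        simp
      rcases le_or_gt τ t with h4 | h4
      · filter_upwards [(hstep s).2 h3] with n hn
        simp only [hθ]
        rw [hn, (hstep t).1 h4, indicator_of_mem (mem_Ioc.2 ⟨h3, h4⟩)]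
        simp
      · filter_upwards [(hstep s).2 h3, (hstep t).2 h4] with n hn hn'
        simp only [hθ]
        rw [hn, hn', indicator_of_notMem (by simp [h4])]
        simp
  have heq : F s - F t = -∫ τ in Ioo 0 T, (Ioc s t).indicator G τ := by
    refine tendsto_nhds_unique_of_eventuallyEq hleft hright ?_
    filter_upwards [hsupp] with n hn
    exact hweak (θ n) (hθc n) (isCompact_Icc.of_isClosed_subset (isClosed_tsupport _) hn)
      (hn.trans fun τ hτ => ⟨hs.trans_le hτ.1, by linarith [hτ.2]⟩)
  have hsub : Ioc s t ⊆ Ioo 0 T := fun τ hτ => ⟨hs.trans hτ.1, hτ.2.trans_lt htT⟩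
  rw [setIntegral_indicator measurableSet_Ioc, inter_eq_self_of_subset_right hsub] at heq
  linarith

/-- The chain rule along the primitive of an integrable function. -/
lemma IsRadialEntropy.sub_eq_integral {κ : Type*} [Fintype κ] {Φ k : EuclideanSpace ℝ κ → ℝ}
    (h : IsRadialEntropy Φ k) {s t : ℝ} (y : κ → ℝ) {γ : κ → ℝ → ℝ}
    (hγ : ∀ j, IntervalIntegrable (γ j) volume s t) {Y : ℝ → EuclideanSpace ℝ κ}
    (hY : ∀ τ j, Y τ j = y j + ∫ v in s..τ, γ j v) :
    Φ (Y t) - Φ (Y s) = ∫ τ in s..t, ∑ j, k (Y τ) * Y τ j * γ j τ := by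
  have hac : ∀ j, AbsolutelyContinuousOnInterval (fun τ => ∫ v in s..τ, γ j v) s t := fun j =>
    (hγ j).absolutelyContinuousOnInterval_intervalIntegral left_mem_uIcc
  -- Each coordinate of Y is a primitive, hence absolutely continuous, and the Lipschitz map Φ
  -- preserves this; the fundamental theorem then needs the derivative only almost everywhere.
  have hAC : AbsolutelyContinuousOnInterval (fun τ => Φ (Y τ)) s t := by
    have hsum := tendsto_finsetSum Finset.univ fun j _ => hac j
    rw [Finset.sum_const_zero] at hsum
    refine squeeze_zero (fun E => Finset.sum_nonneg fun i _ => dist_nonneg) (fun E => ?_) hsum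
    rw [Finset.sum_comm]
    refine Finset.sum_le_sum fun i _ => ?_
    have h1 := h.lipschitz.dist_le_mul (Y (E.2 i).1) (Y (E.2 i).2)
    rw [NNReal.coe_one, one_mul, dist_eq_norm (Y _)] at h1
    refine h1.trans ((norm_le_sum_abs _).trans (le_of_eq (Finset.sum_congr rfl fun j _ => ?_)))
    rw [PiLp.sub_apply, hY, hY, Real.dist_eq]
    congr 1
    ring
  rw [← hAC.integral_deriv_eq_sub]
  refine intervalIntegral.integral_congr_ae ?_
  have hd := ae_all_iff.2 fun j => (hγ j).ae_hasDerivAt_integral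
  filter_upwards [hd] with τ hτ hmem
  have hYd : HasFDerivAt Y (ContinuousLinearMap.toSpanSingleton ℝ
      (WithLp.toLp 2 fun j => γ j τ : EuclideanSpace ℝ κ)) τ := by
    rw [← hasFDerivWithinAt_univ, hasFDerivWithinAt_euclidean]
    intro j
    have h1 := (hτ j (uIoc_subset_uIcc hmem) s left_mem_uIcc).const_add (y j)
    simp_rw [hY]
    rw [hasFDerivWithinAt_univ]
    refine h1.hasFDerivAt.congr_fderiv ?_
    ext
    simp
  have h2 := ((h.hasFDerivAt (Y τ)).comp τ hYd).hasDerivAt.deriv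
  have h3 : deriv (fun τ => Φ (Y τ)) τ = _ := h2
  rw [h3]
  simp [inner_eq_sum, Finset.mul_sum, mul_assoc]

end Time

/-! ### Functions with an integrable weak time derivative -/

/-- `g` is the weak time derivative of `f ∈ C([0,∞); L¹(U))`, and both are integrable on bounded
time intervals. -/
structure IsTimeRegular (U : Set E3) (f g : ℝ → E3 → ℝ) : Prop where
  weak : IsWeakTimeDeriv U f g
  integrableOn : ∀ t, 0 ≤ t → IntegrableOn (f t) U
  tendsto : ∀ t, 0 ≤ t → Tendsto (fun s => ∫ x in U, |f s x - f t x|) (𝓝[Ici 0] t) (𝓝 0)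
  integrable : ∀ T, Integrable (Function.uncurry f)
    ((volume.restrict (Ioo 0 T)).prod (volume.restrict U))
  integrable_deriv : ∀ T, Integrable (Function.uncurry g)
    ((volume.restrict (Ioo 0 T)).prod (volume.restrict U))

section TimeRegular

variable {U : Set E3} {f g : ℝ → E3 → ℝ}

lemma IsTestFunction.time_mul {U : Set E3} {θ : ℝ → ℝ} {ψ : E3 → ℝ} {V : Set ℝ}
    (hθ : IsTestFunction V θ) (hψ : IsTestFunction U ψ) :
    IsTestFunction (V ×ˢ U) fun z : ℝ × E3 => θ z.1 * ψ z.2 := by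
  have hK : IsCompact (tsupport θ ×ˢ tsupport ψ) := hθ.2.1.prod hψ.2.1
  have hsub : tsupport (fun z : ℝ × E3 => θ z.1 * ψ z.2) ⊆ tsupport θ ×ˢ tsupport ψ := by
    refine closure_minimal (fun z hz => ⟨?_, ?_⟩) hK.isClosed
    · exact subset_tsupport _ (left_ne_zero_of_mul hz)
    · exact subset_tsupport _ (right_ne_zero_of_mul hz)
  exact ⟨(hθ.1.comp contDiff_fst).mul (hψ.1.comp contDiff_snd),
    hK.of_isClosed_subset (isClosed_tsupport _) hsub, hsub.trans (prod_mono hθ.2.2 hψ.2.2)⟩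

lemma fderiv_time_mul {θ : ℝ → ℝ} {ψ : E3 → ℝ} (hθ : ContDiff ℝ ∞ θ) (hψ : ContDiff ℝ ∞ ψ)
    (z : ℝ × E3) :
    fderiv ℝ (fun z : ℝ × E3 => θ z.1 * ψ z.2) z (1, 0) = deriv θ z.1 * ψ z.2 := by
  have h1 : HasFDerivAt (fun z : ℝ × E3 => θ z.1) _ z :=
    ((hθ.differentiable (by simp) z.1).hasFDerivAt).comp z hasFDerivAt_fst
  have h2 : HasFDerivAt (fun z : ℝ × E3 => ψ z.2) _ z :=
    ((hψ.differentiable (by simp) z.2).hasFDerivAt).comp z hasFDerivAt_snd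
  have h3 : HasFDerivAt (fun z : ℝ × E3 => θ z.1 * ψ z.2) _ z := h1.mul h2
  rw [h3.fderiv]
  simp [mul_comm]

lemma IsTimeRegular.integrable_deriv_Ioc (h : IsTimeRegular U f g) {s t : ℝ} (hs : 0 ≤ s) :
    Integrable (Function.uncurry g) ((volume.restrict (Ioc s t)).prod (volume.restrict U)) := by
  have h1 := h.integrable_deriv (t + 1)
  rw [Measure.prod_restrict] at h1 ⊢
  exact IntegrableOn.mono_set h1 (prod_mono (fun τ hτ =>
    ⟨hs.trans_lt hτ.1, by linarith [hτ.2]⟩) Subset.rfl)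

lemma IsTimeRegular.integrable_Ioc (h : IsTimeRegular U f g) {s t : ℝ} (hs : 0 ≤ s) :
    Integrable (Function.uncurry f) ((volume.restrict (Ioc s t)).prod (volume.restrict U)) := by
  have h1 := h.integrable (t + 1)
  rw [Measure.prod_restrict] at h1 ⊢
  exact IntegrableOn.mono_set h1 (prod_mono (fun τ hτ =>
    ⟨hs.trans_lt hτ.1, by linarith [hτ.2]⟩) Subset.rfl)

lemma integrable_uncurry_mul {f : ℝ → E3 → ℝ} {I : Set ℝ} {θ : ℝ → ℝ} {ψ : E3 → ℝ}
    (hf : Integrable (Function.uncurry f) ((volume.restrict I).prod (volume.restrict U)))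
    (hθ : Continuous θ) {A : ℝ} (hA : ∀ τ, ‖θ τ‖ ≤ A) (hψ : Continuous ψ) {B : ℝ}
    (hB : ∀ x, ‖ψ x‖ ≤ B) :
    Integrable (fun z : ℝ × E3 => f z.1 z.2 * (θ z.1 * ψ z.2))
      ((volume.restrict I).prod (volume.restrict U)) := by
  simp_rw [mul_comm (f _ _)]
  refine Integrable.bdd_mul (c := A * B) hf ?_ (.of_forall fun z => ?_)
  · exact ((hθ.comp continuous_fst).mul (hψ.comp continuous_snd)).aestronglyMeasurable
  · rw [norm_mul]
    exact mul_le_mul (hA _) (hB _) (norm_nonneg _) ((norm_nonneg _).trans (hA 0))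

/-- Product test functions θ(t)ψ(x) and Fubini reduce the space-time weak derivative to a scalar one
for t ↦ ∫ f ψ. -/
lemma IsTimeRegular.weak_integral (h : IsTimeRegular U f g) (hU : MeasurableSet U) {ψ : E3 → ℝ}
    (hψ : IsTestFunction U ψ) {T : ℝ} {θ : ℝ → ℝ} (hθ : ContDiff ℝ ∞ θ)
    (hθc : HasCompactSupport θ) (hθs : tsupport θ ⊆ Ioo 0 T) :
    ∫ τ in Ioo 0 T, (∫ x in U, f τ x * ψ x) * deriv θ τ =
      -∫ τ in Ioo 0 T, (∫ x in U, g τ x * ψ x) * θ τ := by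
  obtain ⟨B, hB⟩ := hψ.2.1.exists_bound_of_continuous hψ.1.continuous
  have key : ∀ (F : ℝ → E3 → ℝ) (η : ℝ → ℝ), Integrable (Function.uncurry F)
      ((volume.restrict (Ioo 0 T)).prod (volume.restrict U)) → Continuous η →
      HasCompactSupport η → tsupport η ⊆ Ioo 0 T →
      ∫ z in Ioi (0 : ℝ) ×ˢ U, F z.1 z.2 * (η z.1 * ψ z.2) =
        ∫ τ in Ioo 0 T, (∫ x in U, F τ x * ψ x) * η τ := by
    intro F η hF hη hηc hηs
    obtain ⟨A, hA⟩ := hηc.exists_bound_of_continuous hη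
    have hI := integrable_uncurry_mul hF hη hA hψ.1.continuous hB
    rw [setIntegral_eq_of_subset_of_forall_sdiff_eq_zero (s := Ioo 0 T ×ˢ U)
      (measurableSet_Ioi.prod hU) (prod_mono (fun τ hτ => hτ.1) Subset.rfl)]
    · rw [Measure.prod_restrict] at hI
      rw [Measure.volume_eq_prod, setIntegral_prod _ hI]
      refine integral_congr_ae (.of_forall fun τ => ?_)
      simp only
      rw [← integral_mul_const]
      refine integral_congr_ae (.of_forall fun x => ?_)
      simp only
      ring
    · rintro z ⟨hz, hz'⟩
      have : z.1 ∉ tsupport η := fun hmem => hz' ⟨hηs hmem, hz.2⟩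
      rw [image_eq_zero_of_notMem_tsupport this, zero_mul, mul_zero]
  have hφ := (show IsTestFunction (Ioo 0 T) θ from ⟨hθ, hθc, hθs⟩).time_mul hψ
  have h1 := h.weak.2.2 _ ⟨hφ.1, hφ.2.1, hφ.2.2.trans (prod_mono (fun τ hτ => hτ.1) Subset.rfl)⟩
  simp_rw [fderiv_time_mul hθ hψ.1] at h1
  rwa [key f (deriv θ) (h.integrable T) (hθ.continuous_deriv (by simp)) hθc.deriv
    ((tsupport_deriv_subset (𝕜 := ℝ)).trans hθs),
    key g θ (h.integrable_deriv T) hθ.continuous hθc hθs] at h1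

lemma IsTimeRegular.tendsto_integral_mul (h : IsTimeRegular U f g) {ψ : E3 → ℝ}
    (hψ : Continuous ψ) {B : ℝ} (hB : ∀ x, ‖ψ x‖ ≤ B) {t : ℝ} (ht : 0 ≤ t) :
    Tendsto (fun s => ∫ x in U, f s x * ψ x) (𝓝[Ici 0] t) (𝓝 (∫ x in U, f t x * ψ x)) := by
  have hi : ∀ s, 0 ≤ s → IntegrableOn (fun x => f s x * ψ x) U := fun s hs => by
    simp_rw [mul_comm (f _ _)]
    exact (h.integrableOn s hs).bdd_mul (c := B) hψ.aestronglyMeasurable (.of_forall hB)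
  rw [tendsto_iff_norm_sub_tendsto_zero]
  have h0 := (h.tendsto t ht).const_mul B
  rw [mul_zero] at h0
  refine squeeze_zero' (.of_forall fun _ => norm_nonneg _) ?_ h0
  filter_upwards [self_mem_nhdsWithin] with s hs
  rw [← integral_sub (hi s hs) (hi t ht), ← integral_const_mul]
  refine (norm_integral_le_integral_norm _).trans (integral_mono_of_nonneg
    (.of_forall fun _ => norm_nonneg _)
    (((h.integrableOn s hs).sub (h.integrableOn t ht)).abs.const_mul B) (.of_forall fun x => ?_))
  simp only
  rw [← sub_mul, norm_mul, mul_comm, Real.norm_eq_abs (_ - _)]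
  exact mul_le_mul_of_nonneg_right (hB x) (abs_nonneg _)

lemma IsTimeRegular.integral_mul_sub (h : IsTimeRegular U f g) (hU : MeasurableSet U) {ψ : E3 → ℝ}
    (hψ : IsTestFunction U ψ) {s t : ℝ} (hs : 0 ≤ s) (hst : s < t) :
    (∫ x in U, f t x * ψ x) - (∫ x in U, f s x * ψ x) =
      ∫ τ in Ioc s t, ∫ x in U, g τ x * ψ x := by
  obtain ⟨B, hB⟩ := hψ.2.1.exists_bound_of_continuous hψ.1.continuous
  have hint : ∀ {F : ℝ → E3 → ℝ} {I : Set ℝ}, Integrable (Function.uncurry F)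
      ((volume.restrict I).prod (volume.restrict U)) →
      IntegrableOn (fun τ => ∫ x in U, F τ x * ψ x) I := fun hF => by
    have h1 := (integrable_uncurry_mul hF continuous_const (fun _ => (norm_one (α := ℝ)).le)
      hψ.1.continuous hB).integral_prod_left
    simp only [one_mul] at h1
    exact h1
  have hc : ∀ τ, 0 < τ → ContinuousAt (fun s => ∫ x in U, f s x * ψ x) τ := fun τ hτ => by
    have h1 := h.tendsto_integral_mul hψ.1.continuous hB hτ.le
    rwa [nhdsWithin_eq_nhds.2 (Ici_mem_nhds hτ)] at h1
  have hpos : ∀ s', 0 < s' → s' < t → (∫ x in U, f t x * ψ x) - (∫ x in U, f s' x * ψ x) =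
      ∫ τ in Ioc s' t, ∫ x in U, g τ x * ψ x := fun s' hs' hst' =>
    sub_eq_integral_of_weak_deriv hs' hst' (lt_add_one t) (hint (h.integrable _))
      (hint (h.integrable_deriv _)) (hc s' hs') (hc t (hs'.trans hst'))
      fun θ hθ hθc hθs => h.weak_integral hU hψ hθ hθc hθs
  -- The test functions live on the open half line, so s = 0 is reached from positive times, using
  -- continuity of f in L¹ and of the primitive.
  rcases hs.eq_or_lt with rfl | hs'
  · have hG : IntegrableOn (fun τ => ∫ x in U, g τ x * ψ x) (Icc 0 t) := by
      rw [integrableOn_Icc_iff_integrableOn_Ioc]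
      exact hint (h.integrable_deriv_Ioc le_rfl)
    have h1 := (intervalIntegral.continuousOn_primitive hG 0 (left_mem_Icc.2 hst.le)).tendsto
    simp only [Ioc_self, Measure.restrict_empty, integral_zero_measure] at h1
    have h2 := tendsto_const_nhds (x := ∫ x in U, f t x * ψ x) |>.sub
      ((h.tendsto_integral_mul hψ.1.continuous hB le_rfl).mono_left
        (nhdsWithin_mono 0 (Ioo_subset_Ico_self.trans Ico_subset_Ici_self : Ioo 0 t ⊆ Ici 0)))
    have h3 := (h1.mono_left (nhdsWithin_mono 0 (Ioo_subset_Icc_self : Ioo 0 t ⊆ _))).const_sub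
      (∫ τ in Ioc 0 t, ∫ x in U, g τ x * ψ x)
    rw [sub_zero] at h3
    have hne : (𝓝[Ioo 0 t] (0 : ℝ)).NeBot := by
      rw [nhdsWithin_Ioo_eq_nhdsGT hst]
      infer_instance
    refine tendsto_nhds_unique_of_eventuallyEq h2 h3 ?_
    filter_upwards [self_mem_nhdsWithin] with σ hσ
    rw [hpos σ hσ.1 hσ.2, eq_sub_iff_add_eq, add_comm, ← setIntegral_union
      (Ioc_disjoint_Ioc_of_le le_rfl) measurableSet_Ioc, Ioc_union_Ioc_eq_Ioc hσ.1.le hσ.2.le]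
    · exact hG.mono_set ((Ioc_subset_Ioc_right hσ.2.le).trans Ioc_subset_Icc_self)
    · exact hG.mono_set ((Ioc_subset_Ioc_left hσ.1.le).trans Ioc_subset_Icc_self)
  · exact hpos s hs' hst

/-- The scalar identities for all ψ determine the slices almost everywhere. The exceptional set
depends on s and t, so this alone does not give a path in t for fixed x. -/
lemma IsTimeRegular.ae_sub_eq (h : IsTimeRegular U f g) (hU : IsOpen U) {s t : ℝ} (hs : 0 ≤ s)
    (hst : s < t) :
    ∀ᵐ x ∂volume.restrict U, f t x = f s x + ∫ τ in s..t, g τ x := by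
  have hg := h.integrable_deriv_Ioc hs (t := t)
  have hI : IntegrableOn (fun x => f t x - f s x - ∫ τ in Ioc s t, g τ x) U :=
    ((h.integrableOn t (hs.trans hst.le)).sub (h.integrableOn s hs)).sub hg.integral_prod_right
  have h0 := hU.ae_eq_zero_of_integral_contDiff_smul_eq_zero hI.locallyIntegrableOn ?_
  · rw [ae_restrict_iff' hU.measurableSet]
    filter_upwards [h0] with x hx hxU
    rw [intervalIntegral.integral_of_le hst.le]
    linarith [hx hxU]
  · intro ψ hψ hψc hψs
    obtain ⟨B, hB⟩ := hψc.exists_bound_of_continuous hψ.continuous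
    have hm : ∀ {F : E3 → ℝ}, IntegrableOn F U → IntegrableOn (fun x => F x * ψ x) U :=
      fun hF => by
        simp_rw [mul_comm (_ : ℝ) (ψ _)]
        exact hF.bdd_mul (c := B) hψ.continuous.aestronglyMeasurable (.of_forall hB)
    have h1 := h.integral_mul_sub hU.measurableSet ⟨hψ, hψc, hψs⟩ hs hst
    have h2 := integrable_uncurry_mul hg continuous_const (fun _ => (norm_one (α := ℝ)).le)
      hψ.continuous hB
    simp only [one_mul] at h2
    rw [integral_integral_swap h2] at h1
    rw [← setIntegral_eq_integral_of_forall_compl_eq_zero (s := U)]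
    · have h3 := hm (h.integrableOn t (hs.trans hst.le))
      have h4 := hm (h.integrableOn s hs)
      have h5 : IntegrableOn (fun x => (∫ τ in Ioc s t, g τ x) * ψ x) U := hm hg.integral_prod_right
      have h6 : ∀ x, ψ x • (f t x - f s x - ∫ τ in Ioc s t, g τ x) =
          f t x * ψ x - f s x * ψ x - (∫ τ in Ioc s t, g τ x) * ψ x := fun x => by
        rw [smul_eq_mul]
        ring
      simp_rw [h6]
      have h34 : IntegrableOn (fun x => f t x * ψ x - f s x * ψ x) U := h3.sub h4
      rw [integral_sub h34 h5, integral_sub h3 h4, h1]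
      simp_rw [integral_mul_const]
      simp
    · intro x hx
      rw [image_eq_zero_of_notMem_tsupport (fun hmem => hx (hψs hmem)), zero_smul]

end TimeRegular

/-! ### The chain rule in time, integrated over the domain. -/

section TimeRegular

/-- Joint measurability of both sides allows Tonelli to turn equality on almost every slice into
equality on the product. Swapping the variables then exchanges the two quantifiers. -/
lemma ae_eq_prod_of_ae_ae_eq {α β : Type*} [MeasurableSpace α] [MeasurableSpace β] {μ : Measure α}
    {ν : Measure β} [SFinite μ] [SFinite ν] {F G : α × β → ℝ}
    (hF : AEStronglyMeasurable F (μ.prod ν)) (hG : AEStronglyMeasurable G (μ.prod ν))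
    (h : ∀ᵐ x ∂μ, ∀ᵐ y ∂ν, F (x, y) = G (x, y)) : F =ᵐ[μ.prod ν] G := by
  have hm : AEMeasurable (fun z => ‖F z - G z‖ₑ) (μ.prod ν) := (hF.sub hG).enorm
  have h0 : ∫⁻ z, ‖F z - G z‖ₑ ∂μ.prod ν = 0 := by
    rw [lintegral_prod _ hm, lintegral_congr_ae (g := fun _ => 0), lintegral_zero]
    filter_upwards [h] with x hx
    rw [lintegral_congr_ae (g := fun _ => 0), lintegral_zero]
    filter_upwards [hx] with y hy
    simp [hy]
  filter_upwards [(lintegral_eq_zero_iff' hm).1 h0] with z hz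
  simpa [sub_eq_zero] using hz

lemma ae_ae_of_ae_prod_swap {α β : Type*} [MeasurableSpace α] [MeasurableSpace β] {μ : Measure α}
    {ν : Measure β} [SFinite μ] [SFinite ν] {p : α × β → Prop} (h : ∀ᵐ z ∂μ.prod ν, p z) :
    ∀ᵐ y ∂ν, ∀ᵐ x ∂μ, p (x, y) :=
  Measure.ae_ae_of_ae_prod
    ((Measure.measurePreserving_swap (μ := ν) (ν := μ)).quasiMeasurePreserving.ae h)

lemma stronglyMeasurable_primitive {g : ℝ × E3 → ℝ} (hg : StronglyMeasurable g) (s : ℝ) :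
    StronglyMeasurable fun z : ℝ × E3 => ∫ v in Ioc s z.1, g (v, z.2) := by
  have hS : MeasurableSet {p : (ℝ × E3) × ℝ | s < p.2 ∧ p.2 ≤ p.1.1} :=
    (measurableSet_lt measurable_const measurable_snd).inter
      (measurableSet_le measurable_snd measurable_fst.fst)
  have h1 : StronglyMeasurable (Function.uncurry fun (z : ℝ × E3) (v : ℝ) =>
      (Ioc s z.1).indicator (fun v => g (v, z.2)) v) := by
    convert (hg.comp_measurable (measurable_snd.prodMk measurable_fst.snd)).indicator hS using 1
    ext p
    simp [Function.uncurry, indicator, mem_Ioc]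
  convert h1.integral_prod_right (ν := volume) using 1
  ext z
  rw [integral_indicator measurableSet_Ioc]

/-- The integrated chain rule in time. -/
lemma IsRadialEntropy.integral_sub_eq {κ : Type*} [Fintype κ] {Φ k : EuclideanSpace ℝ κ → ℝ}
    (h : IsRadialEntropy Φ k) {U : Set E3} (hU : IsOpen U)
    {f g : κ → ℝ → E3 → ℝ} (hfg : ∀ j, IsTimeRegular U (f j) (g j)) {s t : ℝ} (hs : 0 ≤ s)
    (hst : s < t) :
    IntegrableOn (fun τ => ∫ x in U, ∑ j, (k (field (fun j => f j τ) x) * f j τ x) * g j τ x)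
      (Ioc s t) ∧
    (∫ x in U, (Φ (field (fun j => f j t) x) - Φ 0)) -
      (∫ x in U, (Φ (field (fun j => f j s) x) - Φ 0)) =
    ∫ τ in Ioc s t, ∫ x in U, ∑ j, (k (field (fun j => f j τ) x) * f j τ x) * g j τ x := by
  set μ := volume.restrict (Ioc s t) with hμ
  set ν := volume.restrict U with hν
  have hg : ∀ j, Integrable (Function.uncurry (g j)) (μ.prod ν) := fun j =>
    (hfg j).integrable_deriv_Ioc hs
  have hf : ∀ j, Integrable (Function.uncurry (f j)) (μ.prod ν) := fun j =>
    (hfg j).integrable_Ioc hs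
  -- A strongly measurable representative is taken so that the primitive in W is jointly measurable;
  -- for almost every x the path τ ↦ W(τ, x) is absolutely continuous.
  set g' : κ → ℝ × E3 → ℝ := fun j => (hg j).aestronglyMeasurable.mk _ with hg'
  have hg'm : ∀ j, StronglyMeasurable (g' j) := fun j =>
    (hg j).aestronglyMeasurable.stronglyMeasurable_mk
  have hgg' : ∀ j, ∀ᵐ z ∂μ.prod ν, g j z.1 z.2 = g' j z := fun j =>
    (hg j).aestronglyMeasurable.ae_eq_mk
  set W : ℝ × E3 → EuclideanSpace ℝ κ := fun z => WithLp.toLp 2 fun j =>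
    f j s z.2 + ∫ v in Ioc s z.1, g' j (v, z.2) with hW
  set Q : ℝ × E3 → EuclideanSpace ℝ κ := fun z => field (fun j => f j z.1) z.2 with hQ
  have hQW : ∀ j, ∀ τ, τ ∈ Ioc s t → ∀ᵐ x ∂ν, f j τ x = W (τ, x) j := by
    intro j τ hτ
    filter_upwards [(hfg j).ae_sub_eq hU hs hτ.1, ae_ae_of_ae_prod_swap (hgg' j)] with x hx hx'
    rw [hx, intervalIntegral.integral_of_le hτ.1.le]
    simp only [hW]
    congr 1
    refine integral_congr_ae ?_
    filter_upwards [ae_restrict_of_ae_restrict_of_subset (Ioc_subset_Ioc_right hτ.2) hx']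
      with v hv using hv
  have hWm : ∀ j, AEStronglyMeasurable (fun z => W z j) (μ.prod ν) := fun j =>
    ((hfg j).integrableOn s hs).aestronglyMeasurable.comp_snd.add
      (stronglyMeasurable_primitive (hg'm j) s).aestronglyMeasurable
  -- For each τ the slices agree for almost every x; passing through the product measure gives
  -- agreement for almost every x at almost every τ, which is enough inside the time integral. The
  -- endpoint values are matched separately.
  have hQWae : ∀ᵐ z ∂μ.prod ν, Q z = W z := by
    have h1 : ∀ j, ∀ᵐ z ∂μ.prod ν, f j z.1 z.2 = W z j := fun j => by
      refine ae_eq_prod_of_ae_ae_eq (F := fun z => f j z.1 z.2) (G := fun z => W z j)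
        (hf j).aestronglyMeasurable (hWm j) ?_
      filter_upwards [ae_restrict_mem measurableSet_Ioc] with τ hτ using hQW j τ hτ
    filter_upwards [ae_all_iff.2 h1] with z hz
    ext j
    exact hz j
  have hQm : AEStronglyMeasurable Q (μ.prod ν) :=
    (PiLp.continuous_toLp 2 _).comp_aestronglyMeasurable
      (aemeasurable_pi_lambda _ fun j =>
        (hf j).aestronglyMeasurable.aemeasurable).aestronglyMeasurable
  have hI : Integrable (fun z => ∑ j, (k (Q z) * Q z j) * g j z.1 z.2) (μ.prod ν) := by
    refine integrable_finsetSum _ fun j _ => Integrable.bdd_mul (c := 1) (hg j) ?_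
      (.of_forall fun z => h.abs_mul_apply_le _ j)
    exact (h.contDiff.continuous.comp_aestronglyMeasurable hQm).mul (hf j).aestronglyMeasurable
  refine ⟨hI.integral_prod_left, ?_⟩
  have hΦ : ∀ τ, 0 ≤ τ → Integrable (fun x => Φ (field (fun j => f j τ) x) - Φ 0) ν :=
      fun τ hτ => by
    have hm : AEStronglyMeasurable (field (fun j => f j τ)) ν :=
      aestronglyMeasurable_field fun j => ((hfg j).integrableOn τ hτ).aestronglyMeasurable
    refine Integrable.mono' (integrable_finsetSum Finset.univ fun j _ =>
      ((hfg j).integrableOn τ hτ).abs)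
      ((h.continuous.comp_aestronglyMeasurable hm).sub aestronglyMeasurable_const)
      (.of_forall fun x => ?_)
    rw [Real.norm_of_nonneg (sub_nonneg.2 (h.map_zero_le _))]
    exact (h.sub_map_zero_le_norm _).trans (norm_le_sum_abs _)
  rw [← integral_sub (hΦ t (hs.trans hst.le)) (hΦ s hs)]
  have hswap := integral_integral_swap
    (f := fun τ x => ∑ j, (k (Q (τ, x)) * Q (τ, x) j) * g j τ x) hI
  refine Eq.trans ?_ hswap.symm
  refine integral_congr_ae ?_
  have hgi : ∀ᵐ x ∂ν, ∀ j, Integrable (fun v => g' j (v, x)) μ := by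
    refine ae_all_iff.2 fun j => ?_
    exact ((hg j).congr (hgg' j)).prod_left_ae
  filter_upwards [ae_all_iff.2 fun j => hQW j t (right_mem_Ioc.2 hst), hgi,
    ae_all_iff.2 fun j => ae_ae_of_ae_prod_swap (hgg' j), ae_ae_of_ae_prod_swap hQWae]
    with x hxt hxi hxg hxQ
  have hchain := h.sub_eq_integral (s := s) (t := t) (fun j => f j s x)
    (γ := fun j v => g' j (v, x))
    (fun j => (intervalIntegrable_iff_integrableOn_Ioc_of_le hst.le).2 (hxi j))
    (Y := fun τ => WithLp.toLp 2 fun j => f j s x + ∫ v in s..τ, g' j (v, x)) (fun _ _ => rfl)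
  have hYW : ∀ τ, s ≤ τ → (WithLp.toLp 2 fun j => f j s x + ∫ v in s..τ, g' j (v, x)) = W (τ, x) :=
    fun τ hτ => by
      ext j
      simp only [hW, intervalIntegral.integral_of_le hτ]
  have h1 : field (fun j => f j t) x = W (t, x) := by
    ext j
    exact hxt j
  have h2 : field (fun j => f j s) x = WithLp.toLp 2 fun j =>
      f j s x + ∫ v in s..s, g' j (v, x) := by
    ext j
    simp [field_apply]
  rw [h1, ← hYW t hst.le, h2, sub_sub_sub_cancel_right, hchain,
    intervalIntegral.integral_of_le hst.le]
  refine integral_congr_ae ?_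
  filter_upwards [ae_all_iff.2 hxg, hxQ, ae_restrict_mem measurableSet_Ioc] with τ h3 h4 h5
  refine Finset.sum_congr rfl fun j _ => ?_
  rw [hYW τ h5.1.le, h4, h3 j]
  simp only [hW, intervalIntegral.integral_of_le h5.1.le]

end TimeRegular

/-! ### Uniqueness of weak derivatives -/

section Uniqueness

lemma integrableOn_mul_of_isTestFunction {E : Type*} [NormedAddCommGroup E] [NormedSpace ℝ E]
    [MeasurableSpace E] [BorelSpace E] {μ : Measure E} {V : Set E} {g φ : E → ℝ}
    (hg : LocallyIntegrableOn g V μ) (hφ : IsTestFunction V φ) :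
    IntegrableOn (fun x => g x * φ x) V μ := by
  obtain ⟨B, hB⟩ := hφ.2.1.exists_bound_of_continuous hφ.1.continuous
  have h1 : IntegrableOn (fun x => g x * φ x) (tsupport φ) μ := by
    simp_rw [mul_comm (g _)]
    exact (hg.integrableOn_compact_subset hφ.2.2 hφ.2.1).bdd_mul (c := B)
      hφ.1.continuous.aestronglyMeasurable.restrict (.of_forall hB)
  refine (h1.integrable_of_forall_notMem_eq_zero fun x hx => ?_).integrableOn
  rw [image_eq_zero_of_notMem_tsupport hx, mul_zero]

lemma ae_eq_of_forall_isTestFunction {E : Type*} [NormedAddCommGroup E] [NormedSpace ℝ E]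
    [FiniteDimensional ℝ E] [MeasurableSpace E] [BorelSpace E] {μ : Measure E} {V : Set E}
    (hV : IsOpen V) {g g' : E → ℝ} (hg : LocallyIntegrableOn g V μ)
    (hg' : LocallyIntegrableOn g' V μ)
    (h : ∀ φ, IsTestFunction V φ → ∫ x in V, g x * φ x ∂μ = ∫ x in V, g' x * φ x ∂μ) :
    g =ᵐ[μ.restrict V] g' := by
  have h0 := hV.ae_eq_zero_of_integral_contDiff_smul_eq_zero (hg.sub hg') ?_
  · rw [EventuallyEq, ae_restrict_iff' hV.measurableSet]
    filter_upwards [h0] with x hx hxV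
    exact sub_eq_zero.1 (hx hxV)
  · intro φ hφ hφc hφs
    rw [← setIntegral_eq_integral_of_forall_compl_eq_zero (s := V)]
    · have h1 : ∀ x, φ x • (g - g') x = g x * φ x - g' x * φ x := fun x => by
        rw [smul_eq_mul, Pi.sub_apply]
        ring
      simp_rw [h1]
      rw [integral_sub (integrableOn_mul_of_isTestFunction hg ⟨hφ, hφc, hφs⟩)
        (integrableOn_mul_of_isTestFunction hg' ⟨hφ, hφc, hφs⟩), h φ ⟨hφ, hφc, hφs⟩, sub_self]
    · intro x hx
      rw [image_eq_zero_of_notMem_tsupport (fun hmem => hx (hφs hmem)), zero_smul]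

variable {U : Set E3}

lemma IsWeakPartial.ae_eq {i : Fin 3} {f g g' : E3 → ℝ} (h : IsWeakPartial U i f g)
    (h' : IsWeakPartial U i f g') (hU : IsOpen U) : g =ᵐ[volume.restrict U] g' :=
  ae_eq_of_forall_isTestFunction hU h.2.1 h'.2.1 fun φ hφ => by
    rw [← neg_inj, ← h.2.2 φ hφ, h'.2.2 φ hφ]

lemma IsWeakPartial.isWeakPartial_wD {i : Fin 3} {f g : E3 → ℝ} (h : IsWeakPartial U i f g) :
    IsWeakPartial U i f (wD U i f) := by
  have hex : ∃ g, IsWeakPartial U i f g := ⟨g, h⟩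
  rw [wD, dif_pos hex]
  exact hex.choose_spec

lemma IsWeakPartial.congr_left {i : Fin 3} {f f' g : E3 → ℝ} (h : IsWeakPartial U i f g)
    (hf : LocallyIntegrableOn f' U) (hff' : f =ᵐ[volume.restrict U] f') :
    IsWeakPartial U i f' g := by
  refine ⟨hf, h.2.1, fun φ hφ => ?_⟩
  rw [← h.2.2 φ hφ]
  refine integral_congr_ae ?_
  filter_upwards [hff'] with x hx
  rw [hx]

/-- The equation is stated for the chosen derivative `wDt`, the regularity for some representative
g; uniqueness identifies the two. -/
lemma IsWeakTimeDeriv.ae_ae_wDt_eq {f g : ℝ → E3 → ℝ} (h : IsWeakTimeDeriv U f g)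
    (hU : IsOpen U) :
    ∀ᵐ t ∂volume.restrict (Ioi (0 : ℝ)), ∀ᵐ x ∂volume.restrict U, wDt U f t x = g t x := by
  have hex : ∃ g, IsWeakTimeDeriv U f g := ⟨g, h⟩
  have h' : IsWeakTimeDeriv U f (wDt U f) := by
    rw [wDt, dif_pos hex]
    exact hex.choose_spec
  have h1 := ae_eq_of_forall_isTestFunction (isOpen_Ioi.prod hU) h'.2.1 h.2.1 fun φ hφ => by
    have h2 := h.2.2 φ hφ
    rw [h'.2.2 φ hφ, neg_inj] at h2
    exact h2
  rw [Measure.volume_eq_prod, ← Measure.prod_restrict] at h1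
  exact Measure.ae_ae_of_ae_prod h1

end Uniqueness

/-! ### Bochner spaces -/

section Bochner

lemma exists_eLpNorm_le_mul {X : Type*} [MeasurableSpace X] {μ : Measure X} [IsFiniteMeasure μ]
    {p q : ℝ≥0∞} (hp : p ≠ 0) (hpq : p ≤ q) (hq : q ≠ ⊤) :
    ∃ C : ℝ≥0∞, C ≠ ⊤ ∧ ∀ f : X → ℝ, AEStronglyMeasurable f μ →
      eLpNorm f p μ ≤ eLpNorm f q μ * C := by
  refine ⟨_, ?_, fun f hf => eLpNorm_le_eLpNorm_mul_rpow_measure_univ hpq hf⟩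
  refine ENNReal.rpow_ne_top_of_nonneg ?_ (measure_ne_top μ _)
  rw [sub_nonneg]
  exact one_div_le_one_div_of_le (ENNReal.toReal_pos hp (ne_top_of_le_ne_top hq hpq))
    (ENNReal.toReal_mono hq hpq)

lemma exists_forall_eLpNorm_le {X : Type*} [MeasurableSpace X] {μ : Measure X} [IsFiniteMeasure μ]
    {p q : ℝ≥0∞} (hp : p ≠ 0) (hpq : p ≤ q) (hq : q ≠ ⊤) {ε : ℝ≥0∞} (hε : 0 < ε) :
    ∃ δ : ℝ≥0∞, 0 < δ ∧ ∀ f : X → ℝ, AEStronglyMeasurable f μ → eLpNorm f q μ ≤ δ →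
      eLpNorm f p μ ≤ ε := by
  obtain ⟨C, hCtop, hC⟩ := exists_eLpNorm_le_mul (μ := μ) hp hpq hq
  -- The summand 1 guards against C = 0.
  refine ⟨ε / (C + 1), ENNReal.div_pos hε.ne' (by simpa using hCtop), fun f hf hδ => ?_⟩
  calc eLpNorm f p μ ≤ ε / (C + 1) * (C + 1) :=
        (hC f hf).trans (mul_le_mul' hδ le_self_add)
    _ ≤ ε := (ENNReal.div_mul_cancel (by simp) (by simpa using hCtop)).le

variable {U : Set E3} {m q T : ℝ} {f : ℝ → E3 → ℝ}

lemma MemLL.ae_memLp (h : MemLL m q U T f) (hm : 0 < m) (hq : 1 ≤ q) :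
    ∀ᵐ t ∂volume.restrict (Ioo 0 T), MemLp (f t) (ENNReal.ofReal q) (volume.restrict U) := by
  have hq0 : ENNReal.ofReal q ≠ 0 := by
    rw [ENNReal.ofReal_ne_zero_iff]
    linarith
  have hmeas : AEMeasurable (fun t => eLpNorm (f t) (ENNReal.ofReal q) (volume.restrict U) ^ m)
      (volume.restrict (Ioo 0 T)) := by
    simp_rw [eLpNorm_eq_lintegral_rpow_enorm_toReal hq0 ENNReal.ofReal_ne_top]
    refine (AEMeasurable.pow_const ?_ _).pow_const m
    exact AEMeasurable.lintegral_prod_right' (f := fun z : ℝ × E3 => ‖f z.1 z.2‖ₑ ^ _)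
      (h.1.enorm.pow_const _)
  filter_upwards [h.1.prodMk_left, ae_lt_top' hmeas h.2.ne] with t ht ht'
  exact ⟨ht, (ENNReal.rpow_lt_top_iff_of_pos hm).1 ht'⟩

lemma MemLL.integrable (h : MemLL m q U T f) (hm : 1 ≤ m) (hq : 1 ≤ q)
    (hU : volume U ≠ ⊤) :
    Integrable (Function.uncurry f) ((volume.restrict (Ioo 0 T)).prod (volume.restrict U)) := by
  have hfin : IsFiniteMeasure (volume.restrict U) := ⟨by simpa using hU.lt_top⟩
  obtain ⟨C, hCtop, hC⟩ := exists_eLpNorm_le_mul (μ := volume.restrict U) one_ne_zero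
    (show (1 : ℝ≥0∞) ≤ ENNReal.ofReal q by simpa using hq) ENNReal.ofReal_ne_top
  refine ⟨h.1, ?_⟩
  rw [hasFiniteIntegral_iff_enorm, lintegral_prod _ h.1.enorm]
  calc ∫⁻ t in Ioo 0 T, ∫⁻ x in U, ‖Function.uncurry f (t, x)‖ₑ
      -- From y ≤ 1 + y^m for m ≥ 1, which avoids a Hölder inequality in time.
      ≤ ∫⁻ t in Ioo 0 T, (1 + eLpNorm (f t) (ENNReal.ofReal q) (volume.restrict U) ^ m) * C := by
        refine lintegral_mono_ae ?_
        filter_upwards [h.1.prodMk_left] with t ht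
        have h1 := hC _ ht
        rw [eLpNorm_one_eq_lintegral_enorm] at h1
        refine h1.trans (mul_le_mul_left ?_ C)
        set y := eLpNorm (f t) (ENNReal.ofReal q) (volume.restrict U)
        change y ≤ _
        rcases le_or_gt y 1 with hy | hy
        · exact hy.trans le_self_add
        · exact (ENNReal.le_rpow_self_of_one_le hy.le hm).trans le_add_self
    _ < ⊤ := by
        rw [lintegral_mul_const' _ _ hCtop, lintegral_add_left measurable_const]
        refine ENNReal.mul_lt_top (ENNReal.add_lt_top.2 ⟨?_, h.2⟩) hCtop.lt_top
        simp

lemma ContinuousInLp.isTimeRegular {g : ℝ → E3 → ℝ} (h : ContinuousInLp q U f) (hq : 1 ≤ q)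
    (hU : volume U ≠ ⊤) (hw : IsWeakTimeDeriv U f g)
    (hf : ∀ T, Integrable (Function.uncurry f)
      ((volume.restrict (Ioo 0 T)).prod (volume.restrict U)))
    (hg : ∀ T, Integrable (Function.uncurry g)
      ((volume.restrict (Ioo 0 T)).prod (volume.restrict U))) : IsTimeRegular U f g := by
  have hfin : IsFiniteMeasure (volume.restrict U) := ⟨by simpa using hU.lt_top⟩
  have hq' : (1 : ℝ≥0∞) ≤ ENNReal.ofReal q := by simpa using hq
  refine ⟨hw, fun t ht => (h t ht).1.integrable hq', fun t ht => ?_, hf, hg⟩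
  obtain ⟨C, hCtop, hC⟩ := exists_eLpNorm_le_mul (μ := volume.restrict U) one_ne_zero hq'
    ENNReal.ofReal_ne_top
  have h0 := ENNReal.Tendsto.mul_const (b := C) (h t ht).2 (.inr hCtop)
  rw [zero_mul] at h0
  have h1 := tendsto_of_tendsto_of_tendsto_of_le_of_le' tendsto_const_nhds h0
    (f := fun s => ∫⁻ x in U, ‖f s x - f t x‖ₑ) (.of_forall fun _ => zero_le) (by
      filter_upwards [self_mem_nhdsWithin] with s hs
      have h2 := hC _ ((h s hs).1.1.sub (h t ht).1.1)
      rw [eLpNorm_one_eq_lintegral_enorm] at h2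
      exact h2)
  have h2 := (ENNReal.tendsto_toReal ENNReal.zero_ne_top).comp h1
  refine (h2.congr' ?_)
  filter_upwards [self_mem_nhdsWithin] with s hs
  exact (integral_norm_eq_lintegral_enorm ((h s hs).1.1.sub (h t ht).1.1)).symm

end Bochner

/-! ### Time slices of a strong solution -/

section Slices

variable {U : Set E3} {m q T : ℝ} {f : ℝ → E3 → ℝ}

lemma MemLW.memLL : ∀ {n : ℕ} {f : ℝ → E3 → ℝ}, MemLW m q U T n f → MemLL m q U T f
  | 0, _, h => h
  | _ + 1, _, h => h.1

lemma MemLW.ae_wD {n : ℕ} (h : MemLW m q U T (n + 1) f) (hU : IsOpen U) (hm : 0 < m)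
    (hq : 1 ≤ q) :
    ∀ᵐ t ∂volume.restrict (Ioo 0 T), ∀ i, IsWeakPartial U i (f t) (wD U i (f t)) ∧
      MemLp (wD U i (f t)) (ENNReal.ofReal q) (volume.restrict U) := by
  refine ae_all_iff.2 fun i => ?_
  obtain ⟨g, hg, hgn⟩ := h.2 i
  filter_upwards [hg, hgn.memLL.ae_memLp hm hq] with t ht ht'
  exact ⟨ht.isWeakPartial_wD, (memLp_congr_ae (ht.isWeakPartial_wD.ae_eq ht hU)).2 ht'⟩

lemma MemLW.ae_wD_wD {n : ℕ} (h : MemLW m q U T (n + 2) f) (hU : IsOpen U) (hm : 0 < m)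
    (hq : 1 ≤ q) :
    ∀ᵐ t ∂volume.restrict (Ioo 0 T), ∀ i,
      IsWeakPartial U i (wD U i (f t)) (wD U i (wD U i (f t))) ∧
      MemLp (wD U i (wD U i (f t))) (ENNReal.ofReal q) (volume.restrict U) := by
  refine ae_all_iff.2 fun i => ?_
  obtain ⟨g, hg, hgn⟩ := h.2 i
  obtain ⟨l, hl, hln⟩ := hgn.2 i
  filter_upwards [hg, hl, hln.memLL.ae_memLp hm hq] with t ht htl htl'
  have h1 := htl.congr_left ht.isWeakPartial_wD.2.1 (ht.ae_eq ht.isWeakPartial_wD hU)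
  exact ⟨h1.isWeakPartial_wD, (memLp_congr_ae (h1.isWeakPartial_wD.ae_eq h1 hU)).2 htl'⟩

lemma ae_restrict_Ioi_of_forall {P : ℝ → Prop}
    (h : ∀ T, 0 < T → ∀ᵐ t ∂volume.restrict (Ioo 0 T), P t) :
    ∀ᵐ t ∂volume.restrict (Ioi (0 : ℝ)), P t := by
  have hunion : Ioi (0 : ℝ) = ⋃ n : ℕ, Ioo 0 ((n : ℝ) + 1) := by
    ext t
    simp only [mem_Ioi, mem_iUnion, mem_Ioo, exists_and_left]
    exact ⟨fun ht => ⟨ht, (exists_nat_gt t).imp fun n hn => by linarith⟩, fun ht => ht.1⟩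
  rw [hunion, ae_restrict_iUnion_iff]
  exact fun n => h _ (by positivity)

lemma HasZeroNormalDeriv.exists_isTestLimit {r : ℝ} {f : E3 → ℝ} (h : HasZeroNormalDeriv r U f)
    (hr : 1 ≤ r) (hU : volume U ≠ ⊤) :
    ∃ σ, IsDefiningFunction U σ ∧ ∃ g : Fin 3 → E3 → ℝ,
      IsTestLimit U (fun x => ∑ i, partialD i σ x * wD U i f x) g := by
  have hfin : IsFiniteMeasure (volume.restrict U) := ⟨by simpa using hU.lt_top⟩
  have hr' : (1 : ℝ≥0∞) ≤ ENNReal.ofReal r := by simpa using hr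
  obtain ⟨σ, hσ, hf, G, hG, -, happ⟩ := h
  refine ⟨σ, hσ, G, hf.integrable hr', fun i => (hG i).integrable hr', fun ε hε => ?_⟩
  obtain ⟨δ, hδ, hδε⟩ := exists_forall_eLpNorm_le (μ := volume.restrict U) one_ne_zero hr'
    ENNReal.ofReal_ne_top hε
  obtain ⟨φ, hφ, h1, h2⟩ := happ δ hδ
  refine ⟨φ, hφ, ?_, fun i => ?_⟩
  · have h3 := hδε _ (hf.1.sub hφ.1.continuous.aestronglyMeasurable) h1
    rw [eLpNorm_one_eq_lintegral_enorm] at h3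
    exact h3
  · have h3 := hδε _ ((hG i).1.sub (continuous_partialD
      (hφ.1.of_le (by exact_mod_cast le_top)) i).aestronglyMeasurable) (h2 i)
    rw [eLpNorm_one_eq_lintegral_enorm] at h3
    exact h3

lemma IsC3Domain.volume_ne_top (hU : IsC3Domain U) : volume U ≠ ⊤ :=
  hU.isBounded.measure_lt_top.ne

lemma sum_field_mul_molecularField {a b c : ℝ} {A : E3 → Mat3} (x : E3) :
    ∑ j : Fin 3 × Fin 3, A x j.1 j.2 * molecularField a b c U A x j.1 j.2 =
      ∑ α, ∑ β, A x α β * bulkField a b c (A x) α β +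
        ∑ i, ∑ j : Fin 3 × Fin 3, A x j.1 j.2 *
          wD U i (wD U i fun y => A y j.1 j.2) x := by
  rw [Finset.sum_comm (s := Finset.univ (α := Fin 3))
    (t := Finset.univ (α := Fin 3 × Fin 3)), ← Fintype.sum_prod_type'
      (f := fun α β => A x α β * bulkField a b c (A x) α β), ← Finset.sum_add_distrib]
  refine Finset.sum_congr rfl fun j _ => ?_
  rw [← Finset.mul_sum, ← mul_add]
  rfl

variable {Φ k : EuclideanSpace ℝ (Fin 3 × Fin 3) → ℝ}

/-- The entropy production of the order parameter at a fixed time. -/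
lemma IsRadialEntropy.integral_production_le (h : IsRadialEntropy Φ k) (hU : IsC3Domain U)
    {a b c : ℝ} (ha : 0 < a) (hc : 0 < c) (hac : 9 / 16 * b ^ 2 ≤ a * c) {r : ℝ} (hq : 2 ≤ q)
    (hr : 2 ≤ r) {A : E3 → Mat3} {v : E3 → Fin 3 → ℝ} {γ : Fin 3 × Fin 3 → E3 → ℝ}
    (hA : ∀ j : Fin 3 × Fin 3, MemLp (fun x => A x j.1 j.2) (ENNReal.ofReal r) (volume.restrict U))
    (hAw : ∀ j : Fin 3 × Fin 3, ∀ i,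
      IsWeakPartial U i (fun x => A x j.1 j.2) (wD U i fun x => A x j.1 j.2) ∧
      MemLp (wD U i fun x => A x j.1 j.2) (ENNReal.ofReal r) (volume.restrict U))
    (hAww : ∀ j : Fin 3 × Fin 3, ∀ i,
      IsWeakPartial U i (wD U i fun x => A x j.1 j.2) (wD U i (wD U i fun x => A x j.1 j.2)) ∧
      MemLp (wD U i (wD U i fun x => A x j.1 j.2)) (ENNReal.ofReal r) (volume.restrict U))
    (hbd : ∀ j : Fin 3 × Fin 3, HasZeroNormalDeriv r U fun x => A x j.1 j.2)
    (hv : ∀ i, MemW0 q U fun x => v x i)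
    (hdiv : ∀ᵐ x ∂volume.restrict U, ∑ i, wD U i (fun y => v y i) x = 0)
    (hsymm : ∀ᵐ x ∂volume.restrict U, (A x).transpose = A x ∧ (A x).trace = 0)
    (hγ : ∀ j, IntegrableOn (γ j) U)
    (heq : ∀ᵐ x ∂volume.restrict U, ∀ j : Fin 3 × Fin 3, γ j x +
      ∑ i, v x i * wD U i (fun y => A y j.1 j.2) x = molecularField a b c U A x j.1 j.2) :
    ∫ x in U, ∑ j : Fin 3 × Fin 3,
      (k (field (fun j x => A x j.1 j.2) x) * A x j.1 j.2) * γ j x ≤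
      -(5 / 9 * a) * ∫ x in U, (Φ (field (fun (j : Fin 3 × Fin 3) x => A x j.1 j.2) x) - Φ 0) := by
  have hfin : IsFiniteMeasure (volume.restrict U) := ⟨by simpa using hU.volume_ne_top.lt_top⟩
  set F : Fin 3 × Fin 3 → E3 → ℝ := fun j x => A x j.1 j.2 with hF
  set G : Fin 3 × Fin 3 → Fin 3 → E3 → ℝ := fun j i => wD U i (F j) with hG
  set L : Fin 3 × Fin 3 → Fin 3 → E3 → ℝ := fun j i => wD U i (wD U i (F j)) with hL
  have hq2 : (2 : ℝ≥0∞) ≤ ENNReal.ofReal q := by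
    simpa using ENNReal.ofReal_le_ofReal hq
  have hr2 : (2 : ℝ≥0∞) ≤ ENNReal.ofReal r := by
    simpa using ENNReal.ofReal_le_ofReal hr
  have hr1 : (1 : ℝ≥0∞) ≤ ENNReal.ofReal r := one_le_two.trans hr2
  have hFi : ∀ j, IntegrableOn (F j) U := fun j => (hA j).integrable hr1
  have hGi : ∀ j i, IntegrableOn (G j i) U := fun j i => (hAw j i).2.integrable hr1
  have hLi : ∀ j i, IntegrableOn (L j i) U := fun j i => (hAww j i).2.integrable hr1
  have hFm : AEStronglyMeasurable (field F) (volume.restrict U) :=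
    aestronglyMeasurable_field fun j => (hFi j).aestronglyMeasurable
  have hkm : ∀ j, AEStronglyMeasurable (fun x => k (field F x) * F j x) (volume.restrict U) :=
    fun j => (h.contDiff.continuous.comp_aestronglyMeasurable hFm).mul (hFi j).aestronglyMeasurable
  have hk1 : ∀ j x, ‖k (field F x) * F j x‖ ≤ 1 := fun j x => h.abs_mul_apply_le (field F x) j
  obtain ⟨ρ, hρ⟩ := hU.exists_definingFunction
  choose σ hσ g hg using fun j => (hbd j).exists_isTestLimit (by linarith) hU.volume_ne_top
  choose hv1 D hD hvD happ using hv
  have hlap := h.integral_laplacian_nonpos hU.isOpen hU.isBounded hFi hGi hLi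
    (fun j i => (hAw j i).1) (fun j i => (hAww j i).1) hσ hg hρ
  have htrans := h.integral_transport_eq_zero hU.isOpen hFi (fun j => (hA j).mono_exponent hr2)
    hGi (fun j i => (hAw j i).2.mono_exponent hr2) (fun j i => (hAw j i).1)
    (v := fun i x => v x i) (D := fun i => D i i)
    (fun i => (hv1 i).mono_exponent hq2) (fun i => (hD i i).mono_exponent hq2)
    (fun i ε hε => by
      obtain ⟨δ, hδ, hδε⟩ := exists_forall_eLpNorm_le (μ := volume.restrict U) two_ne_zero hq2
        ENNReal.ofReal_ne_top hε
      obtain ⟨φ, hφ, h1, h2⟩ := happ i δ hδ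
      exact ⟨φ, hφ, hδε _ ((hv1 i).1.sub hφ.1.continuous.aestronglyMeasurable) h1,
        hδε _ ((hD i i).1.sub (continuous_partialD
          (hφ.1.of_le (by exact_mod_cast le_top)) i).aestronglyMeasurable) (h2 i)⟩)
    (by
      -- The divergence condition concerns `wD`, the zero-trace approximation concerns D; they agree
      -- almost everywhere.
      filter_upwards [hdiv, ae_all_iff.2 fun i =>
        (hvD i i).ae_eq (hvD i i).isWeakPartial_wD hU.isOpen] with x hx hx'
      rw [← hx]
      exact Finset.sum_congr rfl fun i _ => hx' i)
  have hI1 : Integrable (fun x => ∑ j, (k (field F x) * F j x) * γ j x) (volume.restrict U) :=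
    integrable_finsetSum _ fun j _ => (hγ j).bdd_mul (c := 1) (hkm j) (.of_forall (hk1 j))
  have hI2 : ∀ i, Integrable (fun x => (∑ j, (k (field F x) * F j x) * G j i x) * v x i)
      (volume.restrict U) := fun i => by
    refine integrable_mul_of_memLp_two ?_ ((hv1 i).mono_exponent hq2)
    refine memLp_finsetSum Finset.univ fun j _ => ?_
    refine ((hAw j i).2.mono_exponent hr2).of_le ((hkm j).mul (hGi j i).aestronglyMeasurable)
      (.of_forall fun x => ?_)
    rw [norm_mul]
    exact mul_le_of_le_one_left (norm_nonneg _) (hk1 j x)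
  have hI3 : ∀ i j, Integrable (fun x => (k (field F x) * F j x) * L j i x) (volume.restrict U) :=
    fun i j => Integrable.bdd_mul (c := 1) (hLi j i) (hkm j) (.of_forall (hk1 j))
  have hI4 : Integrable (fun x => Φ (field F x) - Φ 0) (volume.restrict U) := by
    refine Integrable.mono' (integrable_finsetSum Finset.univ fun j _ => (hFi j).abs)
      ((h.continuous.comp_aestronglyMeasurable hFm).sub aestronglyMeasurable_const)
      (.of_forall fun x => ?_)
    rw [Real.norm_of_nonneg (sub_nonneg.2 (h.map_zero_le _))]
    exact (h.sub_map_zero_le_norm _).trans (norm_le_sum_abs _)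
  have hI2s := integrable_finsetSum Finset.univ fun i _ => hI2 i
  have hI3s := integrable_finsetSum Finset.univ fun i _ =>
    integrable_finsetSum Finset.univ fun j _ => hI3 i j
  -- The equation contracted with k(Q) Q. Coercivity of the bulk term followed by Φ(X) - Φ(0) ≤
  -- k(X)|X|² gives the damping; the Laplacian and transport sums are signed only after integration.
  have hpt : ∀ᵐ x ∂volume.restrict U, ∑ j, (k (field F x) * F j x) * γ j x ≤
      -(5 / 9 * a) * (Φ (field F x) - Φ 0) +
        ∑ i, ∑ j, (k (field F x) * F j x) * L j i x -
        ∑ i, (∑ j, (k (field F x) * F j x) * G j i x) * v x i := by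
    filter_upwards [heq, hsymm] with x hx hs
    have hvec : field F x = vec (A x) := rfl
    have h1 := inner_bulkField_le ha hc hac (A x) hs.1 hs.2
    have h2 := h.sub_map_zero_le (field F x)
    have h3 := sum_field_mul_molecularField (U := U) (a := a) (b := b) (c := c) (A := A) x
    have h4 : ∑ j, (k (field F x) * F j x) * γ j x =
        k (field F x) * ∑ j : Fin 3 × Fin 3, A x j.1 j.2 * molecularField a b c U A x j.1 j.2
          - ∑ i, (∑ j, (k (field F x) * F j x) * G j i x) * v x i := by
      simp_rw [Finset.sum_mul]
      rw [Finset.sum_comm, Finset.mul_sum, ← Finset.sum_sub_distrib]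
      refine Finset.sum_congr rfl fun j _ => ?_
      rw [← hx j, mul_add, mul_add, Finset.mul_sum, Finset.mul_sum, mul_assoc, add_sub_assoc,
        ← Finset.sum_sub_distrib, Finset.sum_eq_zero, add_zero]
      intro i _
      simp only [hF, hG]
      ring
    have h5 : k (field F x) * ∑ i, ∑ j, F j x * L j i x =
        ∑ i, ∑ j, (k (field F x) * F j x) * L j i x := by
      simp_rw [Finset.mul_sum, mul_assoc]
    rw [h4, h3, mul_add, ← h5]
    have h6 := mul_le_mul_of_nonneg_left h1 (h.nonneg (field F x))
    rw [← hvec] at h6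
    have h7 := mul_le_mul_of_nonneg_left h2 (by positivity : 0 ≤ 5 / 9 * a)
    have h8 : k (field F x) * (-(5 / 9 * a) * ‖field F x‖ ^ 2) =
      -(5 / 9 * a * (k (field F x) * ‖field F x‖ ^ 2)) := by ring
    rw [h8] at h6
    have h9 : -(5 / 9 * a) * (Φ (field F x) - Φ 0) = -(5 / 9 * a * (Φ (field F x) - Φ 0)) := by
      ring
    rw [h9]
    refine sub_le_sub_right (add_le_add (h6.trans (neg_le_neg h7)) le_rfl) _
  refine (integral_mono_ae hI1 (((hI4.const_mul _).add hI3s).sub hI2s) hpt).trans ?_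
  have hsplit : ∫ x in U, (-(5 / 9 * a) * (Φ (field F x) - Φ 0) +
        ∑ i, ∑ j, (k (field F x) * F j x) * L j i x -
        ∑ i, (∑ j, (k (field F x) * F j x) * G j i x) * v x i) =
      -(5 / 9 * a) * (∫ x in U, (Φ (field F x) - Φ 0)) +
        (∑ i, ∑ j, ∫ x in U, (k (field F x) * F j x) * L j i x) -
        ∑ i, ∫ x in U, (∑ j, (k (field F x) * F j x) * G j i x) * v x i := by
    have hI5 : Integrable (fun x => -(5 / 9 * a) * (Φ (field F x) - Φ 0) +
        ∑ i, ∑ j, (k (field F x) * F j x) * L j i x) (volume.restrict U) :=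
      (hI4.const_mul _).add hI3s
    rw [integral_sub hI5 hI2s, integral_add (hI4.const_mul _) hI3s,
      integral_const_mul, integral_finsetSum _ fun i _ => hI2 i, integral_finsetSum _ fun i _ =>
      integrable_finsetSum Finset.univ fun j _ => hI3 i j]
    simp_rw [integral_finsetSum Finset.univ fun j _ => hI3 _ j]
  refine hsplit.le.trans ?_
  rw [htrans]
  linarith

end Slices

/-! ### Decay of the entropies -/

section Decay

/-- Iterating the implicit Euler inequality over n steps of length t/n gives y(t)(1 + Ct/n)ⁿ ≤ y(0),
and n → ∞ produces the exponential. No regularity of y is needed. -/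
lemma le_exp_mul_of_forall_mul_le {y : ℝ → ℝ} {C : ℝ} (hC : 0 < C)
    (h : ∀ s t, 0 ≤ s → s < t → y t * (1 + C * (t - s)) ≤ y s) {t : ℝ} (ht : 0 ≤ t) :
    y t ≤ Real.exp (-C * t) * y 0 := by
  rcases ht.eq_or_lt with rfl | ht
  · simp
  have hiter : ∀ (h' : ℝ), 0 < h' → ∀ n : ℕ, y (n * h') * (1 + C * h') ^ n ≤ y 0 := by
    intro h' hh n
    induction n with
    | zero => simp
    | succ n ih =>
      have h1 := h (n * h') ((n + 1 : ℕ) * h') (by positivity) (by push_cast; linarith)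
      rw [show ((n + 1 : ℕ) : ℝ) * h' - n * h' = h' by push_cast; ring] at h1
      rw [pow_succ', ← mul_assoc]
      exact (mul_le_mul_of_nonneg_right h1 (by positivity)).trans ih
  have hlim := (Real.tendsto_one_add_div_pow_exp (C * t)).const_mul (y t)
  have hle : y t * Real.exp (C * t) ≤ y 0 := by
    refine le_of_tendsto hlim ?_
    filter_upwards [eventually_gt_atTop 0] with n hn
    have hn' : (0 : ℝ) < n := by exact_mod_cast hn
    have h1 := hiter (t / n) (by positivity) n
    rwa [mul_div_cancel₀ _ hn'.ne', ← mul_div_assoc] at h1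
  rw [neg_mul, Real.exp_neg, inv_mul_eq_div, le_div_iff₀ (Real.exp_pos _)]
  exact hle

variable {a b c m q r : ℝ} {U : Set E3} {u₀ : E3 → Fin 3 → ℝ} {Q₀ : E3 → Mat3}
  {u : ℝ → E3 → Fin 3 → ℝ} {Q : ℝ → E3 → Mat3} {π : ℝ → E3 → ℝ}
  {Φ k : EuclideanSpace ℝ (Fin 3 × Fin 3) → ℝ}

lemma IsStrongSolution.integrable_entropy (hs : IsStrongSolution a b c m q r U u₀ Q₀ u Q π)
    (hU : volume U ≠ ⊤) (hr : 1 ≤ r) (h : IsRadialEntropy Φ k) {t : ℝ} (ht : 0 ≤ t) :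
    Integrable (fun x => Φ (vec (Q t x)) - Φ 0) (volume.restrict U) := by
  have hfin : IsFiniteMeasure (volume.restrict U) := ⟨by simpa using hU.lt_top⟩
  have hQ : ∀ j : Fin 3 × Fin 3, IntegrableOn (fun x => Q t x j.1 j.2) U := fun j =>
    (hs.Q_cont j.1 j.2 t ht).1.integrable (by simpa using hr)
  have hm : AEStronglyMeasurable (field fun (j : Fin 3 × Fin 3) x => Q t x j.1 j.2)
    (volume.restrict U) := aestronglyMeasurable_field fun j => (hQ j).aestronglyMeasurable
  refine Integrable.mono' (integrable_finsetSum Finset.univ fun j _ => (hQ j).abs)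
    ((h.continuous.comp_aestronglyMeasurable hm).sub aestronglyMeasurable_const)
    (.of_forall fun x => ?_)
  rw [Real.norm_of_nonneg (sub_nonneg.2 (h.map_zero_le _))]
  exact (h.sub_map_zero_le_norm _).trans (norm_le_sum_abs _)

/-- Exponential decay of the entropies of the order parameter. -/
lemma IsStrongSolution.integral_entropy_le (hs : IsStrongSolution a b c m q r U u₀ Q₀ u Q π)
    (hU : IsC3Domain U) (ha : 0 < a) (hc : 0 < c) (hac : 9 / 16 * b ^ 2 ≤ a * c) (hm : 1 < m)
    (hq : 2 ≤ q) (hr : 3 ≤ r) (h : IsRadialEntropy Φ k) {t : ℝ} (ht : 0 ≤ t) :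
    ∫ x in U, (Φ (vec (Q t x)) - Φ 0) ≤
      Real.exp (-(5 / 9 * a) * t) * ∫ x in U, (Φ (vec (Q 0 x)) - Φ 0) := by
  have hUo := hU.isOpen
  have hm0 : 0 < m := by linarith
  have hr1 : 1 ≤ r := by linarith
  choose g hg hgT using fun j : Fin 3 × Fin 3 => hs.Q_time j.1 j.2
  have hint : ∀ {F : ℝ → E3 → ℝ}, (∀ T, 0 < T → MemLL m r U T F) → ∀ T, Integrable
      (Function.uncurry F) ((volume.restrict (Ioo 0 T)).prod (volume.restrict U)) := fun hF T => by
    rcases le_or_gt T 0 with hT | hT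
    · simp [Ioo_eq_empty (not_lt.2 hT)]
    · exact (hF T hT).integrable hm.le hr1 hU.volume_ne_top
  have hreg : ∀ j : Fin 3 × Fin 3, IsTimeRegular U (fun t x => Q t x j.1 j.2) (g j) := fun j =>
    (hs.Q_cont j.1 j.2).isTimeRegular hr1 hU.volume_ne_top (hg j)
      (hint fun T hT => (hs.Q_space T hT j.1 j.2).memLL) (hint fun T hT => (hgT j T hT).memLL)
  set y : ℝ → ℝ := fun t => ∫ x in U, (Φ (vec (Q t x)) - Φ 0) with hy
  set P : ℝ → ℝ := fun t => ∫ x in U, ∑ j : Fin 3 × Fin 3,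
    (k (vec (Q t x)) * Q t x j.1 j.2) * g j t x with hP
  have hy0 : ∀ t, 0 ≤ y t := fun t => integral_nonneg fun x => sub_nonneg.2 (h.map_zero_le _)
  have hfin : IsFiniteMeasure (volume.restrict U) :=
    ⟨by simpa using hU.volume_ne_top.lt_top⟩
  have hchain : ∀ s t, 0 ≤ s → s < t → IntegrableOn P (Ioc s t) ∧
      y t - y s = ∫ τ in Ioc s t, P τ := fun s t hs' hst =>
    h.integral_sub_eq hUo hreg hs' hst
  have hprod : ∀ᵐ t ∂volume.restrict (Ioi (0 : ℝ)), P t ≤ -(5 / 9 * a) * y t := by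
    have hw : ∀ᵐ t ∂volume.restrict (Ioi (0 : ℝ)), ∀ j : Fin 3 × Fin 3, ∀ i,
        IsWeakPartial U i (fun x => Q t x j.1 j.2) (wD U i fun x => Q t x j.1 j.2) ∧
        MemLp (wD U i fun x => Q t x j.1 j.2) (ENNReal.ofReal r) (volume.restrict U) :=
      ae_restrict_Ioi_of_forall fun T hT => ae_all_iff.2 fun j =>
        (hs.Q_space T hT j.1 j.2).ae_wD hUo hm0 hr1
    have hww : ∀ᵐ t ∂volume.restrict (Ioi (0 : ℝ)), ∀ j : Fin 3 × Fin 3, ∀ i,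
        IsWeakPartial U i (wD U i fun x => Q t x j.1 j.2)
          (wD U i (wD U i fun x => Q t x j.1 j.2)) ∧
        MemLp (wD U i (wD U i fun x => Q t x j.1 j.2)) (ENNReal.ofReal r) (volume.restrict U) :=
      ae_restrict_Ioi_of_forall fun T hT => ae_all_iff.2 fun j =>
        (hs.Q_space T hT j.1 j.2).ae_wD_wD hUo hm0 hr1
    have hgt : ∀ᵐ t ∂volume.restrict (Ioi (0 : ℝ)), ∀ j : Fin 3 × Fin 3,
        MemLp (g j t) (ENNReal.ofReal r) (volume.restrict U) :=
      ae_restrict_Ioi_of_forall fun T hT => ae_all_iff.2 fun j =>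
        (hgT j T hT).memLL.ae_memLp hm0 hr1
    filter_upwards [hw, hww, hgt, hs.u_boundary, hs.Q_boundary, hs.Q_eq, hs.div_free,
      ae_all_iff.2 fun j => (hg j).ae_ae_wDt_eq hUo, ae_restrict_mem measurableSet_Ioi]
      with t hwt hwwt hgt hut hQt heq hdiv hdt ht0
    refine h.integral_production_le hU ha hc hac hq (by linarith : 2 ≤ r)
      (fun j => (hs.Q_cont j.1 j.2 t (le_of_lt ht0)).1) hwt hwwt (fun j => hQt j.1 j.2) hut hdiv
      (hs.Q_symm_traceless t (le_of_lt ht0)) (fun j => (hgt j).integrable (by simpa using hr1)) ?_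
    filter_upwards [heq, ae_all_iff.2 hdt] with x hx hx' j
    rw [← hx' j, ← hx j.1 j.2]
  have hprod' : ∀ s t, 0 ≤ s → ∀ᵐ τ ∂volume.restrict (Ioc s t), P τ ≤ -(5 / 9 * a) * y τ :=
    fun s t hs' => ae_restrict_of_ae_restrict_of_subset
      (fun τ hτ => hs'.trans_lt hτ.1) hprod
  -- Monotonicity comes first: it bounds the production at every τ in (s, t] by the value at the
  -- right endpoint, which is the form of the implicit Euler inequality.
  have hanti : ∀ s t, 0 ≤ s → s ≤ t → y t ≤ y s := fun s t hs' hst => by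
    rcases hst.eq_or_lt with rfl | hst
    · exact le_rfl
    rw [← sub_nonpos, (hchain s t hs' hst).2]
    refine integral_nonpos_of_ae ?_
    filter_upwards [hprod' s t hs'] with τ hτ
    refine hτ.trans ?_
    have := mul_nonneg (by positivity : 0 ≤ 5 / 9 * a) (hy0 τ)
    simp only [Pi.zero_apply]
    linarith
  refine le_exp_mul_of_forall_mul_le (y := y) (by positivity)
    (fun s t hs' hst => ?_) ht
  have h1 : y t - y s ≤ ∫ τ in Ioc s t, -(5 / 9 * a) * y t := by
    rw [(hchain s t hs' hst).2]
    refine integral_mono_ae (hchain s t hs' hst).1 (integrable_const _) ?_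
    filter_upwards [hprod' s t hs', ae_restrict_mem measurableSet_Ioc] with τ hτ hmem
    refine hτ.trans ?_
    have := mul_le_mul_of_nonneg_left (hanti τ t (hs'.trans hmem.1.le) hmem.2)
      (by positivity : 0 ≤ 5 / 9 * a)
    linarith
  rw [setIntegral_const, Real.volume_real_Ioc_of_le hst.le, smul_eq_mul] at h1
  linarith

/-- Decay of the truncated `L¹` norms. -/
lemma IsStrongSolution.lintegral_sub_le (hs : IsStrongSolution a b c m q r U u₀ Q₀ u Q π)
    (hU : IsC3Domain U) (ha : 0 < a) (hc : 0 < c) (hac : 9 / 16 * b ^ 2 ≤ a * c) (hm : 1 < m)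
    (hq : 2 ≤ q) (hr : 3 ≤ r) {l : ℝ} (hl : 0 ≤ l) {t : ℝ} (ht : 0 ≤ t) :
    ∫⁻ x in U, ENNReal.ofReal (frob (Q t x) - l) ≤
      ENNReal.ofReal (Real.exp (-(5 / 9 * a) * t)) *
        ∫⁻ x in U, ENNReal.ofReal (frob (Q 0 x) - l) := by
  have hfin : IsFiniteMeasure (volume.restrict U) := ⟨by simpa using hU.volume_ne_top.lt_top⟩
  have hI : ∀ τ, 0 ≤ τ → Integrable (fun x => max (frob (Q τ x) - l) 0) (volume.restrict U) := by
    intro τ hτ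
    have hQ : ∀ j : Fin 3 × Fin 3, IntegrableOn (fun x => Q τ x j.1 j.2) U := fun j =>
      (hs.Q_cont j.1 j.2 τ hτ).1.integrable (by simpa using (by linarith : 1 ≤ r))
    have hQm : AEStronglyMeasurable (field fun (j : Fin 3 × Fin 3) x => Q τ x j.1 j.2)
      (volume.restrict U) := aestronglyMeasurable_field fun j => (hQ j).aestronglyMeasurable
    have hQi : Integrable (fun x => ‖vec (Q τ x)‖) (volume.restrict U) :=
      Integrable.mono' (integrable_finsetSum Finset.univ fun j _ => (hQ j).abs) hQm.norm
        (.of_forall fun x => by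
          rw [norm_norm]
          exact norm_le_sum_abs _)
    simp_rw [norm_vec] at hQi
    exact (hQi.sub (integrable_const l)).pos_part
  have hreal : ∫ x in U, max (frob (Q t x) - l) 0 ≤
      Real.exp (-(5 / 9 * a) * t) * ∫ x in U, max (frob (Q 0 x) - l) 0 := by
    set V := volume.real U with hV
    set e := Real.exp (-(5 / 9 * a) * t) with he
    have he1 : 0 ≤ e := (Real.exp_pos _).le
    -- Each use of the smooth entropy costs at most 2δ per unit volume: at time t through the
    -- subtracted value at 0, at time 0 through the approximation error.
    have key : ∀ δ, 0 < δ → ∫ x in U, max (frob (Q t x) - l) 0 ≤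
        e * (∫ x in U, max (frob (Q 0 x) - l) 0) + (2 * V + e * (2 * V)) * δ := by
      intro δ hδ
      have hΦ := isRadialEntropy_truncNorm (V := EuclideanSpace ℝ (Fin 3 × Fin 3)) hδ l
      have hd := hs.integral_entropy_le hU ha hc hac hm hq hr hΦ ht
      have hΦ0 : truncNorm δ l (0 : EuclideanSpace ℝ (Fin 3 × Fin 3)) ≤ 2 * δ := by
        have := truncNorm_le hδ l (0 : EuclideanSpace ℝ (Fin 3 × Fin 3))
        rwa [norm_zero, zero_sub, max_eq_right (by linarith), zero_add] at this
      have hΦ0' : 0 ≤ truncNorm δ l (0 : EuclideanSpace ℝ (Fin 3 × Fin 3)) :=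
        (le_max_right _ _).trans (max_le_truncNorm δ l (0 : EuclideanSpace ℝ (Fin 3 × Fin 3)))
      have hi := fun τ hτ => hs.integrable_entropy hU.volume_ne_top (by linarith) hΦ (t := τ) hτ
      have h1 : ∫ x in U, max (frob (Q t x) - l) 0 ≤
          ∫ x in U, ((truncNorm δ l (vec (Q t x)) -
            truncNorm δ l (0 : EuclideanSpace ℝ (Fin 3 × Fin 3))) + 2 * δ) := by
        refine integral_mono (hI t ht) ((hi t ht).add (integrable_const _)) fun x => ?_
        have := max_le_truncNorm δ l (vec (Q t x))
        rw [norm_vec] at this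
        simp only
        linarith
      have h2 : ∫ x in U, (truncNorm δ l (vec (Q 0 x)) -
          truncNorm δ l (0 : EuclideanSpace ℝ (Fin 3 × Fin 3))) ≤
          ∫ x in U, (max (frob (Q 0 x) - l) 0 + 2 * δ) := by
        refine integral_mono (hi 0 le_rfl) ((hI 0 le_rfl).add (integrable_const _)) fun x => ?_
        have := truncNorm_le hδ l (vec (Q 0 x))
        rw [norm_vec] at this
        simp only
        linarith
      rw [integral_add (hi t ht) (integrable_const _), setIntegral_const, smul_eq_mul] at h1
      rw [integral_add (hI 0 le_rfl) (integrable_const _), setIntegral_const, smul_eq_mul] at h2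
      have h3 := mul_le_mul_of_nonneg_left h2 he1
      linarith
    have hlim : Tendsto (fun δ => e * (∫ x in U, max (frob (Q 0 x) - l) 0) +
        (2 * V + e * (2 * V)) * δ) (𝓝[>] 0) (𝓝 (e * (∫ x in U, max (frob (Q 0 x) - l) 0) +
        (2 * V + e * (2 * V)) * 0)) :=
      (Continuous.tendsto (by fun_prop) 0).mono_left nhdsWithin_le_nhds
    rw [mul_zero, add_zero] at hlim
    refine ge_of_tendsto hlim ?_
    filter_upwards [self_mem_nhdsWithin] with δ hδ using key δ hδ
  have hcast : ∀ τ, 0 ≤ τ → ∫⁻ x in U, ENNReal.ofReal (frob (Q τ x) - l) =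
      ENNReal.ofReal (∫ x in U, max (frob (Q τ x) - l) 0) := fun τ hτ => by
    rw [ofReal_integral_eq_lintegral_ofReal (hI τ hτ) (.of_forall fun x => le_max_right _ _)]
    refine lintegral_congr fun x => ?_
    rw [ENNReal.ofReal_max, ENNReal.ofReal_zero, max_eq_left zero_le]
  rw [hcast t ht, hcast 0 le_rfl, ← ENNReal.ofReal_mul (Real.exp_pos _).le]
  exact ENNReal.ofReal_le_ofReal hreal

end Decay

/-! ### From truncated `L¹` norms to `L^p` norms -/

section LayerCake

/-- Taylor's formula with integral remainder for X^p at 0: the weight is the second derivative of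
the power. It expresses the power as a positive superposition of the truncations (X - l)₊. -/
lemma lintegral_rpow_mul_sub {p : ℝ} (hp : 2 ≤ p) {X : ℝ} (hX : 0 ≤ X) :
    ∫⁻ l in Ioi (0 : ℝ), ENNReal.ofReal (p * (p - 1) * l ^ (p - 2)) * ENNReal.ofReal (X - l) =
      ENNReal.ofReal (X ^ p) := by
  have hcont : ∀ s : ℝ, 0 ≤ s → Continuous fun l : ℝ => l ^ s := fun s hs =>
    Real.continuous_rpow_const hs
  have hFTC : ∫ l in (0 : ℝ)..X, p * (p - 1) * l ^ (p - 2) * (X - l) = X ^ p := by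
    have h1 := intervalIntegral.integral_eq_sub_of_hasDerivAt_of_le hX
      -- This primitive vanishes at 0 and equals X^p at l = X.
      (f := fun l => p * X * l ^ (p - 1) - (p - 1) * l ^ p)
      (f' := fun l => p * (p - 1) * l ^ (p - 2) * (X - l)) ?_ ?_ ?_
    · rw [h1, Real.zero_rpow (by linarith), Real.zero_rpow (by linarith), Real.rpow_sub_one' hX
        (by linarith)]
      rcases hX.eq_or_lt with rfl | hX
      · rw [Real.zero_rpow (by linarith)]
        ring
      · field_simp
        ring
    · exact ((continuous_const.mul (hcont _ (by linarith))).sub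
        (continuous_const.mul (hcont _ (by linarith)))).continuousOn
    · intro l hl
      have h2 := ((Real.hasDerivAt_rpow_const (x := l) (p := p - 1) (.inl hl.1.ne')).const_mul
        (p * X)).sub ((Real.hasDerivAt_rpow_const (x := l) (p := p) (.inl hl.1.ne')).const_mul
        (p - 1))
      refine h2.congr_deriv ?_
      rw [show p - 1 - 1 = p - 2 by ring, show p - 1 = p - 2 + 1 by ring,
        Real.rpow_add_one hl.1.ne']
      ring
    · exact Continuous.intervalIntegrable
        ((continuous_const.mul (hcont _ (by linarith))).mul (by fun_prop)) _ _
  have hsplit : ∫⁻ l in Ioi (0 : ℝ),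
      ENNReal.ofReal (p * (p - 1) * l ^ (p - 2)) * ENNReal.ofReal (X - l) =
      ∫⁻ l in Ioc 0 X, ENNReal.ofReal (p * (p - 1) * l ^ (p - 2) * (X - l)) := by
    rw [← Ioc_union_Ioi_eq_Ioi hX, lintegral_union measurableSet_Ioi
      (disjoint_left.2 fun l hl hl' => not_lt.2 hl.2 hl'), setLIntegral_congr_fun
      (g := fun _ => 0) measurableSet_Ioi, lintegral_zero, add_zero]
    · refine setLIntegral_congr_fun measurableSet_Ioc fun l hl => ?_
      have := Real.rpow_nonneg hl.1.le (p - 2)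
      have h2 : 0 ≤ p * (p - 1) := mul_nonneg (by linarith) (by linarith)
      exact (ENNReal.ofReal_mul (mul_nonneg h2 this)).symm
    · intro l hl
      simp only
      rw [ENNReal.ofReal_of_nonpos (p := X - l) (by linarith [mem_Ioi.1 hl]), mul_zero]
  rw [hsplit, ← hFTC, intervalIntegral.integral_of_le hX, ofReal_integral_eq_lintegral_ofReal]
  · exact (Continuous.intervalIntegrable
        ((continuous_const.mul (hcont _ (by linarith))).mul (by fun_prop)) _ _).1
  · filter_upwards [ae_restrict_mem measurableSet_Ioc] with l hl
    have := Real.rpow_nonneg hl.1.le (p - 2)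
    have h2 : 0 ≤ p * (p - 1) := mul_nonneg (by linarith) (by linarith)
    exact mul_nonneg (mul_nonneg h2 this) (by linarith [hl.2])

/-- A bound on all truncated `L¹` norms implies the same bound on the `p`-th moment. -/
lemma lintegral_rpow_le_of_forall_lintegral_sub_le {α : Type*} [MeasurableSpace α] {μ : Measure α}
    [SFinite μ] {X Y : α → ℝ} (hX : AEMeasurable X μ) (hY : AEMeasurable Y μ)
    (hX0 : ∀ x, 0 ≤ X x) (hY0 : ∀ x, 0 ≤ Y x) {K : ℝ≥0∞} (hK : K ≠ ⊤)
    (h : ∀ l : ℝ, 0 ≤ l → ∫⁻ x, ENNReal.ofReal (X x - l) ∂μ ≤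
      K * ∫⁻ x, ENNReal.ofReal (Y x - l) ∂μ) {p : ℝ} (hp : 2 ≤ p) :
    ∫⁻ x, ENNReal.ofReal (X x ^ p) ∂μ ≤ K * ∫⁻ x, ENNReal.ofReal (Y x ^ p) ∂μ := by
  have hw : Measurable fun l : ℝ => ENNReal.ofReal (p * (p - 1) * l ^ (p - 2)) := by fun_prop
  have key : ∀ {Z : α → ℝ}, AEMeasurable Z μ → (∀ x, 0 ≤ Z x) →
      ∫⁻ x, ENNReal.ofReal (Z x ^ p) ∂μ = ∫⁻ l in Ioi (0 : ℝ),
        ENNReal.ofReal (p * (p - 1) * l ^ (p - 2)) * ∫⁻ x, ENNReal.ofReal (Z x - l) ∂μ := by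
    intro Z hZ hZ0
    simp_rw [← lintegral_rpow_mul_sub hp (hZ0 _)]
    rw [lintegral_lintegral_swap]
    · refine lintegral_congr fun l => ?_
      rw [lintegral_const_mul' _ _ ENNReal.ofReal_ne_top]
    · exact (hw.comp measurable_snd).aemeasurable.mul
        ((hZ.comp_fst).sub measurable_snd.aemeasurable).ennreal_ofReal
  rw [key hX hX0, key hY hY0, ← lintegral_const_mul' _ _ hK]
  refine setLIntegral_mono' measurableSet_Ioi fun l hl => ?_
  rw [mul_left_comm]
  exact mul_le_mul_right (h l (le_of_lt hl)) _

lemma eLpNorm_eq_lintegral_ofReal_rpow {α : Type*} [MeasurableSpace α] {μ : Measure α}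
    {X : α → ℝ} (hX : ∀ x, 0 ≤ X x) {p : ℝ} (hp : 0 < p) :
    eLpNorm X (ENNReal.ofReal p) μ = (∫⁻ x, ENNReal.ofReal (X x ^ p) ∂μ) ^ (1 / p) := by
  rw [eLpNorm_eq_lintegral_rpow_enorm_toReal (by simpa using hp) ENNReal.ofReal_ne_top,
    ENNReal.toReal_ofReal hp.le]
  congr 1
  refine lintegral_congr fun x => ?_
  rw [Real.enorm_eq_ofReal (hX x), ENNReal.ofReal_rpow_of_nonneg (hX x) hp.le]

end LayerCake

/-! ### Conclusion: decay of the L^p norm. -/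

lemma frob_nonneg (A : Mat3) : 0 ≤ frob A := Real.sqrt_nonneg _

lemma IsStrongSolution.aemeasurable_frob {a b c m q r : ℝ} {U : Set E3} {u₀ : E3 → Fin 3 → ℝ}
    {Q₀ : E3 → Mat3} {u : ℝ → E3 → Fin 3 → ℝ} {Q : ℝ → E3 → Mat3} {π : ℝ → E3 → ℝ}
    (hs : IsStrongSolution a b c m q r U u₀ Q₀ u Q π) {t : ℝ} (ht : 0 ≤ t) :
    AEMeasurable (fun x => frob (Q t x)) (volume.restrict U) := by
  have hm : AEStronglyMeasurable (field fun (j : Fin 3 × Fin 3) x => Q t x j.1 j.2)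
    (volume.restrict U) := aestronglyMeasurable_field fun j => (hs.Q_cont j.1 j.2 t ht).1.1
  have h := hm.norm.aemeasurable
  refine h.congr (.of_forall fun x => ?_)
  exact norm_vec (Q t x)

/-- Exponential decay of the `L^p` norm of the order parameter, with rate `5a / (9p)`. -/
lemma IsStrongSolution.eLpNorm_frob_le {a b c m q r : ℝ} {U : Set E3} {u₀ : E3 → Fin 3 → ℝ}
    {Q₀ : E3 → Mat3} {u : ℝ → E3 → Fin 3 → ℝ} {Q : ℝ → E3 → Mat3} {π : ℝ → E3 → ℝ}
    (hs : IsStrongSolution a b c m q r U u₀ Q₀ u Q π) (hU : IsC3Domain U) (ha : 0 < a)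
    (hc : 0 < c) (hac : 9 / 16 * b ^ 2 ≤ a * c) (hm : 1 < m) (hq : 2 ≤ q) (hr : 3 ≤ r) {p : ℝ}
    (hp : 2 ≤ p) {t : ℝ} (ht : 0 ≤ t) :
    eLpNorm (fun x => frob (Q t x)) (ENNReal.ofReal p) (volume.restrict U) ≤
      ENNReal.ofReal (Real.exp (-(5 / 9 * a / p) * t)) *
        eLpNorm (fun x => frob (Q₀ x)) (ENNReal.ofReal p) (volume.restrict U) := by
  have hp0 : 0 < p := by linarith
  have hinit : eLpNorm (fun x => frob (Q₀ x)) (ENNReal.ofReal p) (volume.restrict U) =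
      eLpNorm (fun x => frob (Q 0 x)) (ENNReal.ofReal p) (volume.restrict U) := by
    refine eLpNorm_congr_ae ?_
    filter_upwards [hs.Q_init] with x hx
    rw [hx]
  have hmom := lintegral_rpow_le_of_forall_lintegral_sub_le (hs.aemeasurable_frob ht)
    (hs.aemeasurable_frob le_rfl) (fun x => frob_nonneg _) (fun x => frob_nonneg _)
    ENNReal.ofReal_ne_top
    (fun l hl => hs.lintegral_sub_le hU ha hc hac hm hq hr hl ht) hp
  rw [hinit, eLpNorm_eq_lintegral_ofReal_rpow (fun x => frob_nonneg _) hp0,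
    eLpNorm_eq_lintegral_ofReal_rpow (fun x => frob_nonneg _) hp0]
  -- The p-th moment decays at the rate 5a/9, independent of p; the p-th root divides the rate by p.
  refine (ENNReal.rpow_le_rpow hmom (by positivity)).trans ?_
  rw [ENNReal.mul_rpow_of_nonneg _ _ (by positivity),
    ENNReal.ofReal_rpow_of_pos (Real.exp_pos _), ← Real.exp_mul]
  refine le_of_eq ?_
  congr 3
  ring

end BerisEdwards

theorem proposition4p1 (a b c p : ℝ) (ha : 0 < a) (hc : 0 < c)
    (hac : 9 / 16 * b ^ 2 ≤ a * c) (hp : 2 ≤ p) :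
    ∃ C : ℝ, 0 < C ∧
      ∀ (m q r : ℝ), 1 < m → 2 ≤ q → 3 ≤ r →
      ∀ (U : Set BerisEdwards.E3), BerisEdwards.IsC3Domain U →
      ∀ (u₀ : BerisEdwards.E3 → Fin 3 → ℝ) (Q₀ : BerisEdwards.E3 → BerisEdwards.Mat3)
        (u : ℝ → BerisEdwards.E3 → Fin 3 → ℝ) (Q : ℝ → BerisEdwards.E3 → BerisEdwards.Mat3)
        (π : ℝ → BerisEdwards.E3 → ℝ),
        BerisEdwards.IsStrongSolution a b c m q r U u₀ Q₀ u Q π →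
        MemLp (fun x => BerisEdwards.frob (Q₀ x)) (ENNReal.ofReal p) (volume.restrict U) →
        ∀ t : ℝ, 0 ≤ t →
          eLpNorm (fun x => BerisEdwards.frob (Q t x)) (ENNReal.ofReal p) (volume.restrict U)
            ≤ ENNReal.ofReal (Real.exp (-C * t)) *
              eLpNorm (fun x => BerisEdwards.frob (Q₀ x)) (ENNReal.ofReal p)
                (volume.restrict U) := by
  refine ⟨5 / 9 * a / p, div_pos (by positivity) (by linarith), ?_⟩
  intro m q r hm hq hr U hU u₀ Q₀ u Q π hs _ t ht
  exact hs.eLpNorm_frob_le hU ha hc hac hm hq hr hp ht
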